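/- **Setting.** Fix $d\ge 1$. For an integer $\mathcal N\ge 1$ let $\mathbb T_d=(\mathbb Z/(2\mathcal N+1))^d$, and let $n_{p}\in\{-\mathcal N,\dots,\mathcal N\}^d$ be the coordinates of $p\in\mathbb T_d$. Let $F$ be a real antisymmetric $d\times d$ matrix with entries in $\frac{2}{2\mathcal N+1}\mathbb Z$. Let $\Omega_{\rm per}$ be the set of $(2\mathcal N+1)$-periodic $\omega\in[-\frac12,\frac12]^{\mathbb Z^d}$, with translations $(\mathfrak t_m\omega)_n=\omega_{n+m}$; it is identified with $[-\frac12,\frac12]^{\mathbb T_d}$, and $dP(\omega)=\prod_{p\in\mathbb T_d}d\omega_p$. The periodic algebra $C^*(\Omega_{\rm per}\times\mathbb Z^d,F)$ is the completion of the continuous compactly supported functions on $\Omega_{\rm per}\times\mathbb Z^d$ with product $(f*g)(\omega,n)=\sum_m f(\omega,m)g(\mathfrak t_m^{-1}\omega,n-m)e^{i\pi n\cdot F\cdot m}$ in the norm $\sup_\omega\|\pi_\omega f\|$, where $(\pi_\omega f\,\phi)(n)=\sum_m f(\mathfrak t_n^{-1}\omega,m-n)e^{i\pi m\cdot F\cdot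 n}\phi(m)$ on $\ell^2(\mathbb Z^d)$. The torus algebra $C^*(\Omega\times\mathbb T_d,F)$ is defined by the same formulas with $\mathbb T_d$ in place of $\mathbb Z^d$, the rotations of $\mathbb T_d$ in place of $\mathfrak t$, and phases $e^{i\pi n_p\cdot F\cdot n_q}$. Put $\mathcal T_{\rm per}(f)=\int f(\omega,0)\,dP$ and $\mathcal T_{\mathbb T}(\tilde f)=\int\tilde f(\omega,0)\,dP$, $(Pf)(\omega,p)=f(\omega,n_p)$, $(J\tilde f)(\omega,n)=\sum_{q}\delta_{n,n_q}\tilde f(\omega,q)$. Let $h(\omega,n)=\delta_{|n|,1}+W\omega_n\delta_{n,0}$ ($W\in\mathbb R$), restricted to $\Omega_{\rm per}$, and $\tilde h=Ph$ (so $J\tilde h=h$). For a multi-index $\alpha\in\mathbb N^d$ let $\partial_\alpha f(\omega,n)=\prod_j(in_j)^{\alpha_j}f(\omega,n)$ and $\tilde\partial_\alpha\tilde f(\omega,p)=\prod_j(i\mathfrak x(p_j))^{\alpha_j}\tilde f(\omega,p)$, where $\mathfrak x:\mathbb Z/(2\mathcal N+1)\to\mathbb R$ satisfies $\mathfrak x(p)=n_p$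 if $|n_p|<\mathcal N/\sqrt2$, and $|\mathfrak x(p)|\le|n_p|$ for all $p$. For $\Phi$ analytic on $\{z:\mathrm{dist}(z,\sigma)\le\kappa\}$, where $\sigma=\sigma(h)=\sigma(J\tilde h)$ is the spectrum in the periodic algebra, let $\bar\Phi=\frac1{2\pi}\int_{\mathrm{dist}(z,\sigma)=\kappa}|\Phi(z)|\,|dz|$. **Theorem.** Let $N\ge 0$, multi-indices $\alpha_1,\dots,\alpha_N$, $\kappa\in\mathbb R$ and $0<\xi<\sinh^{-1}(\kappa/2d)$ be given. There are finite constants $\mathfrak B_3,\mathfrak B_4$, depending only on $d,N,\kappa,\xi,\alpha_1,\dots,\alpha_N$ (not on $\mathcal N$, $F$, $W$, $\mathfrak x$ or the $\Phi_j$), such that for all $\mathcal N\ge1$, $F$, $W$, $\mathfrak x$ as above and all $\Phi_1,\dots,\Phi_N$ analytic on $\{\mathrm{dist}(z,\sigma)\le\kappa\}$: 1. $f_j=\partial_{\alpha_j}\Phi_j(h)$ belongs to the periodic algebra, $Pf_j$ to the torus algebra, and $$\Big|\mathcal T_{\rm per}\Big(\prod_{j=1}^N f_j\Big)-\mathcal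 T_{\mathbb T}\Big(\prod_{j=1}^N Pf_j\Big)\Big|\le\mathfrak B_3\Big(\prod_{j=1}^N\bar\Phi_j\Big)e^{-\frac{\xi}{2}\mathcal N}.$$ 2. $f_j=\partial_{\alpha_j}\Phi_j(J\tilde h)$ belongs to the periodic algebra, $\tilde f_j=\tilde\partial_{\alpha_j}\Phi_j(\tilde h)$ to the torus algebra, and $$\Big|\mathcal T_{\rm per}\Big(\prod_{j=1}^N f_j\Big)-\mathcal T_{\mathbb T}\Big(\prod_{j=1}^N \tilde f_j\Big)\Big|\le\mathfrak B_4\Big(\prod_{j=1}^N\bar\Phi_j\Big)e^{-\frac{\xi}{2}\mathcal N},$$ with strict inequality if $\prod_j\bar\Phi_j>0$. Products are the ordered products in the respective algebras. -/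

import Mathlib

open MeasureTheory
open scoped ENNReal

noncomputable section

namespace NCTorus

/-! ### Twisted covariance algebras

Both algebras of the problem are built by the same recipe. `G` is the (additive) group of sites,
acting on a compact space `Ω` of disorder configurations by `t : G → Ω → Ω`, and
`θ : G → G → ℝ` is the magnetic form, `θ p q = p · F · q`. Elements are functions `f ω p`. -/

/-- The Hilbert space `ℓ²(G)`. -/
abbrev Ell2 (G : Type) : Type := lp (fun _ : G => ℂ) 2

/-- The C*-algebra of all bounded families `(T_ω)_{ω ∈ Ω}` of bounded operators on `ℓ²(G)`, with
the pointwise operations and the norm `sup_ω ‖T_ω‖`. -/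
abbrev OpFamily (G Ω : Type) : Type := lp (fun _ : Ω => Ell2 G →L[ℂ] Ell2 G) ∞

instance instNontrivialEll2 (G : Type) [Nonempty G] : Nontrivial (Ell2 G) := by
  classical
  obtain ⟨i⟩ := ‹Nonempty G›
  refine ⟨⟨lp.single 2 i (1 : ℂ), 0, fun h => ?_⟩⟩
  have h1 := congrArg (fun x : Ell2 G => x i) h
  simp at h1

instance instCStarAlgebraOpFamily (G Ω : Type) [Nonempty G] : CStarAlgebra (OpFamily G Ω) where

section Generic

set_option linter.unusedSectionVars false

variable {G Ω : Type} [AddCommGroup G] [TopologicalSpace Ω]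

/-- Continuous functions on `Ω × G` with compact support (`G` is discrete). -/
structure IsCompactlySupported (f : Ω → G → ℂ) : Prop where
  continuous : ∀ n, Continuous fun ω => f ω n
  finite : {n | ∃ ω, f ω n ≠ 0}.Finite

/-- The weighted shift `(S φ)(p) = a p * φ (p + s)` preserves square summability. -/
theorem memℓp_shift (a : G → ℂ) {C : ℝ} (ha : ∀ p, ‖a p‖ ≤ C) (s : G) (φ : Ell2 G) :
    Memℓp (fun p => a p * φ (p + s)) 2 := by
  have h0 : Summable fun p => ‖φ p‖ ^ (2 : ℝ) := by
    simpa using (lp.memℓp φ).summable (by simp)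
  have h1 : Summable fun p => C ^ (2 : ℝ) * ‖φ (p + s)‖ ^ (2 : ℝ) :=
    (((Equiv.addRight s).summable_iff (f := fun p => ‖φ p‖ ^ (2 : ℝ))).2 h0).mul_left _
  refine memℓp_gen ?_
  have e : (2 : ℝ≥0∞).toReal = 2 := by simp
  rw [e]
  refine Summable.of_nonneg_of_le (fun p => by positivity) (fun p => ?_) h1
  have hC : 0 ≤ C := (norm_nonneg _).trans (ha p)
  rw [norm_mul, Real.mul_rpow (norm_nonneg _) (norm_nonneg _)]
  gcongr
  exact ha p

theorem norm_shift_le (a : G → ℂ) {C : ℝ} (hC : 0 ≤ C) (ha : ∀ p, ‖a p‖ ≤ C) (s : G)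
    (φ : Ell2 G) : ‖(⟨_, memℓp_shift a ha s φ⟩ : Ell2 G)‖ ≤ C * ‖φ‖ := by
  have e : (2 : ℝ≥0∞).toReal = 2 := by simp
  have h0 : Summable fun p => ‖φ p‖ ^ (2 : ℝ) := by
    simpa using (lp.memℓp φ).summable (by simp)
  have h1 : Summable fun p => C ^ (2 : ℝ) * ‖φ (p + s)‖ ^ (2 : ℝ) :=
    (((Equiv.addRight s).summable_iff (f := fun p => ‖φ p‖ ^ (2 : ℝ))).2 h0).mul_left _
  refine lp.norm_le_of_tsum_le (by simp) (by positivity) ?_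
  rw [e, Real.mul_rpow hC (norm_nonneg _)]
  have h2 := lp.norm_rpow_eq_tsum (p := 2) (by simp) φ
  rw [e] at h2
  rw [h2, ← (Equiv.addRight s).tsum_eq (fun p => ‖φ p‖ ^ (2 : ℝ)), ← tsum_mul_left]
  have h3 : ∀ p, ‖a p * φ (p + s)‖ ^ (2 : ℝ) ≤ C ^ (2 : ℝ) * ‖φ (p + s)‖ ^ (2 : ℝ) := by
    intro p
    rw [norm_mul, Real.mul_rpow (norm_nonneg _) (norm_nonneg _)]
    gcongr
    exact ha p
  exact Summable.tsum_le_tsum h3 (Summable.of_nonneg_of_le (fun p => by positivity) h3 h1) h1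

/-- The weighted shift `(S φ)(p) = a p * φ (p + s)` on `ℓ²(G)`, for a bounded weight `a`. -/
def weightedShift (a : G → ℂ) (ha : ∃ C : ℝ, 0 ≤ C ∧ ∀ p, ‖a p‖ ≤ C) (s : G) :
    Ell2 G →L[ℂ] Ell2 G :=
  LinearMap.mkContinuousOfExistsBound
    { toFun := fun φ => ⟨fun p => a p * φ (p + s), memℓp_shift a ha.choose_spec.2 s φ⟩
      map_add' := fun φ ψ => by
        ext p
        change a p * (φ (p + s) + ψ (p + s)) = a p * φ (p + s) + a p * ψ (p + s)
        ring
      map_smul' := fun c φ => by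
        ext p
        change a p * (c * φ (p + s)) = c * (a p * φ (p + s))
        ring }
    ⟨ha.choose, fun φ => norm_shift_le a ha.choose_spec.1 ha.choose_spec.2 s φ⟩

/-- The Peierls phase `e^{iπ θ}`. -/
def phase (x : ℝ) : ℂ := Complex.exp (Complex.I * (Real.pi * x : ℝ))

theorem norm_phase (x : ℝ) : ‖phase x‖ = 1 := by
  rw [phase, mul_comm, Complex.norm_exp_ofReal_mul_I]

variable [CompactSpace Ω] (t : G → Ω → Ω) (θ : G → G → ℝ)

theorem exists_bound {f : Ω → G → ℂ} (hf : IsCompactlySupported f) (s : G) :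
    ∃ C : ℝ, 0 ≤ C ∧ ∀ ω, ‖f ω s‖ ≤ C := by
  obtain ⟨C, hC⟩ := isCompact_univ.exists_bound_of_continuousOn (hf.continuous s).continuousOn
  exact ⟨max C 0, le_max_right _ _, fun ω => (hC ω trivial).trans (le_max_left _ _)⟩

theorem exists_bound' {f : Ω → G → ℂ} (hf : IsCompactlySupported f) (s : G) :
    ∃ C : ℝ, 0 ≤ C ∧ ∀ ω p, ‖f (t (-p) ω) s * phase (θ (p + s) p)‖ ≤ C := by
  obtain ⟨C, hC, h⟩ := exists_bound hf s
  exact ⟨C, hC, fun ω p => by simpa [norm_phase] using h _⟩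

/-- The representation on `ℓ²(G)` of a compactly supported function `f`: the operator
`(π_ω f φ)(p) = ∑_q f(t_p⁻¹ ω, q - p) e^{iπ θ(q, p)} φ(q)`, written with `q = p + s`. -/
def repAt {f : Ω → G → ℂ} (hf : IsCompactlySupported f) (ω : Ω) : Ell2 G →L[ℂ] Ell2 G :=
  ∑ s ∈ hf.finite.toFinset,
    weightedShift (fun p => f (t (-p) ω) s * phase (θ (p + s) p))
      ((exists_bound' t θ hf s).imp fun _ h => ⟨h.1, h.2 ω⟩) s

theorem repAt_apply {f : Ω → G → ℂ} (hf : IsCompactlySupported f) (ω : Ω) (φ : Ell2 G) (p : G) :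
    repAt t θ hf ω φ p = ∑' q, f (t (-p) ω) (q - p) * phase (θ q p) * φ q := by
  rw [← (Equiv.addLeft p).tsum_eq, tsum_eq_sum (s := hf.finite.toFinset)]
  · rw [repAt, sum_apply, lp.coeFn_sum, Finset.sum_apply]
    refine Finset.sum_congr rfl fun s _ => ?_
    simp [weightedShift, LinearMap.mkContinuousOfExistsBound]
  · intro s hs
    have : f (t (-p) ω) s = 0 := by
      by_contra h
      exact hs (by simpa using ⟨_, h⟩)
    simp [this]

theorem memℓp_rep {f : Ω → G → ℂ} (hf : IsCompactlySupported f) :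
    Memℓp (fun ω => repAt t θ hf ω) ∞ := by
  choose C hC h using fun s => exists_bound' t θ hf s
  refine memℓp_infty ⟨∑ s ∈ hf.finite.toFinset, C s, ?_⟩
  rintro _ ⟨ω, rfl⟩
  refine (norm_sum_le _ _).trans (Finset.sum_le_sum fun s _ => ?_)
  refine ContinuousLinearMap.opNorm_le_bound _ (hC s) fun φ => ?_
  exact norm_shift_le _ (hC s) (h s ω) s φ

/-- The family `π f = (π_ω f)_{ω ∈ Ω}`. -/
def rep {f : Ω → G → ℂ} (hf : IsCompactlySupported f) : OpFamily G Ω :=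
  ⟨fun ω => repAt t θ hf ω, memℓp_rep t θ hf⟩

/-- The (reduced, twisted) covariance C*-algebra `C*(Ω × G, θ)`: the completion of the algebra of
compactly supported continuous functions on `Ω × G` in the norm `‖f‖ = sup_ω ‖π_ω f‖`, realised
as the C*-algebra of operator families generated by the `π f`. -/
def covarianceAlgebra : StarSubalgebra ℂ (OpFamily G Ω) :=
  (StarAlgebra.adjoin ℂ
    {T | ∃ (f : Ω → G → ℂ) (hf : IsCompactlySupported f), T = rep t θ hf}).topologicalClosure

instance instCStarAlgebraCovariance : CStarAlgebra (covarianceAlgebra t θ) :=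
  StarSubalgebra.cstarAlgebra _ (h_closed := StarSubalgebra.isClosed_topologicalClosure _)

/-- A compactly supported function as an element of the C*-algebra. -/
def ofFun {f : Ω → G → ℂ} (hf : IsCompactlySupported f) : covarianceAlgebra t θ :=
  ⟨rep t θ hf, StarSubalgebra.le_topologicalClosure _ (StarAlgebra.subset_adjoin ℂ _ ⟨f, hf, rfl⟩)⟩

/-- An element of the C*-algebra as a function on `Ω × G`: `f(ω, p) = ⟨δ_0, (π_ω f) δ_p⟩`. -/
def toFun (a : covarianceAlgebra t θ) : Ω → G → ℂ := by
  classical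
  exact fun ω p => (a : OpFamily G Ω) ω (lp.single 2 p (1 : ℂ)) 0

/-- The function `Φ(a)(ω, p)` obtained from a (self-adjoint) element `a` of the C*-algebra by
functional calculus in that C*-algebra (for `Φ` analytic near the spectrum of `a` this is
`(i / 2π) ∮ Φ(z) (a - z)⁻¹ dz`). -/
def funCalc (Φ : ℂ → ℂ) (a : covarianceAlgebra t θ) : Ω → G → ℂ :=
  toFun t θ (cfc Φ a)

/-- The product `(f * g)(ω, n) = ∑_m f(ω, m) g(t_m⁻¹ ω, n - m) e^{iπ θ(n, m)}`. -/
def conv (f g : Ω → G → ℂ) : Ω → G → ℂ := fun ω n =>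
  ∑' m, f ω m * g (t (-m) ω) (n - m) * phase (θ n m)

/-- The unit `𝟏(ω, n) = δ_{n,0}`. -/
def unit : Ω → G → ℂ := by
  classical
  exact fun _ n => if n = 0 then 1 else 0

/-- The ordered product `f₁ * f₂ * ⋯ * f_N`. -/
def convProd {N : ℕ} (f : Fin N → Ω → G → ℂ) : Ω → G → ℂ :=
  (List.ofFn f).foldr (conv t θ) unit

/-- The trace `𝒯(f) = ∫ f(ω, 0) dP(ω)`. -/
def trace [MeasurableSpace Ω] (P : Measure Ω) (f : Ω → G → ℂ) : ℂ :=
  ∫ ω, f ω 0 ∂P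

/-- The derivation `∂_α = ∂₁^{α₁} ⋯ ∂_d^{α_d}`, where `(∂_j f)(ω, n) = i x_j(n) f(ω, n)` for given
coordinate functions `x_j : G → ℝ`. -/
def multiDeriv {d : ℕ} (x : G → Fin d → ℝ) (α : Fin d → ℕ) (f : Ω → G → ℂ) : Ω → G → ℂ :=
  fun ω n => (∏ j, (Complex.I * (x n j : ℂ)) ^ α j) * f ω n

end Generic

/-- `Φ̄ = (1 / 2π) ∫_{𝒞_κ} |Φ(z)| |dz|`, where `𝒞_κ = {z | dist (z, σ) = κ}` and `|dz|` is
arc length (one-dimensional Hausdorff measure). -/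
def contourMean (σ : Set ℂ) (κ : ℝ) (Φ : ℂ → ℂ) : ℝ :=
  1 / (2 * Real.pi) * ∫ z in {z : ℂ | Metric.infDist z σ = κ}, ‖Φ z‖ ∂μH[1]

/-! ### Sites and disorder configurations -/

/-- The lattice `ℤ^d`. -/
abbrev Lattice (d : ℕ) : Type := Fin d → ℤ

/-- The discrete torus, a product of `d` discrete circles with `2L + 1` points. The rotation
`𝔯_p` is addition of `p`. -/
abbrev Torus (d L : ℕ) : Type := Fin d → ZMod (2 * L + 1)

/-- The coordinates `n_p ∈ {-L, …, L}^d` of a point `p` of the torus. -/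
def coord {d L : ℕ} (p : Torus d L) : Lattice d := fun j => (p j).valMinAbs

/-- The point of the torus onto which a lattice point is wrapped. -/
def wrap {d : ℕ} (L : ℕ) (n : Lattice d) : Torus d L := fun j => (n j : ZMod (2 * L + 1))

/-- The range `[-1/2, 1/2]` of the on-site disorder. -/
abbrev Amp : Type := Set.Icc (-(1 / 2) : ℝ) (1 / 2)

/-- Disorder configurations on `ℤ^d`. -/
abbrev Config (d : ℕ) : Type := Lattice d → Amp

/-- The translation `(𝔱_m ω)_n = ω_{n + m}`. -/
def translate {d : ℕ} (m : Lattice d) (ω : Config d) : Config d := fun n => ω (n + m)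

/-- The set of periodic configurations: `𝔱_{(2L + 1) e_j} ω = ω` for all `j`. -/
def periodicConfigs (d L : ℕ) : Set (Config d) :=
  {ω | ∀ j : Fin d, translate (Pi.single j (2 * L + 1 : ℤ)) ω = ω}

abbrev PerConfig (d L : ℕ) : Type := periodicConfigs d L

instance instCompactPerConfig (d L : ℕ) : CompactSpace (PerConfig d L) := by
  refine isCompact_iff_compactSpace.1 (IsClosed.isCompact ?_)
  have : periodicConfigs d L = ⋂ j : Fin d, ⋂ n : Lattice d,
      {ω : Config d | ω (n + Pi.single j (2 * L + 1 : ℤ)) = ω n} := by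
    ext ω
    simp [periodicConfigs, translate, funext_iff]
  rw [this]
  exact isClosed_iInter fun j => isClosed_iInter fun n =>
    isClosed_eq (continuous_apply _) (continuous_apply _)

/-- Translations of periodic configurations. -/
def perTranslate {d L : ℕ} (m : Lattice d) (ω : PerConfig d L) : PerConfig d L :=
  ⟨translate m ω.1, fun j => by
    funext n
    have := congrFun (ω.2 j) (n + m)
    simpa [translate, add_right_comm] using this⟩

/-- Disorder configurations on the torus. -/
abbrev TorusConfig (d L : ℕ) : Type := Torus d L → Amp

/-- The rotation of configurations, `(𝔯_q ω)_p = ω_{p + q}`. -/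
def rotate {d L : ℕ} (q : Torus d L) (ω : TorusConfig d L) : TorusConfig d L :=
  fun p => ω (p + q)

/-- The canonical identification of torus configurations with periodic configurations. -/
def unroll {d L : ℕ} (ω : TorusConfig d L) : PerConfig d L :=
  ⟨fun n => ω (wrap L n), fun j => by
    funext n
    have : wrap L (n + Pi.single j (2 * L + 1 : ℤ)) = wrap L n := by
      funext i
      rcases eq_or_ne i j with rfl | h
      · have h0 : ((2 * L + 1 : ℕ) : ZMod (2 * L + 1)) = 0 := ZMod.natCast_self _
        push_cast at h0
        simp [wrap, h0]
      · simp [wrap, h]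
    simp [translate, this]⟩

/-- The inverse identification: `ω` is restricted to the cell `{-L, …, L}^d`. -/
def roll {d L : ℕ} (ω : PerConfig d L) : TorusConfig d L := fun p => ω.1 (coord p)

/-- The product `dP_𝕋(ω) = ∏_p dω_p` of the uniform distributions on `[-1/2, 1/2]`. -/
def torusMeasure (d L : ℕ) : Measure (TorusConfig d L) :=
  Measure.pi fun _ => (volume : Measure ℝ).comap (Subtype.val : Amp → ℝ)

/-- The measure `dP_per(ω) = ∏_{n ∈ {-L, …, L}^d} dω_n` on periodic configurations. -/
def perMeasure (d L : ℕ) : Measure (PerConfig d L) := (torusMeasure d L).map unroll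

/-! ### The periodic algebra, the torus algebra and the maps between them -/

/-- The magnetic form `x · F · y`. -/
def magForm {d : ℕ} (F : Matrix (Fin d) (Fin d) ℝ) (x y : Lattice d) : ℝ :=
  ∑ j, ∑ k, (x j : ℝ) * F j k * (y k : ℝ)

/-- The magnetic form on the torus, `n_p · F · n_q`. -/
def torusForm {d L : ℕ} (F : Matrix (Fin d) (Fin d) ℝ) (p q : Torus d L) : ℝ :=
  magForm F (coord p) (coord q)

/-- The magnetic tensor is antisymmetric and its entries are `2 / (2L + 1)` times integers. -/
def IsQuantized {d : ℕ} (L : ℕ) (F : Matrix (Fin d) (Fin d) ℝ) : Prop :=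
  F.transpose = -F ∧ ∀ j k, ∃ m : ℤ, F j k = 2 / (2 * (L : ℝ) + 1) * m

/-- The periodic C*-algebra. -/
abbrev PerAlgebra {d : ℕ} (L : ℕ) (F : Matrix (Fin d) (Fin d) ℝ) :
    StarSubalgebra ℂ (OpFamily (Lattice d) (PerConfig d L)) :=
  covarianceAlgebra perTranslate (magForm F)

/-- The C*-algebra over the discrete torus. -/
abbrev TorusAlgebra {d : ℕ} (L : ℕ) (F : Matrix (Fin d) (Fin d) ℝ) :
    StarSubalgebra ℂ (OpFamily (Torus d L) (TorusConfig d L)) :=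
  covarianceAlgebra rotate (torusForm F)

/-- The map `(P f)(ω, p) = f(ω, n_p)`. -/
def mapP {d L : ℕ} (f : PerConfig d L → Lattice d → ℂ) : TorusConfig d L → Torus d L → ℂ :=
  fun ω p => f (unroll ω) (coord p)

/-- The map `(J f)(ω, n) = ∑_q δ_{n, n_q} f(ω, q)`. -/
def mapJ {d L : ℕ} (f : TorusConfig d L → Torus d L → ℂ) : PerConfig d L → Lattice d → ℂ :=
  fun ω n => ∑ q : Torus d L, if n = coord q then f (roll ω) q else 0

/-! ### The Hamiltonian -/

/-- The nearest-neighbour hopping Hamiltonian `h(ω, n) = δ_{|n|,1} + W ω_n δ_{n,0}`. -/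
def hamiltonian {d : ℕ} (W : ℝ) (ω : Config d) (n : Lattice d) : ℂ :=
  (if ∑ j, n j ^ 2 = 1 then 1 else 0) + if n = 0 then ((W * (ω n : ℝ) : ℝ) : ℂ) else 0

/-- Its restriction to periodic configurations. -/
def perHamiltonian {d : ℕ} (L : ℕ) (W : ℝ) (ω : PerConfig d L) (n : Lattice d) : ℂ :=
  hamiltonian W ω.1 n

/-- The Hamiltonian on the torus. -/
def torusHamiltonian {d : ℕ} (L : ℕ) (W : ℝ) : TorusConfig d L → Torus d L → ℂ :=
  mapP (perHamiltonian L W)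

theorem continuous_roll (d L : ℕ) : Continuous (roll : PerConfig d L → TorusConfig d L) :=
  continuous_pi fun p => (continuous_apply (coord p)).comp continuous_subtype_val

theorem continuous_unroll (d L : ℕ) : Continuous (unroll : TorusConfig d L → PerConfig d L) :=
  Continuous.subtype_mk (continuous_pi fun n => continuous_apply (wrap L n)) _

theorem perHamiltonian_supp {d : ℕ} (L : ℕ) (W : ℝ) :
    IsCompactlySupported (perHamiltonian (d := d) L W) where
  continuous n := by
    unfold perHamiltonian hamiltonian
    refine continuous_const.add ?_
    split_ifs
    · exact Complex.continuous_ofReal.comp (continuous_const.mul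
        (continuous_subtype_val.comp ((continuous_apply n).comp continuous_subtype_val)))
    · exact continuous_const
  finite := by
    refine (Set.Finite.pi' fun _ : Fin d => Set.finite_Icc (-1 : ℤ) 1).subset ?_
    rintro n ⟨ω, h⟩ j
    by_cases h0 : n = 0
    · simp [h0]
    by_cases h1 : ∑ j, n j ^ 2 = 1
    · have : n j ^ 2 ≤ 1 :=
        (Finset.single_le_sum (fun i _ => sq_nonneg (n i)) (Finset.mem_univ j)).trans h1.le
      exact abs_le.1 ((sq_le_one_iff_abs_le_one _).1 this)
    · exact absurd (by simp [perHamiltonian, hamiltonian, h0, h1]) h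

theorem mapP_supp {d L : ℕ} {f : PerConfig d L → Lattice d → ℂ} (hf : IsCompactlySupported f) :
    IsCompactlySupported (mapP f) where
  continuous p := (hf.continuous (coord p)).comp (continuous_unroll d L)
  finite := Set.toFinite _

theorem mapJ_supp {d L : ℕ} {f : TorusConfig d L → Torus d L → ℂ} (hf : IsCompactlySupported f) :
    IsCompactlySupported (mapJ f) where
  continuous n := by
    unfold mapJ
    refine continuous_finsetSum _ fun q _ => ?_
    split_ifs
    · exact (hf.continuous q).comp (continuous_roll d L)
    · exact continuous_const
  finite := by
    refine (Set.finite_range (coord : Torus d L → Lattice d)).subset ?_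
    rintro n ⟨ω, h⟩
    by_contra hn
    refine h (Finset.sum_eq_zero fun q _ => if_neg fun e => hn ⟨q, e.symm⟩)

/-- The Hamiltonian `h` as an element of the periodic algebra. -/
def hPer {d : ℕ} (L : ℕ) (F : Matrix (Fin d) (Fin d) ℝ) (W : ℝ) : PerAlgebra L F :=
  ofFun perTranslate (magForm F) (perHamiltonian_supp L W)

/-- The Hamiltonian `h̃` as an element of the torus algebra. -/
def hTorus {d : ℕ} (L : ℕ) (F : Matrix (Fin d) (Fin d) ℝ) (W : ℝ) : TorusAlgebra L F :=
  ofFun rotate (torusForm F) (mapP_supp (perHamiltonian_supp L W))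

/-- The element `J h̃` of the periodic algebra. -/
def hJ {d : ℕ} (L : ℕ) (F : Matrix (Fin d) (Fin d) ℝ) (W : ℝ) : PerAlgebra L F :=
  ofFun perTranslate (magForm F) (mapJ_supp (mapP_supp (perHamiltonian_supp L W)))

/-! ### Derivatives and correlation functions -/

/-- `∂_α Φ(a)` in the periodic algebra, where `(∂_j f)(ω, n) = i n_j f(ω, n)`. -/
def perDerivCalc {d L : ℕ} {F : Matrix (Fin d) (Fin d) ℝ} (α : Fin d → ℕ) (Φ : ℂ → ℂ)
    (a : PerAlgebra L F) : PerConfig d L → Lattice d → ℂ :=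
  multiDeriv (fun n j => (n j : ℝ)) α (funCalc perTranslate (magForm F) Φ a)

/-- `∂̃_α Φ(a)` in the torus algebra, where `(∂̃_j f)(ω, p) = i 𝔵(p_j) f(ω, p)`. -/
def torusDerivCalc {d L : ℕ} {F : Matrix (Fin d) (Fin d) ℝ} (𝔵 : ZMod (2 * L + 1) → ℝ)
    (α : Fin d → ℕ) (Φ : ℂ → ℂ) (a : TorusAlgebra L F) : TorusConfig d L → Torus d L → ℂ :=
  multiDeriv (fun p j => 𝔵 (p j)) α (funCalc rotate (torusForm F) Φ a)

/-- The functions `𝔵` on the discrete circle admitted in the approximate differential calculus. -/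
def IsApproxCoord (L : ℕ) (𝔵 : ZMod (2 * L + 1) → ℝ) : Prop :=
  (∀ p, |(p.valMinAbs : ℝ)| < L / Real.sqrt 2 → 𝔵 p = p.valMinAbs) ∧
    ∀ p, |𝔵 p| ≤ |(p.valMinAbs : ℝ)|

/-- `f` is (the function of) an element of the periodic algebra. -/
def MemPer {d L : ℕ} (F : Matrix (Fin d) (Fin d) ℝ) (f : PerConfig d L → Lattice d → ℂ) : Prop :=
  ∃ a : PerAlgebra L F, toFun perTranslate (magForm F) a = f

/-- `f` is (the function of) an element of the torus algebra. -/
def MemTorus {d L : ℕ} (F : Matrix (Fin d) (Fin d) ℝ) (f : TorusConfig d L → Torus d L → ℂ) :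
    Prop :=
  ∃ a : TorusAlgebra L F, toFun rotate (torusForm F) a = f

/-- The correlation function `𝒯_per(f₁ * ⋯ * f_N)`. -/
def perCorr {d L N : ℕ} (F : Matrix (Fin d) (Fin d) ℝ)
    (f : Fin N → PerConfig d L → Lattice d → ℂ) : ℂ :=
  trace (perMeasure d L) (convProd perTranslate (magForm F) f)

/-- The correlation function `𝒯_𝕋(f₁ * ⋯ * f_N)`. -/
def torusCorr {d L N : ℕ} (F : Matrix (Fin d) (Fin d) ℝ)
    (f : Fin N → TorusConfig d L → Torus d L → ℂ) : ℂ :=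
  trace (torusMeasure d L) (convProd rotate (torusForm F) f)

end NCTorus

end

/-! Write L for 𝒩. The two algebras are linked by periodization, `periodize`, which sums f(ω, n)
over all lattice points n wrapped onto a given torus point. Since F is quantized, the phases depend
only on residues modulo 2L + 1, so periodization turns twisted convolution over ℤ^d into twisted
convolution over the torus (`periodize_conv`). It sends h to h̃, hence resolvents to resolvents
(`periodize_resFun`). Consequently σ(h̃) ⊆ σ(h), and Φ(h) is sent to Φ(h̃) (`periodize_funCalc`).

The errors are small because everything decays. The Combes–Thomas argument (`norm_entry_mul_exp_le`,
`norm_ent_res_le`) gives off-diagonal decay of (z - h)⁻¹ at any rate below ξ' when 2d sinh ξ' <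
dist(z, σ), uniformly in L, F and W. Cauchy's formula on the curve dist(z, σ) = κ passes this to
Φ(h) with a factor Φ̄ (`norm_funCalc_le`). The trace of a decaying function and that of its
periodization differ only by values at nonzero points of (2L + 1)ℤ^d (`norm_periodize_sub_le`).

Neither P f_j nor f̃_j is the periodization of f_j, but each is the periodization of b_j Φ_j(h) for
a symbol b_j that is dominated by the symbol of ∂_α and agrees with it where all |n_k| < L/√2.
Replacing one symbol by the other costs about e^{-ξ L/√2}, and 1/√2 > 1/2 leaves enough decay to sum
over n. The polynomial growth of the symbol is absorbed by working at a rate slightly above ξ.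
`exists_corr_bound` collects these estimates.

The Cauchy formula needs care, since Φ̄ is an integral against Hausdorff measure over a level curve
around an arbitrary compact K ⊂ ℝ. The curve lies on the graphs of ±√(κ² - dist(x, K)²). Instead of
parametrizing it, fine staircases are inscribed: Cauchy's formula on them telescopes, and their edge
lengths are controlled by the measure of pieces of the curve through 1-Lipschitz projections. This
costs only the constant 6 in `exists_cauchy_approx`. -/

noncomputable section

namespace NCTorus

/-! ### Matrix entries of operator families -/

section Entries

variable {G Ω : Type}

open Classical in
/-- The basis vector `δ_q` of `ℓ²(G)`. -/
def basisVec (q : G) : Ell2 G := lp.single 2 q (1 : ℂ)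

open Classical in
theorem basisVec_apply (q p : G) : basisVec q p = if p = q then 1 else 0 := by
  by_cases h : p = q
  · subst h; simp [basisVec]
  · simp [basisVec, h]

@[simp] theorem basisVec_self (q : G) : basisVec q q = 1 := by simp [basisVec_apply]

theorem basisVec_of_ne {q p : G} (h : p ≠ q) : basisVec q p = 0 := by simp [basisVec_apply, h]

@[simp] theorem norm_basisVec (q : G) : ‖basisVec q‖ = 1 := by
  classical
  simp [basisVec, lp.norm_single]

theorem norm_coord_le (φ : Ell2 G) (p : G) : ‖φ p‖ ≤ ‖φ‖ :=
  lp.norm_apply_le_norm (by simp) φ p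

theorem inner_basisVec (p : G) (φ : Ell2 G) : inner ℂ (basisVec p) φ = φ p := by
  classical
  simp [basisVec, lp.inner_single_left]

/-- Evaluation of `φ ∈ ℓ²(G)` at a site, as a continuous functional. -/
def coordL (p : G) : Ell2 G →L[ℂ] ℂ := innerSL ℂ (basisVec p)

@[simp] theorem coordL_apply (p : G) (φ : Ell2 G) : coordL p φ = φ p := inner_basisVec p φ

theorem hasSum_basisVec (φ : Ell2 G) : HasSum (fun q => φ q • basisVec q) φ := by
  classical
  have h := lp.hasSum_single (p := 2) (by simp) φ
  convert h using 2 with q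
  rw [basisVec, ← lp.single_smul]
  simp

theorem hasSum_apply_basisVec (T : Ell2 G →L[ℂ] Ell2 G) (φ : Ell2 G) (p : G) :
    HasSum (fun q => φ q * T (basisVec q) p) (T φ p) := by
  have h := (hasSum_basisVec φ).mapL ((coordL p).comp T)
  simpa using h

theorem clm_ext_basisVec {T S : Ell2 G →L[ℂ] Ell2 G}
    (h : ∀ p q, T (basisVec q) p = S (basisVec q) p) : T = S := by
  ext φ p
  refine (hasSum_apply_basisVec T φ p).unique ?_
  simp only [h]
  exact hasSum_apply_basisVec S φ p

/-- The matrix entry `⟨δ_p, a_ω δ_q⟩` of an operator family. -/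
def ent (a : OpFamily G Ω) (ω : Ω) (p q : G) : ℂ := a ω (basisVec q) p

theorem norm_ent_le (a : OpFamily G Ω) (ω : Ω) (p q : G) : ‖ent a ω p q‖ ≤ ‖a‖ := by
  refine (norm_coord_le _ _).trans ?_
  have h := (a ω).le_opNorm (basisVec q)
  rw [norm_basisVec, mul_one] at h
  exact h.trans (lp.norm_apply_le_norm (by simp) a ω)

theorem opFamily_ext {a b : OpFamily G Ω} (h : ∀ ω p q, ent a ω p q = ent b ω p q) : a = b := by
  ext1
  funext ω
  exact clm_ext_basisVec fun p q => h ω p q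

theorem ent_add (a b : OpFamily G Ω) (ω : Ω) (p q : G) :
    ent (a + b) ω p q = ent a ω p q + ent b ω p q := rfl

theorem ent_sub (a b : OpFamily G Ω) (ω : Ω) (p q : G) :
    ent (a - b) ω p q = ent a ω p q - ent b ω p q := rfl

theorem ent_smul (c : ℂ) (a : OpFamily G Ω) (ω : Ω) (p q : G) :
    ent (c • a) ω p q = c * ent a ω p q := rfl

/-- A matrix entry as a continuous functional of the operator family. -/
def entL (ω : Ω) (p q : G) : OpFamily G Ω →L[ℂ] ℂ :=
  LinearMap.mkContinuous
    { toFun := fun a => ent a ω p q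
      map_add' := fun _ _ => rfl
      map_smul' := fun _ _ => rfl } 1 fun a => by
    rw [one_mul]
    exact norm_ent_le a ω p q

theorem hasSum_ent_mul (a b : OpFamily G Ω) (ω : Ω) (p q : G) :
    HasSum (fun m => ent a ω p m * ent b ω m q) (ent (a * b) ω p q) := by
  have h := hasSum_apply_basisVec (a ω) (b ω (basisVec q)) p
  convert h using 2 with m
  · exact mul_comm _ _
  · rfl

open Classical in
theorem ent_one [Nonempty G] (ω : Ω) (p q : G) :
    ent (1 : OpFamily G Ω) ω p q = if p = q then 1 else 0 := basisVec_apply q p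

theorem ent_star [Nonempty G] (a : OpFamily G Ω) (ω : Ω) (p q : G) :
    ent (star a) ω p q = star (ent a ω q p) := by
  have h : (star a) ω = ContinuousLinearMap.adjoint (a ω) := rfl
  rw [ent, ent, h, ← inner_basisVec p, ContinuousLinearMap.adjoint_inner_right,
    ← inner_basisVec q]
  exact (inner_conj_symm _ _).symm

end Entries

section Rep

variable {G Ω : Type} [AddCommGroup G] [TopologicalSpace Ω] [CompactSpace Ω]
  (t : G → Ω → Ω) (θ : G → G → ℝ)

theorem ent_rep {f : Ω → G → ℂ} (hf : IsCompactlySupported f) (ω : Ω) (p q : G) :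
    ent (rep t θ hf) ω p q = f (t (-p) ω) (q - p) * phase (θ q p) := by
  change repAt t θ hf ω (basisVec q) p = _
  rw [repAt_apply, tsum_eq_single q]
  · simp
  · intro m hm
    simp [basisVec_of_ne hm]

theorem hasSum_ent_mul_rep (a : OpFamily G Ω) {f : Ω → G → ℂ} (hf : IsCompactlySupported f)
    (ω : Ω) (p n : G) :
    HasSum (fun m => ent a ω p m * f (t (-m) ω) (n - m) * phase (θ n m))
      (ent (a * rep t θ hf) ω p n) := by
  have h := hasSum_ent_mul a (rep t θ hf) ω p n
  simpa only [ent_rep, mul_assoc] using h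

theorem toFun_eq_ent (a : covarianceAlgebra t θ) (ω : Ω) (p : G) :
    toFun t θ a ω p = ent (a : OpFamily G Ω) ω 0 p := rfl

end Rep

/-! ### Phases and self-adjointness of the Hamiltonians -/

theorem star_phase (x : ℝ) : star (phase x) = phase (-x) := by
  rw [phase, phase, Complex.star_def, ← Complex.exp_conj]
  simp

theorem phase_zero : phase 0 = 1 := by simp [phase]

theorem phase_add (x y : ℝ) : phase (x + y) = phase x * phase y := by
  rw [phase, phase, phase, ← Complex.exp_add]
  push_cast
  ring_nf

theorem phase_two_mul_int (m : ℤ) : phase (2 * m) = 1 := by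
  rw [phase, Complex.exp_eq_one_iff]
  refine ⟨m, ?_⟩
  push_cast
  ring

theorem phase_add_two_mul_int (x : ℝ) (m : ℤ) : phase (x + 2 * m) = phase x := by
  rw [phase_add, phase_two_mul_int, mul_one]

section Antisymm

variable {d : ℕ} {F : Matrix (Fin d) (Fin d) ℝ}

theorem magForm_swap (hF : F.transpose = -F) (x y : Lattice d) :
    magForm F y x = -magForm F x y := by
  have h : ∀ j k, F k j = -F j k := fun j k => congrFun (congrFun hF j) k
  unfold magForm
  rw [Finset.sum_comm, ← Finset.sum_neg_distrib]
  refine Finset.sum_congr rfl fun j _ => ?_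
  rw [← Finset.sum_neg_distrib]
  refine Finset.sum_congr rfl fun k _ => ?_
  rw [h j k]
  ring

theorem magForm_self (hF : F.transpose = -F) (x : Lattice d) : magForm F x x = 0 := by
  have := magForm_swap hF x x
  linarith

theorem magForm_add_left (x x' y : Lattice d) :
    magForm F (x + x') y = magForm F x y + magForm F x' y := by
  simp [magForm, add_mul, Finset.sum_add_distrib]

theorem magForm_add_right (x y y' : Lattice d) :
    magForm F x (y + y') = magForm F x y + magForm F x y' := by
  simp [magForm, mul_add, Finset.sum_add_distrib]

end Antisymm

theorem star_hamiltonian {d : ℕ} (W : ℝ) (ω : Config d) (n : Lattice d) :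
    star (hamiltonian W ω n) = hamiltonian W ω n := by
  unfold hamiltonian
  split_ifs <;> simp

theorem hamiltonian_neg {d : ℕ} (W : ℝ) (ω ω' : Config d) {n : Lattice d} (hn : n ≠ 0) :
    hamiltonian W ω (-n) = hamiltonian W ω' n := by
  simp [hamiltonian, hn]

section SelfAdjoint

variable {G Ω : Type} [AddCommGroup G] [TopologicalSpace Ω] [CompactSpace Ω]
  (t : G → Ω → Ω) (θ : G → G → ℝ)

/-- The adjoint exchanges p and q, which negates the displacement and conjugates the phase, but also
reads the disorder at `t (-q) ω` instead of `t (-p) ω`. Off the diagonal the values must therefore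
not depend on the configuration; on the diagonal reality suffices. -/
theorem isSelfAdjoint_ofFun {f : Ω → G → ℂ} (hf : IsCompactlySupported f)
    (hθ : ∀ p q, θ q p = -θ p q) (h : ∀ ω p, star (f ω p) = f ω p)
    (h' : ∀ ω ω' p, p ≠ 0 → f ω (-p) = f ω' p) : IsSelfAdjoint (ofFun t θ hf) := by
  refine Subtype.ext (opFamily_ext fun ω p q => ?_)
  change ent (star (rep t θ hf)) ω p q = ent (rep t θ hf) ω p q
  rw [ent_star, ent_rep, ent_rep, star_mul', h, star_phase, ← hθ]
  rcases eq_or_ne p q with rfl | hpq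
  · rfl
  · rw [← neg_sub q p, h' _ (t (-p) ω) _ (sub_ne_zero.2 hpq.symm)]

end SelfAdjoint

/-- The circle has an odd number of points, so there is no residue halfway round, where the choice
of representative would break the symmetry. -/
theorem coord_neg {d L : ℕ} (p : Torus d L) : coord (-p) = -coord p := by
  funext j
  refine ZMod.valMinAbs_neg_of_ne_half (a := p j) fun h => ?_
  omega

theorem coord_eq_zero {d L : ℕ} {p : Torus d L} : coord p = 0 ↔ p = 0 := by
  simp only [funext_iff, coord, Pi.zero_apply, ZMod.valMinAbs_eq_zero]

theorem isSelfAdjoint_hPer {d : ℕ} (L : ℕ) {F : Matrix (Fin d) (Fin d) ℝ}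
    (hF : F.transpose = -F) (W : ℝ) : IsSelfAdjoint (hPer L F W) :=
  isSelfAdjoint_ofFun _ _ _ (magForm_swap hF) (fun _ _ => star_hamiltonian _ _ _)
    fun _ _ _ => hamiltonian_neg _ _ _

theorem isSelfAdjoint_hTorus {d : ℕ} (L : ℕ) {F : Matrix (Fin d) (Fin d) ℝ}
    (hF : F.transpose = -F) (W : ℝ) : IsSelfAdjoint (hTorus L F W) := by
  refine isSelfAdjoint_ofFun _ _ _ (fun _ _ => magForm_swap hF _ _)
    (fun _ _ => star_hamiltonian _ _ _) fun ω ω' p hp => ?_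
  change hamiltonian W _ (coord (-p)) = hamiltonian W _ (coord p)
  rw [coord_neg, hamiltonian_neg W _ (unroll ω').1 (coord_eq_zero.not.2 hp)]

/-! ### Wrapping -/

theorem wrap_add {d : ℕ} (L : ℕ) (m n : Lattice d) : wrap L (m + n) = wrap L m + wrap L n := by
  funext j; simp [wrap]

theorem wrap_neg {d : ℕ} (L : ℕ) (n : Lattice d) : wrap L (-n) = -wrap L n := by
  funext j; simp [wrap]

theorem wrap_sub {d : ℕ} (L : ℕ) (m n : Lattice d) : wrap L (m - n) = wrap L m - wrap L n := by
  funext j; simp [wrap]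

@[simp] theorem wrap_zero {d : ℕ} (L : ℕ) : wrap L (0 : Lattice d) = 0 := by
  funext j; simp [wrap]

@[simp] theorem wrap_coord {d L : ℕ} (p : Torus d L) : wrap L (coord p) = p := by
  funext j
  exact ZMod.coe_valMinAbs _

theorem coord_wrap {d L : ℕ} {n : Lattice d} (h : ∀ j, |n j| ≤ L) : coord (wrap L n) = n := by
  funext j
  rw [coord, ZMod.valMinAbs_spec]
  refine ⟨rfl, ?_, ?_⟩ <;> have := abs_le.1 (h j) <;> push_cast <;> omega

theorem abs_coord_wrap_le {d L : ℕ} (n : Lattice d) (j : Fin d) :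
    |coord (wrap L n) j| ≤ |n j| := by
  have h := ZMod.natAbs_min_of_le_div_two (2 * L + 1) (coord (wrap L n) j) (n j)
    (by simp [coord, wrap]) ?_
  · rw [Int.abs_eq_natAbs, Int.abs_eq_natAbs]
    exact_mod_cast h
  · exact ZMod.natAbs_valMinAbs_le _

theorem wrap_eq_zero_dvd {d L : ℕ} {n : Lattice d} (h : wrap L n = 0) (j : Fin d) :
    ((2 * L + 1 : ℕ) : ℤ) ∣ n j :=
  (ZMod.intCast_zmod_eq_zero_iff_dvd _ _).1 (congrFun h j)

/-- The place where quantization enters: the factor 2L + 1 in n cancels the denominator of F, so the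
form takes values in 2ℤ and e^{iπ·} does not see it. -/
theorem phase_magForm_of_wrap_eq_zero {d L : ℕ} {F : Matrix (Fin d) (Fin d) ℝ}
    (hF : IsQuantized L F) {n : Lattice d} (hn : wrap L n = 0) (x : ℝ) (m : Lattice d) :
    phase (x + magForm F n m) = phase x := by
  choose k hk using hF.2
  choose c hc using wrap_eq_zero_dvd hn
  have : magForm F n m = 2 * ((∑ j, ∑ i, c j * k j i * m i : ℤ) : ℝ) := by
    unfold magForm
    push_cast
    rw [Finset.mul_sum]
    refine Finset.sum_congr rfl fun j _ => ?_
    rw [Finset.mul_sum]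
    refine Finset.sum_congr rfl fun i _ => ?_
    rw [hk, hc]
    push_cast
    field_simp
  rw [this, phase_add_two_mul_int]

theorem phase_magForm_congr {d L : ℕ} {F : Matrix (Fin d) (Fin d) ℝ}
    (hF : IsQuantized L F) {n n' m m' : Lattice d} (hn : wrap L n = wrap L n')
    (hm : wrap L m = wrap L m') : phase (magForm F n m) = phase (magForm F n' m') := by
  have h1 : ∀ {n n' : Lattice d} (m : Lattice d), wrap L n = wrap L n' →
      phase (magForm F n m) = phase (magForm F n' m) := by
    intro n n' m h
    have := phase_magForm_of_wrap_eq_zero hF (n := n - n') (by rw [wrap_sub, h, sub_self])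
      (magForm F n' m) m
    rw [← this, ← magForm_add_left]
    simp
  have h2 : ∀ a b : Lattice d, phase (magForm F a b) = star (phase (magForm F b a)) := by
    intro a b
    rw [star_phase, ← magForm_swap hF.1]
  -- Antisymmetry exchanges the arguments up to conjugation, so invariance in the first argument
  -- gives it in the second.
  rw [h1 m hn, h2, h1 n' hm, ← h2]

theorem phase_torusForm {d L : ℕ} {F : Matrix (Fin d) (Fin d) ℝ}
    (hF : IsQuantized L F) (n m : Lattice d) :
    phase (torusForm F (wrap L n) (wrap L m)) = phase (magForm F n m) :=
  phase_magForm_congr hF (wrap_coord _) (wrap_coord _)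

theorem perTranslate_unroll {d L : ℕ} (m : Lattice d) (ω : TorusConfig d L) :
    perTranslate m (unroll ω) = unroll (rotate (wrap L m) ω) := by
  refine Subtype.ext (funext fun n => ?_)
  change ω (wrap L (n + m)) = ω (wrap L n + wrap L m)
  rw [wrap_add]

theorem continuous_perTranslate {d L : ℕ} (m : Lattice d) :
    Continuous (perTranslate m : PerConfig d L → PerConfig d L) :=
  continuous_induced_rng.2 (continuous_pi fun n =>
    (continuous_apply (n + m)).comp continuous_subtype_val)

/-- The Hamiltonian only reaches nearest neighbours. -/
theorem abs_le_one_of_hamiltonian_ne_zero {d : ℕ} {W : ℝ} {ω : Config d} {n : Lattice d}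
    (h : hamiltonian W ω n ≠ 0) (j : Fin d) : |n j| ≤ 1 := by
  by_cases h0 : n = 0
  · simp [h0]
  by_cases h1 : ∑ j, n j ^ 2 = 1
  · exact (sq_le_one_iff_abs_le_one _).1
      ((Finset.single_le_sum (fun i _ => sq_nonneg (n i)) (Finset.mem_univ j)).trans h1.le)
  · exact absurd (by simp [hamiltonian, h0, h1]) h

theorem mapJ_torusHamiltonian {d L : ℕ} (hL : 1 ≤ L) (W : ℝ) :
    mapJ (mapP (perHamiltonian (d := d) L W)) = perHamiltonian L W := by
  have key : ∀ (ω : PerConfig d L) n,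
      perHamiltonian L W (unroll (roll ω)) n = perHamiltonian L W ω n := by
    intro ω n
    unfold perHamiltonian hamiltonian
    by_cases h : n = 0
    · subst h
      have : (unroll (roll ω)).1 0 = ω.1 0 := by
        change ω.1 (coord (wrap L 0)) = _
        rw [wrap_zero, coord_eq_zero.2 rfl]
      rw [this]
    · simp [h]
  funext ω n
  unfold mapJ mapP
  simp only [key]
  by_cases hn : perHamiltonian L W ω n = 0
  · rw [hn]
    refine Finset.sum_eq_zero fun q _ => ?_
    split_ifs with h
    · rw [← h, hn]
    · rfl
  · have hc : coord (wrap L n) = n := coord_wrap fun j =>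
      (abs_le_one_of_hamiltonian_ne_zero hn j).trans (by exact_mod_cast hL)
    rw [Finset.sum_eq_single (wrap L n)]
    · rw [if_pos hc.symm, hc]
    · intro q _ hq
      rw [if_neg]
      rintro rfl
      exact hq (wrap_coord q).symm
    · simp

theorem hJ_eq_hPer {d L : ℕ} (hL : 1 ≤ L) (F : Matrix (Fin d) (Fin d) ℝ) (W : ℝ) :
    hJ L F W = hPer L F W := by
  have h : ∀ {f g : PerConfig d L → Lattice d → ℂ} (hf : IsCompactlySupported f)
      (hg : IsCompactlySupported g), f = g →
      ofFun perTranslate (magForm F) hf = ofFun perTranslate (magForm F) hg := by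
    rintro f g hf hg rfl
    rfl
  exact h _ _ (mapJ_torusHamiltonian hL W)

/-! ### Level curves of the distance to a compact subset of the real line -/

section LevelCurve

variable {K : Set ℝ}

/-- Pythagoras: the imaginary part adds the same amount to the squared distance from every real
point, so the nearest point depends on `z.re` alone. This makes the level curve a pair of graphs
over the real axis. -/
theorem sq_infDist_ofReal_image (hK : IsCompact K) (hne : K.Nonempty) (z : ℂ) :
    Metric.infDist z (Complex.ofReal '' K) ^ 2 = Metric.infDist z.re K ^ 2 + z.im ^ 2 := by
  have hd : ∀ p : ℝ, dist z p ^ 2 = dist z.re p ^ 2 + z.im ^ 2 := by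
    intro p
    rw [Complex.dist_eq, Complex.sq_norm, Complex.normSq_apply, Real.dist_eq, sq_abs]
    simp
    ring
  refine le_antisymm ?_ ?_
  · obtain ⟨p, hp, hpd⟩ := hK.exists_infDist_eq_dist hne z.re
    rw [hpd, ← hd]
    gcongr
    · exact Metric.infDist_nonneg
    · exact Metric.infDist_le_dist_of_mem (Set.mem_image_of_mem _ hp)
  · obtain ⟨_, ⟨p, hp, rfl⟩, hpd⟩ :=
      (hK.image Complex.continuous_ofReal).exists_infDist_eq_dist (hne.image _) z
    rw [hpd, hd]
    gcongr
    · exact Metric.infDist_nonneg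
    · exact Metric.infDist_le_dist_of_mem hp

/-- The level curve `{z | dist (z, K) = κ}` in the complex plane. -/
def levelCurve (K : Set ℝ) (κ : ℝ) : Set ℂ := {z | Metric.infDist z (Complex.ofReal '' K) = κ}

/-- The height of the level curve above a point of the real axis (`0` where it has no point). -/
def profile (K : Set ℝ) (κ x : ℝ) : ℝ := √(κ ^ 2 - Metric.infDist x K ^ 2)

theorem isClosed_levelCurve (K : Set ℝ) (κ : ℝ) : IsClosed (levelCurve K κ) :=
  isClosed_eq (Metric.continuous_infDist_pt _) continuous_const

theorem continuous_profile (K : Set ℝ) (κ : ℝ) : Continuous (profile K κ) :=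
  (continuous_const.sub ((Metric.continuous_infDist_pt _).pow 2)).sqrt

theorem profile_nonneg (K : Set ℝ) (κ x : ℝ) : 0 ≤ profile K κ x := Real.sqrt_nonneg _

theorem sq_profile_of_pos {κ x : ℝ} (h : 0 < profile K κ x) :
    profile K κ x ^ 2 = κ ^ 2 - Metric.infDist x K ^ 2 :=
  Real.sq_sqrt (Real.sqrt_pos.1 h).le

theorem profile_eq_zero_iff {κ : ℝ} (hκ : 0 ≤ κ) {x : ℝ} :
    profile K κ x = 0 ↔ κ ≤ Metric.infDist x K := by
  rw [profile, Real.sqrt_eq_zero', sub_nonpos, sq_le_sq₀ hκ Metric.infDist_nonneg]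

theorem infDist_mk_eq (hK : IsCompact K) (hne : K.Nonempty) {κ : ℝ} (hκ : 0 ≤ κ) {x s : ℝ} :
    Metric.infDist (⟨x, s⟩ : ℂ) (Complex.ofReal '' K) = κ ↔
      Metric.infDist x K ^ 2 + s ^ 2 = κ ^ 2 := by
  rw [← sq_eq_sq₀ Metric.infDist_nonneg hκ, sq_infDist_ofReal_image hK hne]

theorem mk_mem_levelCurve (hK : IsCompact K) (hne : K.Nonempty) {κ : ℝ} (hκ : 0 ≤ κ) {e x : ℝ}
    (he : e ^ 2 = 1) (hx : 0 < profile K κ x) :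
    (⟨x, e * profile K κ x⟩ : ℂ) ∈ levelCurve K κ := by
  refine (infDist_mk_eq hK hne hκ).2 ?_
  rw [mul_pow, he, sq_profile_of_pos hx]
  ring

theorem im_of_mem_levelCurve (hK : IsCompact K) (hne : K.Nonempty) {κ : ℝ} (hκ : 0 ≤ κ) {e : ℝ}
    (he : e ^ 2 = 1) {z : ℂ} (hz : z ∈ levelCurve K κ) (h : 0 ≤ e * z.im) :
    z.im = e * profile K κ z.re := by
  have h1 := (infDist_mk_eq hK hne hκ (x := z.re) (s := z.im)).1 hz
  have : profile K κ z.re = e * z.im := by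
    rw [profile, ← h1, ← Real.sqrt_sq h, mul_pow, he]
    ring_nf
  rw [this, ← mul_assoc, ← sq, he, one_mul]

/-- The graph may become vertical where it meets the axis, so it is used only over points within κ/2
of K. Elsewhere z lies on the circle around the point of K nearest to `z.re`, and few centres occur.
-/
theorem levelCurve_subset_union (hK : IsCompact K) (hne : K.Nonempty) {κ : ℝ} (hκ : 0 < κ) :
    levelCurve K κ ⊆
      (⋃ p ∈ {p ∈ K | ∃ x, Metric.infDist x K = |x - p| ∧ κ / 2 ≤ |x - p|},
        Metric.sphere (p : ℂ) κ) ∪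
      ((fun x : ℝ => (⟨x, profile K κ x⟩ : ℂ)) '' {x | Metric.infDist x K ≤ κ / 2} ∪
        (fun x : ℝ => (⟨x, -profile K κ x⟩ : ℂ)) '' {x | Metric.infDist x K ≤ κ / 2}) := by
  intro z hz
  rcases le_total (Metric.infDist z.re K) (κ / 2) with h | h
  · right
    rcases le_total 0 z.im with h0 | h0
    · left
      refine ⟨z.re, h, ?_⟩
      have := im_of_mem_levelCurve hK hne hκ.le (e := 1) (by norm_num) hz (by simpa using h0)
      refine Complex.ext rfl ?_
      simpa using this.symm
    · right
      refine ⟨z.re, h, ?_⟩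
      have := im_of_mem_levelCurve hK hne hκ.le (e := -1) (by norm_num) hz (by simpa using h0)
      refine Complex.ext rfl ?_
      simpa using this.symm
  · left
    obtain ⟨p, hp, hpd⟩ := hK.exists_infDist_eq_dist hne z.re
    rw [Real.dist_eq] at hpd
    refine Set.mem_biUnion (x := p) ⟨hp, z.re, hpd, hpd ▸ h⟩ ?_
    have h1 := (infDist_mk_eq hK hne hκ.le (x := z.re) (s := z.im)).1 hz
    rw [mem_sphere_iff_norm, ← sq_eq_sq₀ (norm_nonneg _) hκ.le, Complex.sq_norm,
      Complex.normSq_apply, ← h1, hpd, sq_abs]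
    simp
    ring

/-- If p is nearest to an x at distance at least κ/2 on one side, reflecting p in x shows that K has
no further point within κ of p on that side. For each side the admissible p are thus κ-separated in
a bounded set, and `⌊s * p / κ⌋` is injective on them. -/
theorem finite_gap_points (hK : IsCompact K) {κ : ℝ} (hκ : 0 < κ) :
    {p ∈ K | ∃ x, Metric.infDist x K = |x - p| ∧ κ / 2 ≤ |x - p|}.Finite := by
  have key : ∀ s : ℝ, s ^ 2 = 1 →
      {p ∈ K | ∃ x, Metric.infDist x K = s * (x - p) ∧ κ / 2 ≤ s * (x - p)}.Finite := by
    intro s hs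
    obtain ⟨R, hR⟩ := hK.isBounded.subset_closedBall 0
    have hs1 : |s| = 1 := by rwa [← sq_eq_sq₀ (abs_nonneg _) zero_le_one, sq_abs, one_pow]
    have hsep : ∀ p ∈ {p ∈ K | ∃ x, Metric.infDist x K = s * (x - p) ∧ κ / 2 ≤ s * (x - p)},
        ∀ p' ∈ K, s * p < s * p' → s * p + κ ≤ s * p' := by
      rintro p ⟨hp, x, h1, h2⟩ p' hp' hlt
      have h3 : Metric.infDist x K ≤ |s * (x - p')| := by
        rw [abs_mul, hs1, one_mul]
        exact Metric.infDist_le_dist_of_mem hp'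
      rw [h1, le_abs] at h3
      rcases h3 with h3 | h3 <;> linarith
    refine Set.Finite.of_injOn (f := fun p => ⌊s * p / κ⌋)
      (t := Set.Icc ⌊-R / κ⌋ ⌊R / κ⌋) ?_ ?_ (Set.finite_Icc _ _)
    · rintro p ⟨hp, -⟩
      have h1 : |s * p| ≤ R := by
        rw [abs_mul, hs1, one_mul]
        simpa using hR hp
      have h2 := abs_le.1 h1
      exact ⟨Int.floor_le_floor (by gcongr; exact h2.1), Int.floor_le_floor (by gcongr; exact h2.2)⟩
    · have hlt : ∀ p ∈ {p ∈ K | ∃ x, Metric.infDist x K = s * (x - p) ∧ κ / 2 ≤ s * (x - p)},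
          ∀ p' ∈ K, s * p < s * p' → ⌊s * p / κ⌋ < ⌊s * p' / κ⌋ := by
        intro p hp p' hp' h
        have h1 := hsep p hp p' hp' h
        have h2 : s * p / κ + 1 ≤ s * p' / κ := by
          rw [div_add_one hκ.ne']
          gcongr
        have h3 := Int.floor_le_floor h2
        rw [Int.floor_add_one] at h3
        omega
      intro p hp p' hp' h
      have h0 : s ≠ 0 := by
        rintro rfl
        simp at hs1
      rcases lt_trichotomy (s * p) (s * p') with h1 | h1 | h1
      · exact absurd h (hlt p hp p' hp'.1 h1).ne
      · exact mul_left_cancel₀ h0 h1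
      · exact absurd h (hlt p' hp' p hp.1 h1).ne'
  refine ((key 1 (by norm_num)).union (key (-1) (by norm_num))).subset ?_
  rintro p ⟨hp, x, h1, h2⟩
  rcases abs_cases (x - p) with ⟨h, -⟩ | ⟨h, -⟩
  · exact Or.inl ⟨hp, x, by rw [h1, h, one_mul], by rwa [h, ← one_mul (x - p)] at h2⟩
  · exact Or.inr ⟨hp, x, by rw [h1, h]; ring, by rw [h] at h2; linarith⟩

theorem hausdorffMeasure_sphere_lt_top (p : ℂ) {κ : ℝ} (hκ : 0 ≤ κ) :
    μH[1] (Metric.sphere p κ) < ∞ := by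
  have h : Metric.sphere p κ ⊆ circleMap p κ '' Set.Icc 0 (2 * Real.pi) := by
    intro z hz
    rw [← abs_of_nonneg hκ, ← image_circleMap_Ioc] at hz
    exact Set.image_mono Set.Ioc_subset_Icc_self hz
  refine (measure_mono h).trans_lt ?_
  refine ((lipschitzWith_circleMap p κ).hausdorffMeasure_image_le zero_le_one _).trans_lt ?_
  rw [hausdorffMeasure_real]
  exact ENNReal.mul_lt_top (by simp) measure_Icc_lt_top

theorem hausdorffMeasure_levelCurve_lt_top (hK : IsCompact K) (hne : K.Nonempty) {κ : ℝ}
    (hκ : 0 < κ) : μH[1] (levelCurve K κ) < ∞ := by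
  refine (measure_mono (levelCurve_subset_union hK hne hκ)).trans_lt ?_
  have hfin : (volume {x | Metric.infDist x K ≤ κ / 2}) < ∞ := by
    have : {x | Metric.infDist x K ≤ κ / 2} ⊆ Metric.cthickening (κ / 2) K := by
      intro x hx
      obtain ⟨p, hp, hpd⟩ := hK.exists_infDist_eq_dist hne x
      exact Metric.mem_cthickening_of_dist_le x p _ _ hp (hpd ▸ hx)
    exact (hK.isBounded.cthickening.subset this).measure_lt_top
  -- With m the profile and D the distance to K, |m - m'|(m + m') = |D - D'|(D + D'). Over the
  -- region D ≤ κ/2 one has m + m' ≥ κ ≥ D + D', so the profile inherits the Lipschitz constant 1 of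
  -- D.
  have hlip : ∀ x ∈ {x | Metric.infDist x K ≤ κ / 2}, ∀ x' ∈ {x | Metric.infDist x K ≤ κ / 2},
      |profile K κ x - profile K κ x'| ≤ |x - x'| := by
    intro x hx x' hx'
    have hd := (Metric.lipschitz_infDist_pt K).dist_le_mul x x'
    change Metric.infDist x K ≤ κ / 2 at hx
    change Metric.infDist x' K ≤ κ / 2 at hx'
    rw [Real.dist_eq, Real.dist_eq, NNReal.coe_one, one_mul] at hd
    have h0 : ∀ w, Metric.infDist w K ≤ κ / 2 → κ / 2 ≤ profile K κ w ∧
        profile K κ w ^ 2 = κ ^ 2 - Metric.infDist w K ^ 2 := by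
      intro w hw
      have : Metric.infDist w K ^ 2 ≤ (κ / 2) ^ 2 := by
        gcongr
        exact Metric.infDist_nonneg
      refine ⟨Real.le_sqrt_of_sq_le (by nlinarith), Real.sq_sqrt (by nlinarith)⟩
    obtain ⟨h1, h2⟩ := h0 x hx
    obtain ⟨h3, h4⟩ := h0 x' hx'
    have hn := Metric.infDist_nonneg (x := x) (s := K)
    have hn' := Metric.infDist_nonneg (x := x') (s := K)
    have e1 : |profile K κ x - profile K κ x'| * (profile K κ x + profile K κ x') =
        |Metric.infDist x K - Metric.infDist x' K| *
          (Metric.infDist x K + Metric.infDist x' K) := by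
      rw [← abs_of_nonneg (a := profile K κ x + profile K κ x') (by linarith), ← abs_mul,
        ← abs_of_nonneg (a := Metric.infDist x K + Metric.infDist x' K) (by linarith), ← abs_mul,
        ← abs_neg]
      congr 1
      linear_combination h4 - h2
    have e2 : |profile K κ x - profile K κ x'| * κ ≤ |x - x'| * κ :=
      calc |profile K κ x - profile K κ x'| * κ
          ≤ |profile K κ x - profile K κ x'| * (profile K κ x + profile K κ x') := by
            gcongr
            linarith
        _ ≤ |x - x'| * κ := by
            rw [e1]
            gcongr
            linarith
    exact le_of_mul_le_mul_right e2 hκ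
  have hgr : ∀ e : ℝ, e ^ 2 = 1 →
      μH[1] ((fun x : ℝ => (⟨x, e * profile K κ x⟩ : ℂ)) '' {x | Metric.infDist x K ≤ κ / 2})
        < ∞ := by
    intro e he
    have hL : LipschitzOnWith 2 (fun x : ℝ => (⟨x, e * profile K κ x⟩ : ℂ))
        {x | Metric.infDist x K ≤ κ / 2} := by
      refine LipschitzOnWith.of_dist_le_mul fun x hx x' hx' => ?_
      rw [Complex.dist_eq, Real.dist_eq]
      refine (Complex.norm_le_abs_re_add_abs_im _).trans ?_
      have := hlip x hx x' hx'
      have he' : |e| = 1 := by rwa [← sq_eq_sq₀ (abs_nonneg _) zero_le_one, sq_abs, one_pow]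
      simp only [Complex.sub_re, Complex.sub_im, ← mul_sub, abs_mul, he', NNReal.coe_ofNat]
      linarith
    refine (hL.hausdorffMeasure_image_le zero_le_one).trans_lt ?_
    rw [hausdorffMeasure_real]
    exact ENNReal.mul_lt_top (by simp) hfin
  refine measure_union_lt_top ?_ (measure_union_lt_top ?_ ?_)
  · exact (measure_biUnion_lt_top (finite_gap_points hK hκ)
      fun p _ => hausdorffMeasure_sphere_lt_top _ hκ.le)
  · simpa using hgr 1 (by norm_num)
  · simpa using hgr (-1) (by norm_num)

end LevelCurve

/-! ### Staircase contours -/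

section Staircase

open Complex (I)

/-- The contribution to a contour integral of `g` of one step of a staircase and its mirror image:
the horizontal edges over `[x, x']` at heights `±m` and the vertical edges at `x'` between the
heights `±m` and `±m'`. -/
def stairTerm (g : ℂ → ℂ) (x x' m m' : ℝ) : ℂ :=
  (∫ u in x..x', (g ⟨u, -m⟩ - g ⟨u, m⟩)) - I * ∫ s in m..m', (g ⟨x', s⟩ + g ⟨x', -s⟩)

theorem continuous_mk_right (u : ℝ) : Continuous fun s : ℝ => (⟨u, s⟩ : ℂ) := by
  simp only [Complex.mk_eq_add_mul_I]
  fun_prop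

theorem continuous_mk_left (s : ℝ) : Continuous fun u : ℝ => (⟨u, s⟩ : ℂ) := by
  simp only [Complex.mk_eq_add_mul_I]
  fun_prop

/-- Rewrites a vertical edge together with its mirror image as a difference of integrals over full
cross-sections, the form in which steps telescope. -/
theorem integral_add_reflect {r : ℝ → ℂ} {a b : ℝ} (ha : 0 ≤ a) (hb : 0 ≤ b)
    (hr : ContinuousOn r (Set.Icc (-max a b) (max a b))) :
    ∫ s in a..b, (r s + r (-s)) = (∫ s in (-b)..b, r s) - ∫ s in (-a)..a, r s := by
  have hint : ∀ c c', |c| ≤ max a b → |c'| ≤ max a b → IntervalIntegrable r volume c c' := by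
    intro c c' hc hc'
    refine (hr.mono ?_).intervalIntegrable
    exact Set.uIcc_subset_Icc (abs_le.1 hc) (abs_le.1 hc')
  have ha' : |a| ≤ max a b := by rw [abs_of_nonneg ha]; exact le_max_left _ _
  have hb' : |b| ≤ max a b := by rw [abs_of_nonneg hb]; exact le_max_right _ _
  have hna : |-a| ≤ max a b := by rwa [abs_neg]
  have hnb : |-b| ≤ max a b := by rwa [abs_neg]
  have hneg : IntervalIntegrable (fun s => r (-s)) volume a b := by
    simpa using (IntervalIntegrable.iff_comp_neg (f := r) (a := -a) (b := -b)).1 (hint _ _ hna hnb)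
  rw [intervalIntegral.integral_add (hint _ _ ha' hb') hneg, intervalIntegral.integral_comp_neg,
    ← intervalIntegral.integral_add_adjacent_intervals (hint (-b) (-a) hnb hna)
      (hint (-a) b hna hb'),
    ← intervalIntegral.integral_add_adjacent_intervals (hint (-a) a hna ha') (hint a b ha' hb')]
  ring

/-- Cauchy's theorem on the rectangle between the two horizontal edges, combined with
`integral_add_reflect`, makes each step a difference of consecutive cross-section integrals. The sum
telescopes, and both end cross-sections have height zero. -/
theorem sum_stairTerm_eq_zero {q : ℂ → ℂ} {D : Set ℂ} (hq : DifferentiableOn ℂ q D) {x m : ℕ → ℝ}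
    (hx : Monotone x) (hm : ∀ k, 0 ≤ m k) {n : ℕ} (h0 : m 0 = 0) (hn : m n = 0)
    (hD : ∀ k, 0 < m k → ∀ u ∈ Set.Icc (x k) (x (k + 1)), ∀ s, |s| ≤ m k → (⟨u, s⟩ : ℂ) ∈ D) :
    ∑ k ∈ Finset.range n, stairTerm q (x k) (x (k + 1)) (m k) (m (k + 1)) = 0 := by
  have hcont : ∀ k, 0 < m k → ∀ u ∈ Set.Icc (x k) (x (k + 1)),
      ContinuousOn (fun s : ℝ => q ⟨u, s⟩) (Set.Icc (-m k) (m k)) := by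
    intro k hk u hu
    refine hq.continuousOn.comp ?_ fun s hs => hD k hk u hu s (abs_le.2 hs)
    exact (continuous_mk_right u).continuousOn
  have key : ∀ k, stairTerm q (x k) (x (k + 1)) (m k) (m (k + 1)) =
      I * (∫ s in (-m k)..m k, q ⟨x k, s⟩) -
        I * ∫ s in (-m (k + 1))..m (k + 1), q ⟨x (k + 1), s⟩ := by
    intro k
    have hhor : (∫ u in x k..x (k + 1), (q ⟨u, -m k⟩ - q ⟨u, m k⟩)) =
        I * (∫ s in (-m k)..m k, q ⟨x k, s⟩) - I * ∫ s in (-m k)..m k, q ⟨x (k + 1), s⟩ := by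
      rcases (hm k).eq_or_lt with h | h
      · simp [← h]
      · have hrect := Complex.integral_boundary_rect_eq_zero_of_differentiableOn q
          ⟨x k, -m k⟩ ⟨x (k + 1), m k⟩ (hq.mono ?_)
        · simp only [← Complex.mk_eq_add_mul_I, smul_eq_mul] at hrect
          rw [intervalIntegral.integral_sub]
          · linear_combination hrect
          all_goals
            refine ContinuousOn.intervalIntegrable ?_
            rw [Set.uIcc_of_le (hx (Nat.le_succ k))]
            refine hq.continuousOn.comp ?_ fun u hu => hD k h u hu _ (by simp [abs_of_pos h])
            exact (continuous_mk_left _).continuousOn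
        · intro z hz
          rw [Complex.mem_reProdIm, Set.uIcc_of_le (hx (Nat.le_succ k)),
            Set.uIcc_of_le (by linarith)] at hz
          exact hD k h z.re hz.1 z.im (abs_le.2 hz.2)
    have hver := integral_add_reflect (r := fun s => q ⟨x (k + 1), s⟩) (hm k) (hm (k + 1)) ?_
    · rw [stairTerm, hhor, hver]
      ring
    · rcases le_total (m k) (m (k + 1)) with h | h
      · rw [max_eq_right h]
        rcases (hm (k + 1)).eq_or_lt with h' | h'
        · simp [← h']
        · exact hcont _ h' _ (Set.left_mem_Icc.2 (hx (Nat.le_succ _)))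
      · rw [max_eq_left h]
        rcases (hm k).eq_or_lt with h' | h'
        · simp [← h']
        · exact hcont _ h' _ (Set.right_mem_Icc.2 (hx (Nat.le_succ _)))
  rw [Finset.sum_congr rfl fun k _ => key k,
    Finset.sum_range_sub' (fun k => I * ∫ s in (-m k)..m k, q ⟨x k, s⟩)]
  simp [h0, hn]

/-- The branch of `log (z - t)`, up to a constant, used on the half plane of sign `e`. -/
def halfLog (e t u s : ℝ) : ℂ := Complex.log ⟨s, -e * (u - t)⟩

/-- Multiplication by -eI turns the closed half plane of sign e into the right half plane, where the
principal logarithm is analytic away from the origin. This is why `halfLog` is a primitive of 1/(z -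
t) there, including on the real axis. -/
theorem mk_mul_eq {e t u s : ℝ} (he : e ^ 2 = 1) :
    (⟨s, -e * (u - t)⟩ : ℂ) = -e * I * (⟨u, e * s⟩ - t) := by
  refine Complex.ext ?_ ?_
  · simp
    linear_combination (-s) * he
  · simp

theorem mk_mem_slitPlane {e t u s : ℝ} (he : e ^ 2 = 1) (h0 : 0 ≤ s) (h : (⟨u, s⟩ : ℂ) ≠ t) :
    (⟨s, -e * (u - t)⟩ : ℂ) ∈ Complex.slitPlane := by
  rw [Complex.mem_slitPlane_iff]
  rcases h0.eq_or_lt with h0 | h0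
  · right
    subst h0
    refine mul_ne_zero (neg_ne_zero.2 ?_) (sub_ne_zero.2 fun hu => h ?_)
    · rintro rfl
      simp at he
    · rw [hu]
      rfl
  · exact Or.inl h0

theorem mk_sub_ne_zero {e t u s : ℝ} (he : e ^ 2 = 1) (h0 : 0 ≤ s) (h : (⟨u, s⟩ : ℂ) ≠ t) :
    (⟨u, e * s⟩ : ℂ) - t ≠ 0 := by
  intro h'
  have := mk_mul_eq (t := t) (u := u) (s := s) he
  rw [h', mul_zero] at this
  exact Complex.slitPlane_ne_zero (mk_mem_slitPlane he h0 h) this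

theorem intervalIntegrable_step {e t x x' m m' : ℝ} (he : e ^ 2 = 1) (hm : 0 ≤ m) (hm' : 0 ≤ m')
    (hx : ∀ u ∈ Set.uIcc x x', (⟨u, m⟩ : ℂ) ≠ t) (hs : ∀ s ∈ Set.uIcc m m', (⟨x', s⟩ : ℂ) ≠ t) :
    IntervalIntegrable (fun u => 1 / ((⟨u, e * m⟩ : ℂ) - t)) volume x x' ∧
      IntervalIntegrable (fun s => 1 / ((⟨x', e * s⟩ : ℂ) - t)) volume m m' := by
  have hs0 : ∀ s ∈ Set.uIcc m m', 0 ≤ s := fun s h => (le_min hm hm').trans h.1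
  refine ⟨?_, ?_⟩
  · refine ContinuousOn.intervalIntegrable fun u hu => ContinuousAt.continuousWithinAt ?_
    exact continuousAt_const.div ((continuous_mk_left _).continuousAt.sub continuousAt_const)
      (mk_sub_ne_zero he hm (hx u hu))
  · refine ContinuousOn.intervalIntegrable fun s hs' => ContinuousAt.continuousWithinAt ?_
    refine continuousAt_const.div (ContinuousAt.sub ?_ continuousAt_const)
      (mk_sub_ne_zero he (hs0 s hs') (hs s hs'))
    exact ((continuous_mk_right x').comp (continuous_const_mul e)).continuousAt

theorem step_eq_halfLog_sub {e t x x' m m' : ℝ} (he : e ^ 2 = 1) (hm : 0 ≤ m) (hm' : 0 ≤ m')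
    (hx : ∀ u ∈ Set.uIcc x x', (⟨u, m⟩ : ℂ) ≠ t) (hs : ∀ s ∈ Set.uIcc m m', (⟨x', s⟩ : ℂ) ≠ t) :
    (∫ u in x..x', 1 / ((⟨u, e * m⟩ : ℂ) - t)) + e * I * (∫ s in m..m', 1 / ((⟨x', e * s⟩ : ℂ) - t))
      = halfLog e t x' m' - halfLog e t x m := by
  have he0 : (e : ℂ) ≠ 0 := by
    rw [Complex.ofReal_ne_zero]
    rintro rfl
    simp at he
  have heI : (-e * I : ℂ) ≠ 0 := by simp [he0]
  have heC : (e : ℂ) ^ 2 = 1 := by exact_mod_cast he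
  have hI := intervalIntegrable_step he hm hm' hx hs
  have hs0 : ∀ s ∈ Set.uIcc m m', 0 ≤ s := fun s h => (le_min hm hm').trans h.1
  have h1 : (∫ u in x..x', 1 / ((⟨u, e * m⟩ : ℂ) - t)) = halfLog e t x' m - halfLog e t x m := by
    refine intervalIntegral.integral_eq_sub_of_hasDerivAt (f := fun u => halfLog e t u m)
      (fun u hu => ?_) ?_
    · have hd : HasDerivAt (fun u : ℝ => (⟨m, -e * (u - t)⟩ : ℂ)) (-e * I) u := by
        have : (fun u : ℝ => (⟨m, -e * (u - t)⟩ : ℂ)) = fun u : ℝ => (m : ℂ) + -e * I * (u - t) := by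
          funext u
          rw [Complex.mk_eq_add_mul_I]
          push_cast
          ring
        rw [this]
        simpa using (((Complex.ofRealCLM.hasDerivAt (x := u)).sub_const (t : ℂ)).const_mul
          (-e * I : ℂ)).const_add (m : ℂ)
      refine (hd.clog_real (mk_mem_slitPlane he hm (hx u hu))).congr_deriv ?_
      rw [mk_mul_eq he]
      field_simp
    · exact hI.1
  have h2 : e * I * (∫ s in m..m', 1 / ((⟨x', e * s⟩ : ℂ) - t)) =
      halfLog e t x' m' - halfLog e t x' m := by
    rw [← intervalIntegral.integral_const_mul]
    refine intervalIntegral.integral_eq_sub_of_hasDerivAt (f := fun s => halfLog e t x' s)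
      (fun s hs' => ?_) ?_
    · have hd : HasDerivAt (fun s : ℝ => (⟨s, -e * (x' - t)⟩ : ℂ)) 1 s := by
        have : (fun s : ℝ => (⟨s, -e * (x' - t)⟩ : ℂ)) =
            fun s : ℝ => (s : ℂ) + ((-e * (x' - t) : ℝ) : ℂ) * I := by
          funext u
          rw [Complex.mk_eq_add_mul_I]
        rw [this]
        exact (Complex.ofRealCLM.hasDerivAt (x := s)).add_const (((-e * (x' - t) : ℝ) : ℂ) * I)
      refine (hd.clog_real (mk_mem_slitPlane he (hs0 s hs') (hs s hs'))).congr_deriv ?_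
      rw [mk_mul_eq he]
      have := mk_sub_ne_zero he (hs0 s hs') (hs s hs')
      field_simp
      linear_combination heC - (e : ℂ) ^ 2 * Complex.I_sq
    · exact hI.2.const_mul _
  rw [h1, h2]
  ring

theorem halfLog_zero_of_neg {e t u : ℝ} (h : 0 < -e * (u - t)) :
    halfLog e t u 0 = Real.log (-e * (u - t)) + Real.pi / 2 * I := by
  have : (⟨0, -e * (u - t)⟩ : ℂ) = ((-e * (u - t) : ℝ) : ℂ) * I := by
    rw [Complex.mk_eq_add_mul_I]; simp
  rw [halfLog, this, Complex.log_ofReal_mul h Complex.I_ne_zero, Complex.log_I]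

theorem halfLog_zero_of_pos {e t u : ℝ} (h : 0 < e * (u - t)) :
    halfLog e t u 0 = Real.log (e * (u - t)) - Real.pi / 2 * I := by
  have : (⟨0, -e * (u - t)⟩ : ℂ) = ((e * (u - t) : ℝ) : ℂ) * (-I) := by
    rw [Complex.mk_eq_add_mul_I]; push_cast; ring
  rw [halfLog, this, Complex.log_ofReal_mul h (neg_ne_zero.2 Complex.I_ne_zero), Complex.log_neg_I]
  ring

/-- The winding number is found without topology: in each half plane `halfLog` is a primitive along
the staircase, so only its values at the two real endpoints survive. Their real parts cancel between
the half planes, and the four arguments of size π/2 add up to 2π. -/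
theorem sum_stairTerm_inv_sub {t : ℝ} {x m : ℕ → ℝ} (hm : ∀ k, 0 ≤ m k) {n : ℕ} (h0 : m 0 = 0)
    (hn : m n = 0) (hxt : x 0 < t) (htx : t < x n)
    (hx : ∀ k, ∀ u ∈ Set.uIcc (x k) (x (k + 1)), (⟨u, m k⟩ : ℂ) ≠ t)
    (hs : ∀ k, ∀ s ∈ Set.uIcc (m k) (m (k + 1)), (⟨x (k + 1), s⟩ : ℂ) ≠ t) :
    ∑ k ∈ Finset.range n, stairTerm (fun z => 1 / (z - t)) (x k) (x (k + 1)) (m k) (m (k + 1))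
      = 2 * Real.pi * I := by
  have key : ∀ k, stairTerm (fun z => 1 / (z - t)) (x k) (x (k + 1)) (m k) (m (k + 1)) =
      (halfLog (-1) t (x (k + 1)) (m (k + 1)) - halfLog (-1) t (x k) (m k)) -
        (halfLog 1 t (x (k + 1)) (m (k + 1)) - halfLog 1 t (x k) (m k)) := by
    intro k
    have hp := step_eq_halfLog_sub (e := 1) (by norm_num) (hm k) (hm (k + 1)) (hx k) (hs k)
    have hn := step_eq_halfLog_sub (e := -1) (by norm_num) (hm k) (hm (k + 1)) (hx k) (hs k)
    have hI := fun e (he : e ^ 2 = 1) => intervalIntegrable_step (e := e) he (hm k) (hm (k + 1))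
      (hx k) (hs k)
    rw [← hp, ← hn, stairTerm, intervalIntegral.integral_sub, intervalIntegral.integral_add]
    · simp only [one_mul, neg_mul, Complex.ofReal_neg, Complex.ofReal_one]
      ring
    · simpa using (hI 1 (by norm_num)).2
    · simpa using (hI (-1) (by norm_num)).2
    · simpa using (hI (-1) (by norm_num)).1
    · simpa using (hI 1 (by norm_num)).1
  rw [Finset.sum_congr rfl fun k _ => key k, Finset.sum_sub_distrib,
    Finset.sum_range_sub (fun k => halfLog (-1) t (x k) (m k)),
    Finset.sum_range_sub (fun k => halfLog 1 t (x k) (m k)), h0, hn,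
    halfLog_zero_of_neg (e := -1) (u := x n) (by linarith),
    halfLog_zero_of_pos (e := -1) (u := x 0) (by linarith),
    halfLog_zero_of_pos (e := 1) (u := x n) (by linarith),
    halfLog_zero_of_neg (e := 1) (u := x 0) (by linarith)]
  simp
  ring

end Staircase

/-! ### Lengths of pieces of the level curve -/

section Lengths

variable {K : Set ℝ}

/-- The part of the level curve over `(a, b]` in the half plane of sign `e`. -/
def strip (K : Set ℝ) (κ e a b : ℝ) : Set ℂ :=
  levelCurve K κ ∩ {z | z.re ∈ Set.Ioc a b ∧ 0 ≤ e * z.im}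

theorem measurableSet_strip (K : Set ℝ) (κ e a b : ℝ) : MeasurableSet (strip K κ e a b) := by
  refine (isClosed_levelCurve K κ).measurableSet.inter (MeasurableSet.inter ?_ ?_)
  · exact Complex.measurable_re measurableSet_Ioc
  · exact measurableSet_le measurable_const (Complex.measurable_im.const_mul e)

theorem strip_subset (K : Set ℝ) (κ e a b : ℝ) : strip K κ e a b ⊆ levelCurve K κ :=
  Set.inter_subset_left

theorem strip_union (K : Set ℝ) (κ e : ℝ) {a b c : ℝ} (hab : a ≤ b) (hbc : b ≤ c) :
    strip K κ e a b ∪ strip K κ e b c = strip K κ e a c := by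
  rw [strip, strip, strip, ← Set.inter_union_distrib_left]
  congr 1
  ext z
  have := Set.ext_iff.1 (Set.Ioc_union_Ioc_eq_Ioc hab hbc) z.re
  simp only [Set.mem_union] at this
  change (z.re ∈ _ ∧ _) ∨ (z.re ∈ _ ∧ _) ↔ z.re ∈ _ ∧ _
  tauto

theorem mem_strip (hK : IsCompact K) (hne : K.Nonempty) {κ : ℝ} (hκ : 0 ≤ κ) {e a b x : ℝ}
    (he : e ^ 2 = 1) (hx : 0 < profile K κ x) (hxab : x ∈ Set.Ioc a b) :
    (⟨x, e * profile K κ x⟩ : ℂ) ∈ strip K κ e a b := by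
  refine ⟨mk_mem_levelCurve hK hne hκ he hx, hxab, ?_⟩
  change 0 ≤ e * (e * profile K κ x)
  rw [← mul_assoc, ← sq, he, one_mul]
  exact hx.le

theorem eq_of_mem_strip (hK : IsCompact K) (hne : K.Nonempty) {κ : ℝ} (hκ : 0 ≤ κ) {e a b : ℝ}
    (he : e ^ 2 = 1) {z : ℂ} (hz : z ∈ strip K κ e a b) : z = ⟨z.re, e * profile K κ z.re⟩ :=
  Complex.ext rfl (im_of_mem_levelCurve hK hne hκ he hz.1 hz.2.2)

/-- Projection to the real axis is 1-Lipschitz, so it cannot increase one-dimensional measure, and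
it maps the strip onto the whole interval. -/
theorem width_le_hausdorffMeasure_strip (hK : IsCompact K) (hne : K.Nonempty) {κ : ℝ}
    (hκ : 0 ≤ κ) {e a b : ℝ} (he : e ^ 2 = 1) (h : ∀ x ∈ Set.Ioc a b, 0 < profile K κ x) :
    ENNReal.ofReal (b - a) ≤ μH[1] (strip K κ e a b) := by
  have h1 : Set.Ioc a b ⊆ Complex.re '' strip K κ e a b := fun x hx =>
    ⟨_, mem_strip hK hne hκ he (h x hx) hx, rfl⟩
  have h2 : LipschitzWith 1 Complex.re := LipschitzWith.of_dist_le_mul fun z w => by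
    rw [NNReal.coe_one, one_mul, Real.dist_eq, Complex.dist_eq, ← Complex.sub_re]
    exact Complex.abs_re_le_norm _
  have h3 := h2.hausdorffMeasure_image_le zero_le_one (strip K κ e a b)
  rw [hausdorffMeasure_real] at h3
  calc ENNReal.ofReal (b - a) = volume (Set.Ioc a b) := Real.volume_Ioc.symm
    _ ≤ volume (Complex.re '' strip K κ e a b) := measure_mono h1
    _ ≤ _ := by simpa using h3

/-- The same argument with projection to the imaginary axis; the intermediate value theorem shows
that every height between the two profile values is attained. -/
theorem height_le_hausdorffMeasure_strip (hK : IsCompact K) (hne : K.Nonempty) {κ : ℝ}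
    (hκ : 0 ≤ κ) {e a b u v : ℝ} (he : e ^ 2 = 1) (hu : u ∈ Set.Icc a b) (hv : v ∈ Set.Icc a b) :
    ENNReal.ofReal (profile K κ v - profile K κ u) ≤ μH[1] (strip K κ e a b) := by
  -- The strip is open at a, so the height `profile K κ a` might be attained only at the missing
  -- abscissa. It is discarded as a null set.
  have h1 : Set.Ioo (profile K κ u) (profile K κ v) \ {profile K κ a} ⊆
      (fun z : ℂ => e * z.im) '' strip K κ e a b := by
    rintro c ⟨hc, hca⟩
    have hsub := intermediate_value_uIcc (continuous_profile K κ).continuousOn (a := u) (b := v)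
    obtain ⟨w, hw, rfl⟩ := hsub (Set.Icc_subset_uIcc (Set.Ioo_subset_Icc_self hc))
    have hw' : w ∈ Set.Icc a b := Set.uIcc_subset_Icc hu hv hw
    have hwa : a < w := lt_of_le_of_ne hw'.1 fun h => hca (by rw [h]; rfl)
    have hpos : 0 < profile K κ w := (profile_nonneg K κ u).trans_lt hc.1
    refine ⟨_, mem_strip hK hne hκ he hpos ⟨hwa, hw'.2⟩, ?_⟩
    change e * (e * profile K κ w) = _
    rw [← mul_assoc, ← sq, he, one_mul]
  have he' : |e| = 1 := by rwa [← sq_eq_sq₀ (abs_nonneg _) zero_le_one, sq_abs, one_pow]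
  have h2 : LipschitzWith 1 (fun z : ℂ => e * z.im) := LipschitzWith.of_dist_le_mul fun z w => by
    rw [NNReal.coe_one, one_mul, Real.dist_eq, Complex.dist_eq, ← mul_sub, abs_mul, he', one_mul,
      ← Complex.sub_im]
    exact Complex.abs_im_le_norm _
  have h3 := h2.hausdorffMeasure_image_le zero_le_one (strip K κ e a b)
  rw [hausdorffMeasure_real] at h3
  calc ENNReal.ofReal (profile K κ v - profile K κ u)
      = volume (Set.Ioo (profile K κ u) (profile K κ v) \ {profile K κ a}) := by
        rw [measure_sdiff_null Real.volume_singleton, Real.volume_Ioo]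
    _ ≤ volume ((fun z : ℂ => e * z.im) '' strip K κ e a b) := measure_mono h1
    _ ≤ _ := by simpa using h3

theorem mul_le_setIntegral_of_le {S : Set ℂ} {μ : Measure ℂ} (hS : MeasurableSet S)
    (hfin : μ S ≠ ∞) {f : ℂ → ℝ} (hf : IntegrableOn f S μ) {c l : ℝ} (hc : 0 ≤ c)
    (hl : ENNReal.ofReal l ≤ μ S) (h : ∀ z ∈ S, c ≤ f z) : l * c ≤ ∫ z in S, f z ∂μ := by
  have h1 : l ≤ μ.real S := (ENNReal.ofReal_le_iff_le_toReal hfin).1 hl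
  calc l * c ≤ μ.real S * c := by gcongr
    _ = ∫ _ in S, c ∂μ := by rw [setIntegral_const, smul_eq_mul]
    _ ≤ _ := setIntegral_mono_on (integrableOn_const hfin) hf hS h

theorem sum_setIntegral_strip_le {κ e : ℝ} {f : ℂ → ℝ} (hf0 : ∀ z, 0 ≤ f z)
    (hf : IntegrableOn f (levelCurve K κ) μH[1]) {x : ℕ → ℝ} (hx : Monotone x) (n : ℕ) :
    ∑ k ∈ Finset.range n, ∫ z in strip K κ e (x k) (x (k + 1)), f z ∂μH[1] ≤
      ∫ z in levelCurve K κ, f z ∂μH[1] := by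
  rw [← integral_biUnion_finset]
  · refine setIntegral_mono_set hf (ae_of_all _ hf0) (HasSubset.Subset.eventuallyLE ?_)
    exact Set.iUnion₂_subset fun k _ => strip_subset _ _ _ _ _
  · exact fun k _ => measurableSet_strip _ _ _ _ _
  · intro i _ j _ hij
    have h := hx.pairwise_disjoint_on_Ioc_succ hij
    refine Set.disjoint_left.2 fun z hz hz' => Set.disjoint_left.1 h hz.2.1 hz'.2.1
  · exact fun k _ => hf.mono_set (strip_subset _ _ _ _ _)

theorem uniformContinuous_profile (hK : IsCompact K) {κ : ℝ} (hκ : 0 ≤ κ) :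
    UniformContinuous (profile K κ) := by
  rcases K.eq_empty_or_nonempty with rfl | hne
  · have : profile ∅ κ = fun _ => √(κ ^ 2) := by
      funext x
      simp [profile]
    rw [this]
    exact uniformContinuous_const
  refine HasCompactSupport.uniformContinuous_of_continuous ?_ (continuous_profile K κ)
  refine HasCompactSupport.intro (K := Metric.cthickening κ K) hK.cthickening fun x hx => ?_
  rw [profile_eq_zero_iff hκ]
  by_contra! h
  obtain ⟨p, hp, hpd⟩ := hK.exists_infDist_eq_dist hne x
  exact hx (Metric.mem_cthickening_of_dist_le x p _ _ hp (hpd ▸ h.le))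

end Lengths

/-! ### Point evaluations approximating a single step of a staircase -/

section Step

open Complex (I)

theorem dist_mk_left (w u s : ℝ) : dist (⟨w, s⟩ : ℂ) ⟨u, s⟩ = |w - u| := by
  rw [Complex.dist_of_im_eq (z := ⟨w, s⟩) (w := ⟨u, s⟩) rfl, Real.dist_eq]

theorem dist_mk_right (u s v : ℝ) : dist (⟨u, s⟩ : ℂ) ⟨u, v⟩ = |s - v| := by
  rw [Complex.dist_of_re_eq (z := ⟨u, s⟩) (w := ⟨u, v⟩) rfl, Real.dist_eq]

theorem abs_sub_le_of_mem_uIcc {a b s v : ℝ} (hs : s ∈ Set.uIcc a b) (hv : v ∈ Set.uIcc a b) :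
    |s - v| ≤ |b - a| := by
  rcases le_total a b with h | h
  · rw [Set.uIcc_of_le h] at hs hv
    rw [abs_of_nonneg (sub_nonneg.2 h), abs_le]
    constructor <;> linarith [hs.1, hs.2, hv.1, hv.2]
  · rw [Set.uIcc_of_ge h] at hs hv
    rw [abs_of_nonpos (sub_nonpos.2 h), abs_le]
    constructor <;> linarith [hs.1, hs.2, hv.1, hv.2]

/-- The edges of a step of a staircase (and of its mirror image) that contribute to `stairTerm`
lie in `C`. -/
structure StepIn (C : Set ℂ) (x x' m m' : ℝ) : Prop where
  le : x ≤ x'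
  nonneg : 0 ≤ m
  hor : 0 < m → ∀ w ∈ Set.Icc x x', (⟨w, m⟩ : ℂ) ∈ C ∧ (⟨w, -m⟩ : ℂ) ∈ C
  ver : m ≠ m' → ∀ s ∈ Set.uIcc m m', (⟨x', s⟩ : ℂ) ∈ C ∧ (⟨x', -s⟩ : ℂ) ∈ C

variable {C : Set ℂ} {x x' m m' : ℝ}

theorem StepIn.intervalIntegrable (h : StepIn C x x' m m') {g : ℂ → ℂ} (hg : ContinuousOn g C) :
    IntervalIntegrable (fun w => g ⟨w, -m⟩ - g ⟨w, m⟩) volume x x' ∧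
      IntervalIntegrable (fun s => g ⟨x', s⟩ + g ⟨x', -s⟩) volume m m' := by
  constructor
  · rcases h.nonneg.eq_or_lt with h0 | h0
    · simp [← h0]
    · refine ContinuousOn.intervalIntegrable ?_
      rw [Set.uIcc_of_le h.le]
      exact (hg.comp (continuous_mk_left _).continuousOn fun w hw => (h.hor h0 w hw).2).sub
        (hg.comp (continuous_mk_left _).continuousOn fun w hw => (h.hor h0 w hw).1)
  · rcases eq_or_ne m m' with h0 | h0
    · subst h0
      simp
    · refine ContinuousOn.intervalIntegrable ?_
      exact (hg.comp (continuous_mk_right _).continuousOn fun w hw => (h.ver h0 w hw).1).add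
        (hg.comp ((continuous_mk_right x').comp continuous_neg).continuousOn
          fun w hw => (h.ver h0 w hw).2)

theorem StepIn.stairTerm_congr (h : StepIn C x x' m m') {g g' : ℂ → ℂ} (hg : Set.EqOn g g' C) :
    stairTerm g x x' m m' = stairTerm g' x x' m m' := by
  unfold stairTerm
  congr 1
  · refine intervalIntegral.integral_congr fun w hw => ?_
    rw [Set.uIcc_of_le h.le] at hw
    rcases h.nonneg.eq_or_lt with h0 | h0
    · simp [← h0]
    · simp only [hg (h.hor h0 w hw).1, hg (h.hor h0 w hw).2]
  · congr 1
    rcases eq_or_ne m m' with h0 | h0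
    · subst h0
      simp
    · refine intervalIntegral.integral_congr fun s hs => ?_
      simp only [hg (h.ver h0 s hs).1, hg (h.ver h0 s hs).2]

theorem StepIn.stairTerm_sub_mul (h : StepIn C x x' m m') {g g' : ℂ → ℂ} (hg : ContinuousOn g C)
    (hg' : ContinuousOn g' C) (c : ℂ) :
    stairTerm (fun z => g z - c * g' z) x x' m m' =
      stairTerm g x x' m m' - c * stairTerm g' x x' m m' := by
  have h1 := h.intervalIntegrable hg
  have h2 := h.intervalIntegrable hg'
  have e1 : (∫ u in x..x', (g ⟨u, -m⟩ - c * g' ⟨u, -m⟩ - (g ⟨u, m⟩ - c * g' ⟨u, m⟩))) =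
      (∫ u in x..x', (g ⟨u, -m⟩ - g ⟨u, m⟩)) - c * ∫ u in x..x', (g' ⟨u, -m⟩ - g' ⟨u, m⟩) := by
    rw [← intervalIntegral.integral_const_mul, ← intervalIntegral.integral_sub h1.1
      (h2.1.const_mul c)]
    congr 1 with u
    ring
  have e2 : (∫ s in m..m', (g ⟨x', s⟩ - c * g' ⟨x', s⟩ + (g ⟨x', -s⟩ - c * g' ⟨x', -s⟩))) =
      (∫ s in m..m', (g ⟨x', s⟩ + g ⟨x', -s⟩)) - c * ∫ s in m..m', (g' ⟨x', s⟩ + g' ⟨x', -s⟩) := by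
    rw [← intervalIntegral.integral_const_mul, ← intervalIntegral.integral_sub h1.2
      (h2.2.const_mul c)]
    congr 1 with u
    ring
  rw [stairTerm, stairTerm, stairTerm, e1, e2]
  ring

open Classical in
/-- A step of a staircase contributes nearly the same as point evaluations of `g`. -/
theorem StepIn.norm_stairTerm_sub_le (h : StepIn C x x' m m') {g : ℂ → ℂ} (hg : ContinuousOn g C)
    {r η u v : ℝ} (hr : ∀ z ∈ C, ∀ z' ∈ C, dist z z' < r → ‖g z - g z'‖ ≤ η)
    (hu : u ∈ Set.Icc x x') (hxr : x' - x < r) (hv : v ∈ Set.uIcc m m') (hmr : |m' - m| < r) :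
    ‖stairTerm g x x' m m' -
        ((x' - x : ℝ) * (if 0 < m then g ⟨u, -m⟩ else 0) -
          (x' - x : ℝ) * (if 0 < m then g ⟨u, m⟩ else 0) -
          I * (m' - m : ℝ) * g ⟨x', v⟩ - I * (m' - m : ℝ) * g ⟨x', -v⟩)‖ ≤
      2 * η * ((if 0 < m then x' - x else 0) + |m' - m|) := by
  have hI := h.intervalIntegrable hg
  have h1 : ‖(∫ w in x..x', (g ⟨w, -m⟩ - g ⟨w, m⟩)) -
      ((x' - x : ℝ) * (if 0 < m then g ⟨u, -m⟩ else 0) -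
          (x' - x : ℝ) * (if 0 < m then g ⟨u, m⟩ else 0))‖ ≤
      2 * η * (if 0 < m then x' - x else 0) := by
    split_ifs with h0
    · have e : (∫ w in x..x', (g ⟨w, -m⟩ - g ⟨w, m⟩)) -
          ((x' - x : ℝ) * g ⟨u, -m⟩ - (x' - x : ℝ) * g ⟨u, m⟩) =
          ∫ w in x..x', ((g ⟨w, -m⟩ - g ⟨w, m⟩) - (g ⟨u, -m⟩ - g ⟨u, m⟩)) := by
        rw [intervalIntegral.integral_sub hI.1 intervalIntegrable_const,
          intervalIntegral.integral_const, Complex.real_smul]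
        ring
      rw [e]
      refine (intervalIntegral.norm_integral_le_of_norm_le_const (C := 2 * η) fun w hw => ?_).trans
        (by rw [abs_of_nonneg (sub_nonneg.2 h.le)])
      rw [Set.uIoc_of_le h.le] at hw
      have hw' := Set.Ioc_subset_Icc_self hw
      have hd : ∀ s : ℝ, dist (⟨w, s⟩ : ℂ) ⟨u, s⟩ < r := by
        intro s
        refine lt_of_le_of_lt ?_ hxr
        rw [dist_mk_left, abs_le]
        constructor <;> linarith [hw'.1, hw'.2, hu.1, hu.2]
      have a1 := hr _ (h.hor h0 w hw').1 _ (h.hor h0 u hu).1 (hd m)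
      have a2 := hr _ (h.hor h0 w hw').2 _ (h.hor h0 u hu).2 (hd (-m))
      calc ‖g ⟨w, -m⟩ - g ⟨w, m⟩ - (g ⟨u, -m⟩ - g ⟨u, m⟩)‖
          = ‖(g ⟨w, -m⟩ - g ⟨u, -m⟩) - (g ⟨w, m⟩ - g ⟨u, m⟩)‖ := by congr 1; ring
        _ ≤ η + η := (norm_sub_le _ _).trans (add_le_add a2 a1)
        _ = 2 * η := by ring
    · have : m = 0 := le_antisymm (not_lt.1 h0) h.nonneg
      simp [this]
  have h2 : ‖(∫ s in m..m', (g ⟨x', s⟩ + g ⟨x', -s⟩)) -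
      ((m' - m : ℝ) * g ⟨x', v⟩ + (m' - m : ℝ) * g ⟨x', -v⟩)‖ ≤ 2 * η * |m' - m| := by
    rcases eq_or_ne m m' with h0 | h0
    · subst h0
      simp
    · have e : (∫ s in m..m', (g ⟨x', s⟩ + g ⟨x', -s⟩)) -
          ((m' - m : ℝ) * g ⟨x', v⟩ + (m' - m : ℝ) * g ⟨x', -v⟩) =
          ∫ s in m..m', ((g ⟨x', s⟩ + g ⟨x', -s⟩) - (g ⟨x', v⟩ + g ⟨x', -v⟩)) := by
        rw [intervalIntegral.integral_sub hI.2 intervalIntegrable_const,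
          intervalIntegral.integral_const, Complex.real_smul]
        ring
      rw [e]
      refine intervalIntegral.norm_integral_le_of_norm_le_const (C := 2 * η) fun s hs => ?_
      have hs' := Set.uIoc_subset_uIcc hs
      have hsv : |s - v| < r := (abs_sub_le_of_mem_uIcc hs' hv).trans_lt hmr
      have a1 := hr _ (h.ver h0 s hs').1 _ (h.ver h0 v hv).1 (by
        rwa [dist_mk_right])
      have a2 := hr _ (h.ver h0 s hs').2 _ (h.ver h0 v hv).2 (by
        rw [dist_mk_right, ← abs_neg]
        convert hsv using 2
        ring)
      calc ‖g ⟨x', s⟩ + g ⟨x', -s⟩ - (g ⟨x', v⟩ + g ⟨x', -v⟩)‖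
          = ‖(g ⟨x', s⟩ - g ⟨x', v⟩) + (g ⟨x', -s⟩ - g ⟨x', -v⟩)‖ := by congr 1; ring
        _ ≤ η + η := (norm_add_le _ _).trans (add_le_add a1 a2)
        _ = 2 * η := by ring
  have e3 : stairTerm g x x' m m' -
        ((x' - x : ℝ) * (if 0 < m then g ⟨u, -m⟩ else 0) -
          (x' - x : ℝ) * (if 0 < m then g ⟨u, m⟩ else 0) -
          I * (m' - m : ℝ) * g ⟨x', v⟩ - I * (m' - m : ℝ) * g ⟨x', -v⟩) =
      ((∫ w in x..x', (g ⟨w, -m⟩ - g ⟨w, m⟩)) -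
      ((x' - x : ℝ) * (if 0 < m then g ⟨u, -m⟩ else 0) -
          (x' - x : ℝ) * (if 0 < m then g ⟨u, m⟩ else 0))) -
      I * ((∫ s in m..m', (g ⟨x', s⟩ + g ⟨x', -s⟩)) -
      ((m' - m : ℝ) * g ⟨x', v⟩ + (m' - m : ℝ) * g ⟨x', -v⟩)) := by
    rw [stairTerm]
    ring
  rw [e3, mul_add]
  refine (norm_sub_le _ _).trans (add_le_add h1 ?_)
  rwa [norm_mul, Complex.norm_I, one_mul]

end Step

/-! ### Fine staircases inside the level curve and Cauchy's formula on them -/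

section CauchyApprox

open Complex (I)

variable {K : Set ℝ}

theorem le_infDist_of_profile_le (hK : IsCompact K) (hne : K.Nonempty) {κ u s : ℝ}
    (h : profile K κ u ≤ |s|) : κ ≤ Metric.infDist (⟨u, s⟩ : ℂ) (Complex.ofReal '' K) := by
  refine le_of_sq_le_sq ?_ Metric.infDist_nonneg
  rw [sq_infDist_ofReal_image hK hne]
  have := (Real.sqrt_le_left (abs_nonneg s)).1 h
  rw [sq_abs] at this
  change κ ^ 2 ≤ Metric.infDist u K ^ 2 + s ^ 2
  linarith

theorem infDist_le_of_abs_le_profile (hK : IsCompact K) (hne : K.Nonempty) {κ u s : ℝ}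
    (hκ : 0 ≤ κ) (hpos : 0 < profile K κ u) (h : |s| ≤ profile K κ u) :
    Metric.infDist (⟨u, s⟩ : ℂ) (Complex.ofReal '' K) ≤ κ := by
  refine le_of_sq_le_sq ?_ hκ
  rw [sq_infDist_ofReal_image hK hne]
  have h1 : s ^ 2 ≤ profile K κ u ^ 2 := by
    rw [← sq_abs]
    gcongr
  rw [sq_profile_of_pos hpos] at h1
  change Metric.infDist u K ^ 2 + s ^ 2 ≤ κ ^ 2
  linarith

theorem sub_le_infDist (hK : IsCompact K) (hne : K.Nonempty) {κ u w s δ : ℝ}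
    (h : profile K κ u ≤ |s|) (hw : |w - u| ≤ δ) :
    κ - δ ≤ Metric.infDist (⟨w, s⟩ : ℂ) (Complex.ofReal '' K) := by
  have h1 := le_infDist_of_profile_le hK hne h
  have h2 := Metric.infDist_le_infDist_add_dist (s := Complex.ofReal '' K) (x := ⟨u, s⟩)
    (y := ⟨w, s⟩)
  rw [dist_mk_left, abs_sub_comm] at h2
  linarith

/-- A fine staircase just inside the level curve. -/
structure FineStair (K : Set ℝ) (κ r : ℝ) (n : ℕ) (x u : ℕ → ℝ) : Prop where
  mono : Monotone x
  mem : ∀ k, u k ∈ Set.Icc (x k) (x (k + 1))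
  min : ∀ k, ∀ w ∈ Set.Icc (x k) (x (k + 1)), profile K κ (u k) ≤ profile K κ w
  mesh : ∀ k, 2 * (x (k + 1) - x k) < r
  osc : ∀ k, ∀ w ∈ Set.Icc (x k) (x (k + 2)), ∀ w' ∈ Set.Icc (x k) (x (k + 2)),
    2 * (|profile K κ w - profile K κ w'| + |w - w'|) < r
  left : ∀ t ∈ K, x 0 < t
  right : ∀ t ∈ K, t < x n
  zero_left : profile K κ (u 0) = 0
  zero_right : profile K κ (u n) = 0

/-- An equidistant partition of [-(R + κ), R + κ], where K ⊆ [-R, R], with heights equal to the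
minimum of the profile over each cell. Uniform continuity of the profile supplies the mesh. -/
theorem exists_fineStair (hK : IsCompact K) (hne : K.Nonempty) {κ : ℝ} (hκ : 0 < κ) {r : ℝ}
    (hr : 0 < r) : ∃ n x u, FineStair K κ r n x u := by
  obtain ⟨R, hR⟩ := hK.isBounded.subset_closedBall 0
  have hR' : ∀ t ∈ K, |t| ≤ R := fun t ht => by simpa using hR ht
  have hR0 : 0 ≤ R := by
    obtain ⟨t, ht⟩ := hne
    exact (abs_nonneg t).trans (hR' t ht)
  obtain ⟨δ, hδ, hδ'⟩ := Metric.uniformContinuous_iff.1 (uniformContinuous_profile hK hκ.le)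
    (r / 4) (by positivity)
  -- The mesh h will satisfy 8h < δ and 8h < r. For `osc`, two points at distance at most 2h < δ
  -- have profiles differing by less than r/4, and 2(r/4 + 2h) < r.
  obtain ⟨n, hn⟩ := exists_nat_gt (2 * (R + κ) / (min δ r / 8))
  have hmin : 0 < min δ r := lt_min hδ hr
  have hn0 : (0 : ℝ) < n := lt_of_le_of_lt (by positivity) hn
  set h : ℝ := 2 * (R + κ) / n with hh
  have hpos : 0 < h := by positivity
  have hsmall : h < min δ r / 8 := by
    rw [hh, div_lt_iff₀ hn0]
    rw [div_lt_iff₀ (by positivity)] at hn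
    linarith
  have hhδ : 8 * h < δ := by linarith [min_le_left δ r]
  have hhr : 8 * h < r := by linarith [min_le_right δ r]
  set x : ℕ → ℝ := fun k => -(R + κ) + k * h with hx
  have hxs : ∀ k, x (k + 1) = x k + h := fun k => by simp only [hx]; push_cast; ring
  have hxn : x n = R + κ := by
    simp only [hx, hh]
    field_simp
    ring
  have hex : ∀ k, ∃ u ∈ Set.Icc (x k) (x (k + 1)), IsMinOn (profile K κ) (Set.Icc (x k) (x (k + 1))) u :=
    fun k => isCompact_Icc.exists_isMinOn ⟨x k, Set.left_mem_Icc.2 (by rw [hxs]; linarith)⟩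
      (continuous_profile K κ).continuousOn
  choose u hu humin using hex
  have hmin' : ∀ k, ∀ w ∈ Set.Icc (x k) (x (k + 1)), profile K κ (u k) ≤ profile K κ w :=
    fun k w hw => humin k hw
  have hzero : ∀ w, R + κ ≤ |w| → profile K κ w = 0 := by
    intro w hw
    rw [profile_eq_zero_iff hκ.le]
    refine (Metric.le_infDist hne).2 fun t ht => ?_
    rw [Real.dist_eq]
    have := abs_sub_abs_le_abs_sub w t
    linarith [hR' t ht]
  refine ⟨n, x, u, ⟨monotone_nat_of_le_succ fun k => by rw [hxs]; linarith, hu, hmin',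
    fun k => by rw [hxs]; linarith, fun k w hw w' hw' => ?_, fun t ht => ?_, fun t ht => ?_,
    le_antisymm ?_ (profile_nonneg _ _ _), le_antisymm ?_ (profile_nonneg _ _ _)⟩⟩
  · rw [show k + 2 = k + 1 + 1 from rfl, hxs, hxs] at hw hw'
    have h1 : |w - w'| ≤ 2 * h := by
      rw [abs_le]
      constructor <;> linarith [hw.1, hw.2, hw'.1, hw'.2]
    have h2 := hδ' (a := w) (b := w') (by rw [Real.dist_eq]; linarith)
    rw [Real.dist_eq] at h2
    linarith
  · have := (abs_le.1 (hR' t ht)).1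
    simp only [hx]
    push_cast
    linarith
  · rw [hxn]
    linarith [(abs_le.1 (hR' t ht)).2]
  -- The first cell contains the endpoint x 0, at distance at least κ from K, so its minimal height
  -- is 0. The next goal concerns the cell that starts at x n, for the same reason.
  · refine (hmin' 0 (x 0) (Set.left_mem_Icc.2 (by rw [hxs]; linarith))).trans (hzero _ ?_).le
    simp only [hx, Nat.cast_zero, zero_mul, add_zero, abs_neg]
    exact le_abs_self _
  · refine (hmin' n (x n) (Set.left_mem_Icc.2 (by rw [hxs]; linarith))).trans (hzero _ ?_).le
    rw [hxn]
    exact le_abs_self _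

namespace FineStair

variable {κ r : ℝ} {n : ℕ} {x u : ℕ → ℝ}

theorem le_succ (h : FineStair K κ r n x u) (k : ℕ) : x k ≤ x (k + 1) := h.mono (Nat.le_succ k)

/-- The height of the vertical edges right of the `k`-th strip. -/
theorem mem_uIcc_max (k : ℕ) :
    max (profile K κ (u k)) (profile K κ (u (k + 1))) ∈
      Set.uIcc (profile K κ (u k)) (profile K κ (u (k + 1))) := ⟨min_le_max, le_rfl⟩

theorem sub_le_infDist_hor (h : FineStair K κ r n x u) (hK : IsCompact K) (hne : K.Nonempty)
    {k : ℕ} {w s : ℝ} (hw : w ∈ Set.Icc (x k) (x (k + 1))) (hs : profile K κ (u k) ≤ |s|) :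
    κ - r ≤ Metric.infDist (⟨w, s⟩ : ℂ) (Complex.ofReal '' K) := by
  refine sub_le_infDist hK hne hs ?_
  have := h.mem k
  have := h.mesh k
  rw [abs_le]
  constructor <;> linarith [hw.1, hw.2, (h.mem k).1, (h.mem k).2, h.le_succ k]

theorem sub_le_infDist_ver (h : FineStair K κ r n x u) (hK : IsCompact K) (hne : K.Nonempty)
    {k : ℕ} {s : ℝ} (hs : |s| ∈ Set.uIcc (profile K κ (u k)) (profile K κ (u (k + 1)))) :
    κ - r ≤ Metric.infDist (⟨x (k + 1), s⟩ : ℂ) (Complex.ofReal '' K) := by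
  rcases min_le_iff.1 hs.1 with h1 | h1
  · exact h.sub_le_infDist_hor hK hne (Set.right_mem_Icc.2 (h.le_succ k)) h1
  · exact h.sub_le_infDist_hor hK hne (Set.left_mem_Icc.2 (h.le_succ (k + 1))) h1

theorem infDist_le_hor (h : FineStair K κ r n x u) (hK : IsCompact K) (hne : K.Nonempty)
    (hκ : 0 ≤ κ) {k : ℕ} (hpos : 0 < profile K κ (u k)) {w s : ℝ}
    (hw : w ∈ Set.Icc (x k) (x (k + 1))) (hs : |s| ≤ profile K κ (u k)) :
    Metric.infDist (⟨w, s⟩ : ℂ) (Complex.ofReal '' K) ≤ κ :=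
  infDist_le_of_abs_le_profile hK hne hκ (hpos.trans_le (h.min k w hw)) (hs.trans (h.min k w hw))

theorem infDist_le_ver (h : FineStair K κ r n x u) (hK : IsCompact K) (hne : K.Nonempty)
    (hκ : 0 ≤ κ) {k : ℕ} (hk : profile K κ (u k) ≠ profile K κ (u (k + 1))) {s : ℝ}
    (hs : |s| ∈ Set.uIcc (profile K κ (u k)) (profile K κ (u (k + 1)))) :
    Metric.infDist (⟨x (k + 1), s⟩ : ℂ) (Complex.ofReal '' K) ≤ κ := by
  have h0 := profile_nonneg K κ (u k)
  have h0' := profile_nonneg K κ (u (k + 1))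
  rcases le_total (profile K κ (u k)) (profile K κ (u (k + 1))) with h1 | h1
  · rw [Set.uIcc_of_le h1] at hs
    exact h.infDist_le_hor hK hne hκ (h0.trans_lt (lt_of_le_of_ne h1 hk))
      (Set.left_mem_Icc.2 (h.le_succ (k + 1))) hs.2
  · rw [Set.uIcc_of_ge h1] at hs
    exact h.infDist_le_hor hK hne hκ (h0'.trans_lt (lt_of_le_of_ne h1 hk.symm))
      (Set.right_mem_Icc.2 (h.le_succ k)) hs.2

theorem stepIn (h : FineStair K κ r n x u) (hK : IsCompact K) (hne : K.Nonempty)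
    (hκ : 0 ≤ κ) (k : ℕ) :
    StepIn {z | Metric.infDist z (Complex.ofReal '' K) ∈ Set.Icc (κ - r) κ} (x k) (x (k + 1))
      (profile K κ (u k)) (profile K κ (u (k + 1))) where
  le := h.le_succ k
  nonneg := profile_nonneg _ _ _
  hor hpos w hw :=
    ⟨⟨h.sub_le_infDist_hor hK hne hw (le_abs_self _),
      h.infDist_le_hor hK hne hκ hpos hw (abs_of_pos hpos).le⟩,
      h.sub_le_infDist_hor hK hne hw (by rw [abs_neg]; exact le_abs_self _),
      h.infDist_le_hor hK hne hκ hpos hw (by rw [abs_neg]; exact (abs_of_pos hpos).le)⟩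
  ver hk s hs := by
    have h0 : |s| = s := abs_of_nonneg
      ((le_min (profile_nonneg K κ (u k)) (profile_nonneg K κ (u (k + 1)))).trans hs.1)
    have hs' : |s| ∈ Set.uIcc (profile K κ (u k)) (profile K κ (u (k + 1))) := by rwa [h0]
    have hs'' : |-s| ∈ Set.uIcc (profile K κ (u k)) (profile K κ (u (k + 1))) := by
      rwa [abs_neg, h0]
    exact ⟨⟨h.sub_le_infDist_ver hK hne hs', h.infDist_le_ver hK hne hκ hk hs'⟩,
      h.sub_le_infDist_ver hK hne hs'', h.infDist_le_ver hK hne hκ hk hs''⟩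

/-- Cauchy's formula for the staircase. -/
theorem sum_stairTerm_eq (h : FineStair K κ r n x u) (hK : IsCompact K)
    (hκ : 0 < κ) (hr : r < κ) {Φ : ℂ → ℂ}
    (hΦ : DifferentiableOn ℂ Φ {z | Metric.infDist z (Complex.ofReal '' K) ≤ κ}) {t : ℝ}
    (ht : t ∈ K) :
    ∑ k ∈ Finset.range n, stairTerm (fun z => Φ z / (z - t)) (x k) (x (k + 1))
      (profile K κ (u k)) (profile K κ (u (k + 1))) = Φ t * (2 * Real.pi * I) := by
  have hne : K.Nonempty := ⟨t, ht⟩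
  have ht0 : Metric.infDist (t : ℂ) (Complex.ofReal '' K) = 0 :=
    Metric.infDist_zero_of_mem (Set.mem_image_of_mem _ ht)
  have hnt : ∀ z : ℂ, κ - r ≤ Metric.infDist z (Complex.ofReal '' K) → z ≠ t := by
    rintro _ hz rfl
    rw [ht0] at hz
    linarith
  have hnhds : {z : ℂ | Metric.infDist z (Complex.ofReal '' K) ≤ κ} ∈ nhds (t : ℂ) := by
    have : ∀ᶠ z in nhds (t : ℂ), Metric.infDist z (Complex.ofReal '' K) < κ :=
      (Metric.continuous_infDist_pt _).continuousAt.eventually_lt_const (ht0.trans_lt hκ)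
    exact this.mono fun z hz => hz.le
  -- The difference quotient is holomorphic across t, so its staircase sum vanishes. On the edges it
  -- equals Φ(z)/(z - t) - Φ(t)/(z - t), whose second term yields the winding number.
  have hq := (Complex.differentiableOn_dslope hnhds).2 hΦ
  have h1 := sum_stairTerm_eq_zero hq h.mono (fun k => profile_nonneg K κ (u k)) h.zero_left
    h.zero_right fun k hk w hw s hs => h.infDist_le_hor hK hne hκ.le hk hw hs
  have h2 := sum_stairTerm_inv_sub (t := t) (fun k => profile_nonneg K κ (u k)) h.zero_left
    h.zero_right (h.left t ht) (h.right t ht)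
    (fun k w hw => hnt _ (h.sub_le_infDist_hor hK hne (by rwa [Set.uIcc_of_le (h.le_succ k)] at hw)
      (le_abs_self _)))
    (fun k s hs => hnt _ (h.sub_le_infDist_ver hK hne (by
      rwa [abs_of_nonneg ((le_min (profile_nonneg K κ (u k))
        (profile_nonneg K κ (u (k + 1)))).trans hs.1)])))
  have hsub : ∀ z ∈ {z | Metric.infDist z (Complex.ofReal '' K) ∈ Set.Icc (κ - r) κ},
      z - (t : ℂ) ≠ 0 := fun z hz => sub_ne_zero.2 (hnt z hz.1)
  have hc1 : ContinuousOn (fun z => Φ z / (z - t))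
      {z | Metric.infDist z (Complex.ofReal '' K) ∈ Set.Icc (κ - r) κ} :=
    (hΦ.continuousOn.mono fun z hz => hz.2).div (by fun_prop) hsub
  have hc2 : ContinuousOn (fun z : ℂ => 1 / (z - t))
      {z | Metric.infDist z (Complex.ofReal '' K) ∈ Set.Icc (κ - r) κ} :=
    continuousOn_const.div (by fun_prop) hsub
  have h3 : ∀ k, stairTerm (dslope Φ t) (x k) (x (k + 1)) (profile K κ (u k))
      (profile K κ (u (k + 1))) =
      stairTerm (fun z => Φ z / (z - t)) (x k) (x (k + 1))
        (profile K κ (u k)) (profile K κ (u (k + 1))) -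
      Φ t * stairTerm (fun z => 1 / (z - t)) (x k) (x (k + 1))
        (profile K κ (u k)) (profile K κ (u (k + 1))) := by
    intro k
    rw [← (h.stepIn hK hne hκ.le k).stairTerm_sub_mul hc1 hc2]
    refine (h.stepIn hK hne hκ.le k).stairTerm_congr fun z hz => ?_
    rw [dslope_of_ne _ (hnt z hz.1), slope_def_field]
    ring
  rw [Finset.sum_congr rfl fun k _ => h3 k, Finset.sum_sub_distrib, ← Finset.mul_sum, h2] at h1
  exact sub_eq_zero.1 h1

end FineStair

end CauchyApprox

/-! ### Staircase weights bounded by integrals over the level curve -/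

section CauchyApprox

open Complex (I)

variable {K : Set ℝ}

namespace FineStair

variable {κ r : ℝ} {n : ℕ} {x u : ℕ → ℝ}

-- A horizontal edge is charged to the piece of the curve over its own cell, a vertical edge to the
-- pieces over the two adjacent cells. No piece is charged more than three times, hence the constant
-- 3. The term η pays for evaluating f at nodes off the curve.
open Classical in
theorem sum_length_mul_le (h : FineStair K κ r n x u) (hK : IsCompact K) (hne : K.Nonempty)
    (hκ : 0 < κ) (hr : 0 < r) {η : ℝ} (hη : 0 ≤ η) {f : ℂ → ℝ} (hf0 : ∀ z, 0 ≤ f z)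
    (hf : IntegrableOn f (levelCurve K κ) μH[1])
    (hfr : ∀ z ∈ {z | Metric.infDist z (Complex.ofReal '' K) ∈ Set.Icc (κ - r) κ},
      ∀ z' ∈ {z | Metric.infDist z (Complex.ofReal '' K) ∈ Set.Icc (κ - r) κ},
      dist z z' < r → |f z - f z'| ≤ η) {e : ℝ} (he : e ^ 2 = 1) :
    ∑ k ∈ Finset.range n, ((if 0 < profile K κ (u k) then x (k + 1) - x k else 0) *
        f ⟨u k, e * profile K κ (u k)⟩ +
      |profile K κ (u (k + 1)) - profile K κ (u k)| *
        f ⟨x (k + 1), e * max (profile K κ (u k)) (profile K κ (u (k + 1)))⟩) ≤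
      3 * ∫ z in levelCurve K κ, (f z + η) ∂μH[1] := by
  have hH := (hausdorffMeasure_levelCurve_lt_top hK hne hκ).ne
  have hHs : ∀ a b, μH[1] (strip K κ e a b) ≠ ∞ := fun a b =>
    ((measure_mono (strip_subset K κ e a b)).trans_lt hH.lt_top).ne
  have hg : IntegrableOn (fun z => f z + η) (levelCurve K κ) μH[1] :=
    hf.add (integrableOn_const hH)
  have hg0 : ∀ z, 0 ≤ f z + η := fun z => add_nonneg (hf0 z) hη
  have he1 : e = 1 ∨ e = -1 := sq_eq_one_iff.1 he
  have hstep := fun k => h.stepIn hK hne hκ.le k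
  have hΓ : ∀ z ∈ levelCurve K κ,
      z ∈ {z | Metric.infDist z (Complex.ofReal '' K) ∈ Set.Icc (κ - r) κ} := by
    intro z hz
    have : Metric.infDist z (Complex.ofReal '' K) = κ := hz
    exact ⟨by linarith, this.le⟩
  have hd : ∀ w w' s s' : ℝ, dist (⟨w, e * s⟩ : ℂ) ⟨w', e * s'⟩ ≤ |w - w'| + |s - s'| := by
    intro w w' s s'
    rw [Complex.dist_eq]
    refine (Complex.norm_le_abs_re_add_abs_im _).trans ?_
    have he' : |e| = 1 := by rwa [← sq_eq_sq₀ (abs_nonneg _) zero_le_one, sq_abs, one_pow]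
    simp only [Complex.sub_re, Complex.sub_im, ← mul_sub, abs_mul, he', one_mul, le_refl]
  have hle2 : ∀ k, x k ≤ x (k + 2) := fun k => h.mono (by omega)
  have hor : ∀ k, (if 0 < profile K κ (u k) then x (k + 1) - x k else 0) *
        f ⟨u k, e * profile K κ (u k)⟩ ≤
      ∫ z in strip K κ e (x k) (x (k + 1)), (f z + η) ∂μH[1] := by
    intro k
    split_ifs with hpos
    · refine mul_le_setIntegral_of_le (measurableSet_strip _ _ _ _ _) (hHs _ _)
        (hg.mono_set (strip_subset _ _ _ _ _)) (hf0 _)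
        (width_le_hausdorffMeasure_strip hK hne hκ.le he fun w hw =>
          hpos.trans_le (h.min k w (Set.Ioc_subset_Icc_self hw))) fun z hz => ?_
      have hzre : z.re ∈ Set.Icc (x k) (x (k + 2)) :=
        ⟨hz.2.1.1.le, hz.2.1.2.trans (h.mono (by omega))⟩
      have huk : u k ∈ Set.Icc (x k) (x (k + 2)) :=
        ⟨(h.mem k).1, (h.mem k).2.trans (h.mono (by omega))⟩
      have h1 := hfr ⟨u k, e * profile K κ (u k)⟩
        (hΓ _ (mk_mem_levelCurve hK hne hκ.le he hpos)) z (hΓ z hz.1) (by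
          rw [eq_of_mem_strip hK hne hκ.le he hz]
          have := h.osc k _ huk _ hzre
          have := abs_nonneg (u k - z.re)
          have := abs_nonneg (profile K κ (u k) - profile K κ z.re)
          exact (hd _ _ _ _).trans_lt (by linarith))
      linarith [(abs_le.1 h1).2]
    · rw [zero_mul]
      exact integral_nonneg hg0
  have ver : ∀ k, |profile K κ (u (k + 1)) - profile K κ (u k)| *
        f ⟨x (k + 1), e * max (profile K κ (u k)) (profile K κ (u (k + 1)))⟩ ≤
      (∫ z in strip K κ e (x k) (x (k + 1)), (f z + η) ∂μH[1]) +
        ∫ z in strip K κ e (x (k + 1)) (x (k + 1 + 1)), (f z + η) ∂μH[1] := by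
    intro k
    have hdisj : Disjoint (strip K κ e (x k) (x (k + 1))) (strip K κ e (x (k + 1)) (x (k + 1 + 1))) :=
      Set.disjoint_left.2 fun z hz hz' => not_lt.2 hz.2.1.2 hz'.2.1.1
    rw [← setIntegral_union hdisj (measurableSet_strip _ _ _ _ _)
      (hg.mono_set (strip_subset _ _ _ _ _)) (hg.mono_set (strip_subset _ _ _ _ _)),
      strip_union K κ e (h.le_succ k) (h.le_succ (k + 1))]
    rcases eq_or_ne (profile K κ (u k)) (profile K κ (u (k + 1))) with heq | hneq
    · rw [heq, sub_self, abs_zero, zero_mul]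
      exact integral_nonneg hg0
    have huk : u k ∈ Set.Icc (x k) (x (k + 2)) :=
      ⟨(h.mem k).1, (h.mem k).2.trans (h.mono (by omega))⟩
    have huk' : u (k + 1) ∈ Set.Icc (x k) (x (k + 2)) :=
      ⟨(h.le_succ k).trans (h.mem (k + 1)).1, (h.mem (k + 1)).2⟩
    have hxk : x (k + 1) ∈ Set.Icc (x k) (x (k + 2)) := ⟨h.le_succ k, h.le_succ (k + 1)⟩
    have hl : ENNReal.ofReal |profile K κ (u (k + 1)) - profile K κ (u k)| ≤
        μH[1] (strip K κ e (x k) (x (k + 2))) := by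
      rcases abs_cases (profile K κ (u (k + 1)) - profile K κ (u k)) with ⟨ha, -⟩ | ⟨ha, -⟩
      · rw [ha]
        exact height_le_hausdorffMeasure_strip hK hne hκ.le he huk huk'
      · rw [ha, neg_sub]
        exact height_le_hausdorffMeasure_strip hK hne hκ.le he huk' huk
    refine mul_le_setIntegral_of_le (measurableSet_strip _ _ _ _ _) (hHs _ _)
      (hg.mono_set (strip_subset _ _ _ _ _)) (hf0 _) hl fun z hz => ?_
    have hzre : z.re ∈ Set.Icc (x k) (x (k + 2)) := ⟨hz.2.1.1.le, hz.2.1.2⟩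
    have hmem : (⟨x (k + 1), e * max (profile K κ (u k)) (profile K κ (u (k + 1)))⟩ : ℂ) ∈
        {z | Metric.infDist z (Complex.ofReal '' K) ∈ Set.Icc (κ - r) κ} := by
      have := (hstep k).ver hneq _ (mem_uIcc_max k)
      rcases he1 with rfl | rfl
      · simpa using this.1
      · simpa using this.2
    have hosc : |x (k + 1) - z.re| +
        |max (profile K κ (u k)) (profile K κ (u (k + 1))) - profile K κ z.re| < r := by
      have h1 := h.osc k _ hxk _ hzre
      have h2 := h.osc k _ huk _ hzre
      have h3 := h.osc k _ huk' _ hzre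
      have h4 := abs_nonneg (profile K κ (x (k + 1)) - profile K κ z.re)
      have h5 := abs_nonneg (u k - z.re)
      have h6 := abs_nonneg (u (k + 1) - z.re)
      rcases max_choice (profile K κ (u k)) (profile K κ (u (k + 1))) with hm | hm <;>
        rw [hm] <;> linarith
    have h1 := hfr _ hmem z (hΓ z hz.1) (by
      rw [eq_of_mem_strip hK hne hκ.le he hz]
      exact (hd _ _ _ _).trans_lt hosc)
    linarith [(abs_le.1 h1).2]
  have hsum := sum_setIntegral_strip_le (e := e) hg0 hg h.mono n
  have hsum' := sum_setIntegral_strip_le (e := e) hg0 hg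
    (x := fun k => x (k + 1)) (fun a b hab => h.mono (by omega)) n
  calc _ ≤ ∑ k ∈ Finset.range n, ((∫ z in strip K κ e (x k) (x (k + 1)), (f z + η) ∂μH[1]) +
        ((∫ z in strip K κ e (x k) (x (k + 1)), (f z + η) ∂μH[1]) +
        ∫ z in strip K κ e (x (k + 1)) (x (k + 1 + 1)), (f z + η) ∂μH[1])) :=
        Finset.sum_le_sum fun k _ => add_le_add (hor k) (ver k)
    _ ≤ _ := by
        rw [Finset.sum_add_distrib, Finset.sum_add_distrib]
        linarith

end FineStair

theorem integrableOn_levelCurve (hK : IsCompact K) (hne : K.Nonempty) {κ : ℝ} (hκ : 0 < κ)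
    {f : ℂ → ℝ} (hf : ContinuousOn f (levelCurve K κ)) :
    IntegrableOn f (levelCurve K κ) μH[1] := by
  have hcomp : IsCompact (levelCurve K κ) := by
    refine (((hK.image Complex.continuous_ofReal).cthickening (r := κ))).of_isClosed_subset
      (isClosed_levelCurve K κ) fun z hz => ?_
    obtain ⟨p, hp, hpd⟩ :=
      (hK.image Complex.continuous_ofReal).exists_infDist_eq_dist (hne.image _) z
    have : Metric.infDist z (Complex.ofReal '' K) = κ := hz
    exact Metric.mem_cthickening_of_dist_le z p _ _ hp (by rw [← hpd, this])
  obtain ⟨C, hC⟩ := hcomp.exists_bound_of_continuousOn hf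
  have hm := (isClosed_levelCurve K κ).measurableSet
  exact ⟨hf.aestronglyMeasurable hm, HasFiniteIntegral.restrict_of_bounded C
    (hausdorffMeasure_levelCurve_lt_top hK hne hκ) ((ae_restrict_iff' hm).2 (ae_of_all _ hC))⟩

end CauchyApprox

/-! ### Cauchy's formula as a uniform limit of finite sums -/

section CauchyApprox

open Complex (I)

variable {K : Set ℝ}

theorem isCompact_annulus (hK : IsCompact K) (hne : K.Nonempty) (a b : ℝ) :
    IsCompact {z : ℂ | Metric.infDist z (Complex.ofReal '' K) ∈ Set.Icc a b} := by
  refine ((hK.image Complex.continuous_ofReal).cthickening (r := b)).of_isClosed_subset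
    (isClosed_Icc.preimage (Metric.continuous_infDist_pt _)) fun z hz => ?_
  obtain ⟨p, hp, hpd⟩ :=
    (hK.image Complex.continuous_ofReal).exists_infDist_eq_dist (hne.image _) z
  exact Metric.mem_cthickening_of_dist_le z p _ _ hp (hpd ▸ hz.2)

theorem contourMean_ofReal_image (K : Set ℝ) (κ : ℝ) (Φ : ℂ → ℂ) :
    contourMean (Complex.ofReal '' K) κ Φ =
      1 / (2 * Real.pi) * ∫ z in levelCurve K κ, ‖Φ z‖ ∂μH[1] := rfl

open Classical in
/-- Cauchy's integral formula on the level curve, in the form of a uniform approximation by finite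
sums whose total weight is controlled by the mean of `|Φ|` over the level curve. -/
theorem exists_cauchy_approx (hK : IsCompact K) (hne : K.Nonempty) {κ : ℝ} (hκ : 0 < κ)
    {Φ : ℂ → ℂ} (hΦ : DifferentiableOn ℂ Φ {z | Metric.infDist z (Complex.ofReal '' K) ≤ κ})
    {ε : ℝ} (hε : 0 < ε) :
    ∃ (s : Finset (ℕ × Fin 4)) (z c : ℕ × Fin 4 → ℂ),
      (∀ i ∈ s, κ - ε ≤ Metric.infDist (z i) (Complex.ofReal '' K)) ∧
      ∑ i ∈ s, ‖c i‖ ≤ 6 * contourMean (Complex.ofReal '' K) κ Φ + ε ∧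
      ∀ t ∈ K, ‖Φ t - ∑ i ∈ s, c i / (z i - t)‖ ≤ ε := by
  -- This annulus is compact, stays away from K and contains the level curve and the contributing
  -- edges of every fine enough staircase. Hence Φ(z), and Φ(z)/(z - t) jointly in z and t ∈ K, are
  -- uniformly continuous on it.
  set C : Set ℂ := {z | Metric.infDist z (Complex.ofReal '' K) ∈ Set.Icc (κ / 2) κ} with hC
  have hCc : IsCompact C := isCompact_annulus hK hne _ _
  set H : ℝ := (μH[1] : Measure ℂ).real (levelCurve K κ) with hHdef
  have hHfin := (hausdorffMeasure_levelCurve_lt_top hK hne hκ).ne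
  have hH0 : 0 ≤ H := measureReal_nonneg
  set η : ℝ := ε / (H + 1) with hηdef
  have hη : 0 < η := by positivity
  have hηH : η * H ≤ ε := by
    rw [hηdef, div_mul_eq_mul_div, div_le_iff₀ (by positivity)]
    nlinarith
  have hΦC : ContinuousOn Φ C := hΦ.continuousOn.mono fun z hz => hz.2
  have hne' : ∀ z ∈ C, ∀ t ∈ K, z - (t : ℂ) ≠ 0 := by
    intro z hz t ht h
    have h0 : Metric.infDist z (Complex.ofReal '' K) = 0 := by
      rw [sub_eq_zero.1 h]
      exact Metric.infDist_zero_of_mem (Set.mem_image_of_mem _ ht)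
    have := hz.1
    rw [h0] at this
    linarith
  have huc1 := Metric.uniformContinuousOn_iff.1
    (hCc.uniformContinuousOn_of_continuous hΦC) η hη
  have hjoint : ContinuousOn (fun p : ℂ × ℝ => Φ p.1 / (p.1 - p.2)) (C ×ˢ K) := by
    refine (hΦC.comp continuousOn_fst fun p hp => hp.1).div (by fun_prop) fun p hp => ?_
    exact hne' p.1 hp.1 p.2 hp.2
  have huc2 := Metric.uniformContinuousOn_iff.1
    ((hCc.prod hK).uniformContinuousOn_of_continuous hjoint) η hη
  obtain ⟨r1, hr1, huc1⟩ := huc1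
  obtain ⟨r2, hr2, huc2⟩ := huc2
  set r : ℝ := min (min r1 r2) (min ε (κ / 2)) with hrdef
  have hr : 0 < r := by positivity
  have hrr1 : r ≤ r1 := (min_le_left _ _).trans (min_le_left _ _)
  have hrr2 : r ≤ r2 := (min_le_left _ _).trans (min_le_right _ _)
  have hrε : r ≤ ε := (min_le_right _ _).trans (min_le_left _ _)
  have hrκ : r ≤ κ / 2 := (min_le_right _ _).trans (min_le_right _ _)
  obtain ⟨n, x, u, h⟩ := exists_fineStair hK hne hκ hr
  have hCr : ∀ z, Metric.infDist z (Complex.ofReal '' K) ∈ Set.Icc (κ - r) κ → z ∈ C :=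
    fun z hz => ⟨by linarith [hz.1], hz.2⟩
  set m : ℕ → ℝ := fun k => profile K κ (u k) with hm
  set M : ℕ → ℝ := fun k => max (m k) (m (k + 1)) with hM
  set δ : ℕ → ℝ := fun k => if 0 < m k then x (k + 1) - x k else 0 with hδ
  have hδ0 : ∀ k, 0 ≤ δ k := by
    intro k
    simp only [hδ]
    split_ifs
    · exact sub_nonneg.2 (h.le_succ k)
    · exact le_rfl
  have hm0 : ∀ k, 0 ≤ m k := fun k => profile_nonneg _ _ _
  have hM0 : ∀ k, 0 ≤ M k := fun k => (hm0 k).trans (le_max_left _ _)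
  -- Four nodes per step: one on each of the two horizontal edges and one on each of the two
  -- vertical edges. The weights `w` are the oriented edge lengths, with `δ` set to 0 where the
  -- horizontal edges collapse onto the axis and cancel.
  set z : ℕ × Fin 4 → ℂ := fun i =>
    ![⟨u i.1, m i.1⟩, ⟨u i.1, -m i.1⟩, ⟨x (i.1 + 1), M i.1⟩, ⟨x (i.1 + 1), -M i.1⟩] i.2 with hz
  set w : ℕ × Fin 4 → ℂ := fun i =>
    ![-(δ i.1 : ℂ), (δ i.1 : ℂ), -I * (m (i.1 + 1) - m i.1 : ℝ),
      -I * (m (i.1 + 1) - m i.1 : ℝ)] i.2 with hw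
  have hΓC : levelCurve K κ ⊆ C := fun z hz =>
    ⟨by have : Metric.infDist z (Complex.ofReal '' K) = κ := hz
        linarith, le_of_eq hz⟩
  have hint : IntegrableOn (fun z => ‖Φ z‖) (levelCurve K κ) μH[1] :=
    integrableOn_levelCurve hK hne hκ (hΦC.norm.mono hΓC)
  have hweight : ∀ e : ℝ, e ^ 2 = 1 → ∑ k ∈ Finset.range n,
      (δ k * ‖Φ ⟨u k, e * m k⟩‖ + |m (k + 1) - m k| * ‖Φ ⟨x (k + 1), e * M k⟩‖) ≤
      3 * ((∫ z in levelCurve K κ, ‖Φ z‖ ∂μH[1]) + η * H) := by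
    intro e he
    have := h.sum_length_mul_le hK hne hκ hr hη.le (f := fun z => ‖Φ z‖)
      (fun z => norm_nonneg _) hint (fun z hz z' hz' hd =>
        (abs_norm_sub_norm_le _ _).trans (by
          rw [← dist_eq_norm]
          exact (huc1 z (hCr z hz) z' (hCr z' hz') (hd.trans_le hrr1)).le)) he
    rwa [integral_add hint (integrableOn_const hHfin), setIntegral_const, smul_eq_mul,
      mul_comm _ η] at this
  have hlength : ∑ k ∈ Finset.range n, (δ k + |m (k + 1) - m k|) ≤ 3 * H := by
    have := h.sum_length_mul_le hK hne hκ hr le_rfl (f := fun _ => 1) (fun _ => zero_le_one)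
      (integrableOn_const hHfin) (fun z _ z' _ _ => by simp) (e := 1) (by norm_num)
    simpa using this
  -- Using π > 3, the two error terms, each 6ηH/(2π), are at most ηH ≤ ε.
  have hpi : (1 : ℝ) / (2 * Real.pi) ≤ 1 / 6 :=
    one_div_le_one_div_of_le (by norm_num) (by linarith [Real.pi_gt_three])
  have hpi0 : (0 : ℝ) ≤ 1 / (2 * Real.pi) := by positivity
  have hnorm : ‖(2 * Real.pi * I : ℂ)⁻¹‖ = 1 / (2 * Real.pi) := by
    rw [norm_inv, norm_mul, norm_mul, Complex.norm_I, Complex.norm_real,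
      Real.norm_of_nonneg Real.pi_pos.le]
    simp
  have h2pi : (2 * Real.pi * I : ℂ) ≠ 0 := Complex.two_pi_I_ne_zero
  refine ⟨Finset.range n ×ˢ Finset.univ, z, fun i => (2 * Real.pi * I)⁻¹ * (w i * Φ (z i)),
    ?_, ?_, ?_⟩
  · rintro ⟨k, i⟩ -
    refine (sub_le_sub_left hrε κ).trans ?_
    have hver : |M k| ∈ Set.uIcc (m k) (m (k + 1)) := by
      rw [abs_of_nonneg (hM0 k)]
      exact FineStair.mem_uIcc_max k
    have hver' : |-M k| ∈ Set.uIcc (m k) (m (k + 1)) := by rwa [abs_neg]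
    fin_cases i
    · exact h.sub_le_infDist_hor hK hne (h.mem k) (le_abs_self _)
    · exact h.sub_le_infDist_hor hK hne (h.mem k) (by rw [abs_neg]; exact le_abs_self _)
    · exact h.sub_le_infDist_ver hK hne hver
    · exact h.sub_le_infDist_ver hK hne hver'
  · have h1 := hweight 1 (by norm_num)
    have h2 := hweight (-1) (by norm_num)
    have e1 : ∑ i ∈ Finset.range n ×ˢ (Finset.univ : Finset (Fin 4)),
        ‖(2 * Real.pi * I : ℂ)⁻¹ * (w i * Φ (z i))‖ = 1 / (2 * Real.pi) *
        (∑ k ∈ Finset.range n,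
          (δ k * ‖Φ ⟨u k, 1 * m k⟩‖ + |m (k + 1) - m k| * ‖Φ ⟨x (k + 1), 1 * M k⟩‖) +
        ∑ k ∈ Finset.range n,
          (δ k * ‖Φ ⟨u k, -1 * m k⟩‖ + |m (k + 1) - m k| * ‖Φ ⟨x (k + 1), -1 * M k⟩‖)) := by
      rw [Finset.sum_product, ← Finset.sum_add_distrib, Finset.mul_sum]
      refine Finset.sum_congr rfl fun k _ => ?_
      rw [Fin.sum_univ_four]
      have ha : |δ k| = δ k := abs_of_nonneg (hδ0 k)
      simp [hw, hz, ha, -Complex.ofReal_sub, abs_of_pos Real.pi_pos]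
      ring
    rw [e1, contourMean_ofReal_image]
    calc _ ≤ 1 / (2 * Real.pi) * (3 * ((∫ z in levelCurve K κ, ‖Φ z‖ ∂μH[1]) + η * H) +
          3 * ((∫ z in levelCurve K κ, ‖Φ z‖ ∂μH[1]) + η * H)) := by gcongr
      _ = 6 * (1 / (2 * Real.pi) * ∫ z in levelCurve K κ, ‖Φ z‖ ∂μH[1]) +
          1 / (2 * Real.pi) * (6 * (η * H)) := by ring
      _ ≤ _ := by
          gcongr
          calc 1 / (2 * Real.pi) * (6 * (η * H)) ≤ 1 / 6 * (6 * (η * H)) := by gcongr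
            _ ≤ ε := by linarith
  · intro t ht
    have hcauchy := h.sum_stairTerm_eq hK hκ (by linarith) hΦ ht
    have hstep : ∀ k, ‖stairTerm (fun z => Φ z / (z - t)) (x k) (x (k + 1)) (m k) (m (k + 1)) -
        ∑ i : Fin 4, w (k, i) * Φ (z (k, i)) / (z (k, i) - t)‖ ≤
        2 * η * (δ k + |m (k + 1) - m k|) := by
      intro k
      have hcont : ContinuousOn (fun z => Φ z / (z - t))
          {z | Metric.infDist z (Complex.ofReal '' K) ∈ Set.Icc (κ - r) κ} := by
        refine ContinuousOn.div (hΦC.mono hCr) (by fun_prop) fun z hz => ?_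
        exact hne' z (hCr z hz) t ht
      have := (h.stepIn hK hne hκ.le k).norm_stairTerm_sub_le hcont (r := r) (η := η)
        (u := u k) (v := M k)
        (fun z hz z' hz' hd => by
          rw [← dist_eq_norm]
          refine (huc2 (z, t) ⟨hCr z hz, ht⟩ (z', t) ⟨hCr z' hz', ht⟩ ?_).le
          rw [Prod.dist_eq, dist_self, max_eq_left dist_nonneg]
          exact hd.trans_le hrr2)
        (h.mem k) (by linarith [h.mesh k, h.le_succ k]) (FineStair.mem_uIcc_max k) (by
          have huk : u k ∈ Set.Icc (x k) (x (k + 2)) :=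
            ⟨(h.mem k).1, (h.mem k).2.trans (h.mono (by omega))⟩
          have huk' : u (k + 1) ∈ Set.Icc (x k) (x (k + 2)) :=
            ⟨(h.le_succ k).trans (h.mem (k + 1)).1, (h.mem (k + 1)).2⟩
          have h1 := h.osc k _ huk' _ huk
          have h2 := abs_nonneg (u (k + 1) - u k)
          have h3 := abs_nonneg (profile K κ (u (k + 1)) - profile K κ (u k))
          linarith)
      refine le_trans (le_of_eq ?_) this
      congr 1
      rw [Fin.sum_univ_four]
      simp only [hw, hz, hδ, hm]
      split_ifs <;> simp <;> ring
    have e2 : Φ t - ∑ i ∈ Finset.range n ×ˢ (Finset.univ : Finset (Fin 4)),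
        (2 * Real.pi * I : ℂ)⁻¹ * (w i * Φ (z i)) / (z i - t) = (2 * Real.pi * I : ℂ)⁻¹ *
        ∑ k ∈ Finset.range n, (stairTerm (fun z => Φ z / (z - t)) (x k) (x (k + 1))
          (m k) (m (k + 1)) - ∑ i : Fin 4, w (k, i) * Φ (z (k, i)) / (z (k, i) - t)) := by
      rw [Finset.sum_sub_distrib, hcauchy, mul_sub, Finset.sum_product, Finset.mul_sum]
      congr 1
      · field_simp
      · refine Finset.sum_congr rfl fun k _ => ?_
        rw [Finset.mul_sum]
        refine Finset.sum_congr rfl fun i _ => ?_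
        ring
    have hlength0 : 0 ≤ ∑ k ∈ Finset.range n, (δ k + |m (k + 1) - m k|) :=
      Finset.sum_nonneg fun k _ => add_nonneg (hδ0 k) (abs_nonneg _)
    rw [e2, norm_mul, hnorm]
    calc _ ≤ 1 / (2 * Real.pi) * ∑ k ∈ Finset.range n, 2 * η * (δ k + |m (k + 1) - m k|) := by
          gcongr
          exact norm_sum_le_of_le _ fun k _ => hstep k
      _ = 1 / (2 * Real.pi) * (2 * η * ∑ k ∈ Finset.range n, (δ k + |m (k + 1) - m k|)) := by
          rw [← Finset.mul_sum]
      _ ≤ 1 / 6 * (2 * η * (3 * H)) := by gcongr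
      _ ≤ ε := by linarith

end CauchyApprox

/-! ### Combes–Thomas estimate -/

section CombesThomas

open Complex (I)

/-- A Neumann series argument: X' = X(1 - Y(X - X')) with the perturbation Y(X - X') of norm below
1. The bound comes from the resolvent identity Z = Y + Y(X - X')Z for the inverse Z. -/
theorem isUnit_and_norm_inverse_le {A : Type*} [NormedRing A] [CompleteSpace A]
    {X X' Y : A} {ρ v : ℝ} (hXY : X * Y = 1) (hYX : Y * X = 1) (hρ : 0 < ρ) (hv : v < ρ)
    (hY : ‖Y‖ ≤ ρ⁻¹) (hX' : ‖X' - X‖ ≤ v) :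
    IsUnit X' ∧ ‖Ring.inverse X'‖ ≤ 1 / (ρ - v) := by
  have hv0 : 0 ≤ v := (norm_nonneg _).trans hX'
  have hsmall : ‖Y * (X - X')‖ < 1 := by
    calc ‖Y * (X - X')‖ ≤ ‖Y‖ * ‖X - X'‖ := norm_mul_le _ _
      _ ≤ ρ⁻¹ * v := by
        rw [norm_sub_rev]
        gcongr
      _ < ρ⁻¹ * ρ := by gcongr
      _ = 1 := inv_mul_cancel₀ hρ.ne'
  have hX : IsUnit X := ⟨⟨X, Y, hXY, hYX⟩, rfl⟩
  have hunit : IsUnit X' := by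
    have h1 : X' = X * (1 - Y * (X - X')) := by
      rw [mul_sub, ← mul_assoc, hXY]
      simp
    rw [h1]
    exact hX.mul (isUnit_one_sub_of_norm_lt_one hsmall)
  refine ⟨hunit, ?_⟩
  set Z := Ring.inverse X' with hZ
  have hZX : X' * Z = 1 := Ring.mul_inverse_cancel _ hunit
  have h2 : Z = Y + Y * (X - X') * Z := by
    have : Y * (X - X') * Z = (Y * X) * Z - Y * (X' * Z) := by noncomm_ring
    rw [this, hYX, hZX]
    simp
  have h3 : ‖Z‖ ≤ ρ⁻¹ + ρ⁻¹ * v * ‖Z‖ := by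
    calc ‖Z‖ = ‖Y + Y * (X - X') * Z‖ := congrArg _ h2
      _ ≤ ‖Y‖ + ‖Y‖ * ‖X - X'‖ * ‖Z‖ := (norm_add_le _ _).trans
        (add_le_add le_rfl ((norm_mul_le _ _).trans (by gcongr; exact norm_mul_le _ _)))
      _ ≤ _ := by
        rw [norm_sub_rev]
        gcongr
  rw [le_div_iff₀ (by linarith)]
  have h4 : ρ * ‖Z‖ ≤ 1 + v * ‖Z‖ := by
    calc ρ * ‖Z‖ ≤ ρ * (ρ⁻¹ + ρ⁻¹ * v * ‖Z‖) := by gcongr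
      _ = 1 + v * ‖Z‖ := by field_simp
  linarith

variable {G : Type} [AddCommGroup G]

theorem weightedShift_apply (a : G → ℂ) (ha : ∃ C : ℝ, 0 ≤ C ∧ ∀ p, ‖a p‖ ≤ C) (s : G)
    (φ : Ell2 G) (p : G) : weightedShift a ha s φ p = a p * φ (p + s) := by
  simp [weightedShift, LinearMap.mkContinuousOfExistsBound]

theorem norm_weightedShift_le (a : G → ℂ) (ha : ∃ C : ℝ, 0 ≤ C ∧ ∀ p, ‖a p‖ ≤ C) (s : G) {C : ℝ}
    (hC : 0 ≤ C) (h : ∀ p, ‖a p‖ ≤ C) : ‖weightedShift a ha s‖ ≤ C :=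
  ContinuousLinearMap.opNorm_le_bound _ hC fun φ => norm_shift_le a hC h s φ

theorem norm_exp_I_mul (a x : ℝ) : ‖Complex.exp (I * a * x)‖ = 1 := by
  rw [mul_assoc, mul_comm, ← Complex.ofReal_mul, Complex.norm_exp_ofReal_mul_I]

/-- Multiplication by the character `p ↦ e^{i a c(p)}`. -/
def gauge (c : G →+ ℝ) (a : ℝ) : Ell2 G →L[ℂ] Ell2 G :=
  weightedShift (fun p => Complex.exp (I * a * c p))
    ⟨1, zero_le_one, fun p => (norm_exp_I_mul a (c p)).le⟩ 0

theorem gauge_apply (c : G →+ ℝ) (a : ℝ) (φ : Ell2 G) (p : G) :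
    gauge c a φ p = Complex.exp (I * a * c p) * φ p := by
  rw [gauge, weightedShift_apply, add_zero]

theorem norm_gauge_le (c : G →+ ℝ) (a : ℝ) : ‖gauge c a‖ ≤ 1 :=
  norm_weightedShift_le _ _ _ zero_le_one fun p => (norm_exp_I_mul a (c p)).le

theorem gauge_neg_mul (c : G →+ ℝ) (a : ℝ) : gauge c (-a) * gauge c a = 1 := by
  ext φ p
  change gauge c (-a) (gauge c a φ) p = φ p
  rw [gauge_apply, gauge_apply, ← mul_assoc, ← Complex.exp_add]
  simp

theorem gauge_mul_neg (c : G →+ ℝ) (a : ℝ) : gauge c a * gauge c (-a) = 1 := by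
  simpa using gauge_neg_mul c (-a)

theorem gauge_basisVec (c : G →+ ℝ) (a : ℝ) (q : G) :
    gauge c a (basisVec q) = Complex.exp (I * a * c q) • basisVec q := by
  ext p
  rw [gauge_apply, lp.coeFn_smul, Pi.smul_apply, smul_eq_mul]
  by_cases h : p = q
  · rw [h]
  · rw [basisVec_of_ne h, mul_zero, mul_zero]

/-- The Combes–Thomas estimate for a finite-range operator `H = ∑ T_s` on `ℓ²(G)`. -/
theorem norm_entry_mul_exp_le (c : G →+ ℝ) (S : Finset G) (T : G → Ell2 G →L[ℂ] Ell2 G)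
    (a : G → G → ℂ) (hT : ∀ s φ p, T s φ p = a s p * φ (p + s)) {B : G → ℝ}
    (hB : ∀ s ∈ S, ‖T s‖ ≤ B s) {z : ℂ} {R : Ell2 G →L[ℂ] Ell2 G} {ρ v ξ : ℝ} (hv : v < ρ)
    (hRl : R * (z • 1 - ∑ s ∈ S, T s) = 1) (hRr : (z • 1 - ∑ s ∈ S, T s) * R = 1)
    (hR : ‖R‖ ≤ ρ⁻¹)
    (hξ : ∀ b : ℝ, |b| < ξ → ∑ s ∈ S, |Real.exp (b * c s) - 1| * B s ≤ v) {b : ℝ} (hb : |b| < ξ)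
    (p q : G) : ‖R (basisVec q) p‖ * Real.exp (b * c (p - q)) ≤ 1 / (ρ - v) := by
  have hv0 : 0 ≤ v := by simpa using hξ 0 (by simpa using (abs_nonneg b).trans_lt hb)
  have hρ : 0 < ρ := hv0.trans_lt hv
  -- For real l this is conjugation of the operator by the unitary character e^{i l c}. The
  -- coefficients also make sense for complex l, so the unbounded weight e^{b c} never has to act on
  -- ℓ²(G).
  set H : ℂ → Ell2 G →L[ℂ] Ell2 G := fun l => ∑ s ∈ S, Complex.exp (I * l * c s) • T s with hH
  set A : ℂ → Ell2 G →L[ℂ] Ell2 G := fun l => z • 1 - H l with hA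
  have hA0 : A 0 = z • 1 - ∑ s ∈ S, T s := by simp [hA, hH]
  have hconj : ∀ x : ℝ, A x = gauge c (-x) * A 0 * gauge c x := by
    intro x
    have h1 : H x = gauge c (-x) * (∑ s ∈ S, T s) * gauge c x := by
      rw [Finset.mul_sum, Finset.sum_mul]
      refine Finset.sum_congr rfl fun s _ => ?_
      ext φ p
      change Complex.exp (I * x * c s) * T s φ p = gauge c (-x) (T s (gauge c x φ)) p
      rw [gauge_apply, hT, hT, gauge_apply, map_add]
      have : Complex.exp (I * x * c s) =
          Complex.exp (I * (-x : ℝ) * c p) * Complex.exp (I * x * (c p + c s : ℝ)) := by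
        rw [← Complex.exp_add]
        congr 1
        push_cast
        ring
      rw [this]
      ring
    rw [hA0]
    simp only [hA]
    rw [h1, mul_sub, sub_mul, mul_smul_comm, smul_mul_assoc, mul_one, gauge_neg_mul]
  have hYl : ∀ x : ℝ, (gauge c (-x) * R * gauge c x) * A x = 1 := by
    intro x
    rw [hconj, hA0]
    calc _ = gauge c (-x) * (R * ((gauge c x * gauge c (-x)) *
          (z • 1 - ∑ s ∈ S, T s))) * gauge c x := by simp only [mul_assoc]
      _ = 1 := by rw [gauge_mul_neg, one_mul, hRl, mul_one, gauge_neg_mul]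
  have hYr : ∀ x : ℝ, A x * (gauge c (-x) * R * gauge c x) = 1 := by
    intro x
    rw [hconj, hA0]
    calc _ = gauge c (-x) * ((z • 1 - ∑ s ∈ S, T s) * ((gauge c x * gauge c (-x)) * R)) *
          gauge c x := by simp only [mul_assoc]
      _ = 1 := by rw [gauge_mul_neg, one_mul, hRr, mul_one, gauge_neg_mul]
  have hYn : ∀ x : ℝ, ‖gauge c (-x) * R * gauge c x‖ ≤ ρ⁻¹ := by
    intro x
    calc _ ≤ ‖gauge c (-x)‖ * ‖R‖ * ‖gauge c x‖ :=
          (norm_mul_le _ _).trans (by gcongr; exact norm_mul_le _ _)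
      _ ≤ 1 * ρ⁻¹ * 1 := by
          gcongr
          · exact norm_gauge_le _ _
          · exact norm_gauge_le _ _
      _ = ρ⁻¹ := by ring
  -- Only the imaginary part of l matters for the perturbation: the real part contributes unimodular
  -- factors. Thus A l stays within v < ρ of an operator whose inverse has norm at most ρ⁻¹.
  have hdiff : ∀ l : ℂ, |l.im| < ξ → ‖A l - A l.re‖ ≤ v := by
    intro l hl
    have h1 : A l - A l.re =
        ∑ s ∈ S, (Complex.exp (I * l.re * c s) - Complex.exp (I * l * c s)) • T s := by
      simp only [hA, hH, sub_smul, Finset.sum_sub_distrib]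
      abel
    rw [h1]
    refine (norm_sum_le_of_le _ fun s hs => ?_).trans (hξ (-l.im) (by rwa [abs_neg]))
    rw [norm_smul]
    have h2 : Complex.exp (I * l.re * c s) - Complex.exp (I * l * c s) =
        Complex.exp (I * l.re * c s) * ((1 - Real.exp (-l.im * c s) : ℝ) : ℂ) := by
      push_cast
      rw [mul_sub, mul_one, ← Complex.exp_add]
      congr 2
      conv_lhs => rw [← Complex.re_add_im l]
      linear_combination (l.im * c s : ℂ) * Complex.I_sq
    rw [h2, norm_mul, norm_exp_I_mul, one_mul, Complex.norm_real, Real.norm_eq_abs, abs_sub_comm]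
    gcongr
    exact hB s hs
  have hinv : ∀ l : ℂ, |l.im| < ξ → IsUnit (A l) ∧ ‖Ring.inverse (A l)‖ ≤ 1 / (ρ - v) :=
    fun l hl => isUnit_and_norm_inverse_le (hYr l.re) (hYl l.re) hρ hv (hYn l.re) (hdiff l hl)
  have hAd : Differentiable ℂ A := by
    simp only [hA, hH]
    fun_prop
  set U : Set ℂ := {l | |l.im| < ξ} with hU
  have hUo : IsOpen U := isOpen_lt (by fun_prop) continuous_const
  have hUc : IsPreconnected U := by
    have : U = Complex.imLm ⁻¹' Set.Ioo (-ξ) ξ := by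
      ext l
      simp [hU, abs_lt]
    rw [this]
    exact ((convex_Ioo (-ξ) ξ).linear_preimage Complex.imLm).isPreconnected
  -- On the real axis the matrix entry of (A l)⁻¹ is an explicit exponential times the entry of R.
  -- Both sides are analytic on the strip |Im l| < ξ, so the identity theorem carries the formula to
  -- l = ib, where the exponential is the real weight e^{b c(p - q)}.
  have hF : AnalyticOnNhd ℂ (fun l => coordL p (Ring.inverse (A l) (basisVec q))) U := by
    refine DifferentiableOn.analyticOnNhd (fun l hl => ?_) hUo
    have h1 : DifferentiableAt ℂ (fun l => Ring.inverse (A l)) l :=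
      (differentiableAt_inverse (𝕜 := ℂ) (hinv l hl).1).comp l (hAd l)
    exact ((coordL p).differentiableAt.comp l
      (h1.clm_apply (differentiableAt_const _))).differentiableWithinAt
  have hG : AnalyticOnNhd ℂ (fun l => Complex.exp (I * l * (c q - c p)) * R (basisVec q) p) U := by
    refine DifferentiableOn.analyticOnNhd (Differentiable.differentiableOn ?_) hUo
    fun_prop
  have hreal : ∀ x : ℝ, coordL p (Ring.inverse (A x) (basisVec q)) =
      Complex.exp (I * x * (c q - c p)) * R (basisVec q) p := by
    intro x
    have h1 : Ring.inverse (A x) = gauge c (-x) * R * gauge c x :=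
      Ring.inverse_unit ⟨_, _, hYr x, hYl x⟩
    rw [h1, coordL_apply]
    change gauge c (-x) (R (gauge c x (basisVec q))) p = _
    rw [gauge_basisVec, map_smul, gauge_apply, lp.coeFn_smul, Pi.smul_apply, smul_eq_mul,
      ← mul_assoc, ← Complex.exp_add]
    congr 2
    push_cast
    ring
  have h0 : (0 : ℂ) ∈ U := by
    change |(0 : ℂ).im| < ξ
    simpa using (abs_nonneg b).trans_lt hb
  have hfreq : ∃ᶠ l in nhdsWithin (0 : ℂ) {0}ᶜ,
      coordL p (Ring.inverse (A l) (basisVec q)) =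
        Complex.exp (I * l * (c q - c p)) * R (basisVec q) p := by
    have ht : Filter.Tendsto (fun x : ℝ => (x : ℂ)) (nhdsWithin 0 {0}ᶜ) (nhdsWithin 0 {0}ᶜ) := by
      refine tendsto_nhdsWithin_of_tendsto_nhds_of_eventually_within _ ?_ ?_
      · exact (Complex.continuous_ofReal.tendsto' 0 0 (by simp)).mono_left nhdsWithin_le_nhds
      · filter_upwards [self_mem_nhdsWithin] with x hx
        simpa using hx
    exact ht.frequently (Filter.Eventually.frequently (Filter.Eventually.of_forall hreal))
  have heq := hF.eqOn_of_preconnected_of_frequently_eq hG hUc h0 hfreq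
  have hbU : (b * I : ℂ) ∈ U := by
    change |(b * I : ℂ).im| < ξ
    simpa using hb
  have hval := heq hbU
  simp only [coordL_apply] at hval
  have h1 : Complex.exp (I * (b * I) * (c q - c p)) = (Real.exp (b * c (p - q)) : ℂ) := by
    rw [map_sub]
    push_cast
    congr 1
    linear_combination ((c q - c p) * b : ℂ) * Complex.I_sq
  rw [h1] at hval
  calc ‖R (basisVec q) p‖ * Real.exp (b * c (p - q))
      = ‖(Ring.inverse (A (b * I))) (basisVec q) p‖ := by
        rw [hval, norm_mul, Complex.norm_real, Real.norm_of_nonneg (Real.exp_pos _).le, mul_comm]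
    _ ≤ ‖Ring.inverse (A (b * I))‖ := by
        refine (norm_coord_le _ _).trans ?_
        have := (Ring.inverse (A (b * I))).le_opNorm (basisVec q)
        rwa [norm_basisVec, mul_one] at this
    _ ≤ _ := (hinv _ hbU).2

end CombesThomas

/-! ### Resolvents through the functional calculus -/

section Resolvent

variable {A : Type*} [CStarAlgebra A]

/-- The resolvent `(z - a)⁻¹` of a normal element. -/
def res (a : A) (z : ℂ) : A := cfc (fun t : ℂ => (z - t)⁻¹) a

theorem continuousOn_inv_sub {a : A} {z : ℂ} (hz : z ∉ spectrum ℂ a) :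
    ContinuousOn (fun t : ℂ => (z - t)⁻¹) (spectrum ℂ a) :=
  ContinuousOn.inv₀ (by fun_prop) fun t ht h => hz (by rwa [sub_eq_zero.1 h])

theorem smul_one_sub_eq_cfc (a : A) [IsStarNormal a] (z : ℂ) :
    z • 1 - a = cfc (fun t : ℂ => z - t) a := by
  rw [cfc_sub (fun _ => z) (fun t => t) a, cfc_const z a, cfc_id' ℂ a, Algebra.algebraMap_eq_smul_one]

theorem res_mul (a : A) [IsStarNormal a] {z : ℂ} (hz : z ∉ spectrum ℂ a) :
    res a z * (z • 1 - a) = 1 := by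
  rw [smul_one_sub_eq_cfc, res, ← cfc_mul _ _ a (continuousOn_inv_sub hz) (by fun_prop),
    ← cfc_one ℂ a]
  refine cfc_congr fun t ht => inv_mul_cancel₀ fun h => hz (by rwa [sub_eq_zero.1 h])

theorem mul_res (a : A) [IsStarNormal a] {z : ℂ} (hz : z ∉ spectrum ℂ a) :
    (z • 1 - a) * res a z = 1 := by
  rw [smul_one_sub_eq_cfc, res, ← cfc_mul _ _ a (by fun_prop) (continuousOn_inv_sub hz),
    ← cfc_one ℂ a]
  refine cfc_congr fun t ht => mul_inv_cancel₀ fun h => hz (by rwa [sub_eq_zero.1 h])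

theorem notMem_spectrum_of_infDist {a : A} {z : ℂ} {ρ : ℝ} (hρ : 0 < ρ)
    (h : ρ ≤ Metric.infDist z (spectrum ℂ a)) : z ∉ spectrum ℂ a := by
  intro hz
  rw [Metric.infDist_zero_of_mem hz] at h
  linarith

theorem norm_res_le (a : A) {z : ℂ} {ρ : ℝ} (hρ : 0 < ρ)
    (h : ρ ≤ Metric.infDist z (spectrum ℂ a)) : ‖res a z‖ ≤ ρ⁻¹ := by
  refine norm_cfc_le (by positivity) fun t ht => ?_
  rw [norm_inv]
  gcongr
  rw [← dist_eq_norm]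
  exact h.trans (Metric.infDist_le_dist_of_mem ht)

end Resolvent

/-! ### Exponential decay of the resolvent of the periodic Hamiltonian -/

/-- The `ℓ¹` norm of a lattice point. -/
def nrm {d : ℕ} (n : Lattice d) : ℝ := ∑ j, |(n j : ℝ)|

theorem nrm_nonneg {d : ℕ} (n : Lattice d) : 0 ≤ nrm n := Finset.sum_nonneg fun _ _ => abs_nonneg _

theorem nrm_add_le {d : ℕ} (m n : Lattice d) : nrm (m + n) ≤ nrm m + nrm n := by
  rw [nrm, nrm, nrm, ← Finset.sum_add_distrib]
  refine Finset.sum_le_sum fun j _ => ?_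
  rw [Pi.add_apply, Int.cast_add]
  exact abs_add_le _ _

theorem nrm_neg {d : ℕ} (n : Lattice d) : nrm (-n) = nrm n := by
  simp [nrm]

theorem abs_le_nrm {d : ℕ} (n : Lattice d) (j : Fin d) : |(n j : ℝ)| ≤ nrm n :=
  Finset.single_le_sum (f := fun j => |(n j : ℝ)|) (fun _ _ => abs_nonneg _) (Finset.mem_univ j)

/-- A signed sum of the coordinates of a lattice point. -/
def signedSum {d : ℕ} (e : Fin d → ℝ) : Lattice d →+ ℝ where
  toFun n := ∑ j, e j * n j
  map_zero' := by simp
  map_add' m n := by simp [mul_add, Finset.sum_add_distrib]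

theorem signedSum_single {d : ℕ} (e : Fin d → ℝ) (j : Fin d) (k : ℤ) :
    signedSum e (Pi.single j k) = e j * k := by
  change ∑ i, e i * (((Pi.single j k : Lattice d) i : ℤ) : ℝ) = _
  rw [Finset.sum_eq_single j]
  · simp
  · intro i _ hi
    simp [hi]
  · simp

theorem eq_single_of_sum_sq_eq_one {d : ℕ} {n : Lattice d} (h : ∑ j, n j ^ 2 = 1) :
    ∃ j, n = Pi.single j 1 ∨ n = Pi.single j (-1) := by
  obtain ⟨j, hj⟩ : ∃ j, n j ≠ 0 := by
    by_contra! h0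
    simp [h0] at h
  have h1 : ∀ i, i ≠ j → n i = 0 := by
    intro i hi
    have h2 : n i ^ 2 + n j ^ 2 ≤ 1 := by
      rw [← h, ← Finset.sum_pair hi (f := fun i => n i ^ 2)]
      exact Finset.sum_le_sum_of_subset_of_nonneg (Finset.subset_univ _) fun _ _ _ => sq_nonneg _
    have h3 : 0 < n j ^ 2 := by positivity
    exact pow_eq_zero_iff (two_ne_zero) |>.1 (le_antisymm (by linarith) (sq_nonneg (n i)))
  have h2 : n j ^ 2 = 1 := by
    rw [← h]
    exact (Finset.sum_eq_single (f := fun i => n i ^ 2) j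
      (fun i _ hi => by simp [h1 i hi]) (by simp)).symm
  have h4 : ∀ k : ℤ, n j = k → n = Pi.single j k := by
    intro k hk
    funext i
    by_cases hi : i = j
    · subst hi
      simpa using hk
    · rw [h1 i hi]
      simp [hi]
  exact ⟨j, (sq_eq_one_iff.1 h2).imp (h4 1) (h4 (-1))⟩

theorem abs_exp_sub_one_add (x : ℝ) :
    |Real.exp x - 1| + |Real.exp (-x) - 1| = 2 * Real.sinh |x| := by
  have key : ∀ y : ℝ, 0 ≤ y → |Real.exp y - 1| + |Real.exp (-y) - 1| = 2 * Real.sinh y := by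
    intro y hy
    have h1 := Real.one_le_exp hy
    have h2 : Real.exp (-y) ≤ 1 := Real.exp_le_one_iff.2 (by linarith)
    rw [abs_of_nonneg (by linarith), abs_of_nonpos (by linarith), Real.sinh_eq]
    ring
  rcases le_total 0 x with h | h
  · rw [abs_of_nonneg h, key x h]
  · rw [abs_of_nonpos h, ← key (-x) (by linarith), neg_neg, add_comm]

/-- Opposite neighbours ±e_j contribute (e^y - 1) + (1 - e^{-y}) = 2 sinh y with y = |b|, which is
the source of the threshold arsinh(κ/2d). The on-site term s = 0 has factor e^0 - 1 = 0, so neither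
the disorder nor W influences the bound. -/
theorem sum_hopping_le {d : ℕ} {S : Finset (Lattice d)}
    (hS : ∀ s ∈ S, s = 0 ∨ ∑ j, s j ^ 2 = 1) {e : Fin d → ℝ} (he : ∀ j, |e j| = 1)
    {B : Lattice d → ℝ} (hB : ∀ s, s ≠ 0 → B s = 1) (b : ℝ) :
    ∑ s ∈ S, |Real.exp (b * signedSum e s) - 1| * B s ≤ 2 * d * Real.sinh |b| := by
  classical
  set ν : Fin d × Bool → Lattice d := fun i => Pi.single i.1 (if i.2 then 1 else -1) with hν
  have hinj : Function.Injective ν := by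
    rintro ⟨j, x⟩ ⟨j', x'⟩ h
    have h1 := congrFun h j
    have hj : j = j' := by
      by_contra hj
      simp only [hν, Pi.single_eq_same, Pi.single_eq_of_ne hj] at h1
      revert h1
      split_ifs <;> simp
    subst hj
    simp only [hν, Pi.single_eq_same] at h1
    cases x <;> cases x' <;> simp_all
  have hsub : S.filter (· ≠ 0) ⊆ Finset.univ.image ν := by
    intro s hs
    rw [Finset.mem_filter] at hs
    obtain ⟨j, h | h⟩ := eq_single_of_sum_sq_eq_one ((hS s hs.1).resolve_left hs.2)
    · exact Finset.mem_image.2 ⟨(j, true), Finset.mem_univ _, by simp [hν, h]⟩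
    · exact Finset.mem_image.2 ⟨(j, false), Finset.mem_univ _, by simp [hν, h]⟩
  calc ∑ s ∈ S, |Real.exp (b * signedSum e s) - 1| * B s
      = ∑ s ∈ S.filter (· ≠ 0), |Real.exp (b * signedSum e s) - 1| := by
        rw [Finset.sum_filter]
        refine Finset.sum_congr rfl fun s _ => ?_
        split_ifs with h
        · rw [hB s h, mul_one]
        · rw [not_not.1 h]
          simp
    _ ≤ ∑ s ∈ Finset.univ.image ν, |Real.exp (b * signedSum e s) - 1| :=
        Finset.sum_le_sum_of_subset_of_nonneg hsub fun _ _ _ => abs_nonneg _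
    _ = ∑ j, (|Real.exp (b * e j) - 1| + |Real.exp (-(b * e j)) - 1|) := by
        rw [Finset.sum_image hinj.injOn, Fintype.sum_prod_type]
        refine Finset.sum_congr rfl fun j _ => ?_
        rw [Fintype.sum_bool]
        simp [hν, signedSum_single]
    _ = 2 * d * Real.sinh |b| := by
        simp only [abs_exp_sub_one_add, abs_mul, he, mul_one]
        simp
        ring

/-- The resolvent of the periodic Hamiltonian. -/
def resPer {d : ℕ} (L : ℕ) (F : Matrix (Fin d) (Fin d) ℝ) (W : ℝ) (z : ℂ) : PerAlgebra L F :=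
  res (hPer L F W) z

/-- The resolvent of the Hamiltonian on the torus. -/
def resTorus {d : ℕ} (L : ℕ) (F : Matrix (Fin d) (Fin d) ℝ) (W : ℝ) (z : ℂ) : TorusAlgebra L F :=
  res (hTorus L F W) z

/-- Exponential decay of the matrix entries of the resolvent of the periodic Hamiltonian. -/
theorem norm_ent_res_le {d L : ℕ} {F : Matrix (Fin d) (Fin d) ℝ} (hF : F.transpose = -F) (W : ℝ)
    {z : ℂ} {ρ ξ ξ' : ℝ} (hξ : 0 ≤ ξ) (hξ' : ξ < ξ') (hρ : 2 * d * Real.sinh ξ' < ρ)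
    (hz : ρ ≤ Metric.infDist z (spectrum ℂ (hPer L F W))) (ω : PerConfig d L) (p q : Lattice d) :
    ‖ent (resPer L F W z : OpFamily (Lattice d) (PerConfig d L)) ω p q‖ ≤
      1 / (ρ - 2 * d * Real.sinh ξ') * Real.exp (-ξ * nrm (p - q)) := by
  classical
  have hsinh : 0 ≤ Real.sinh ξ' := Real.sinh_nonneg_iff.2 (hξ.trans hξ'.le)
  have hρ0 : 0 < ρ := lt_of_le_of_lt (by positivity) hρ
  have hnormal : IsStarNormal (hPer L F W) := (isSelfAdjoint_hPer L hF W).isStarNormal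
  have hzs := notMem_spectrum_of_infDist hρ0 hz
  have hl := congrArg (fun a : PerAlgebra L F => (a : OpFamily (Lattice d) (PerConfig d L)) ω)
    (res_mul (hPer L F W) hzs)
  have hr := congrArg (fun a : PerAlgebra L F => (a : OpFamily (Lattice d) (PerConfig d L)) ω)
    (mul_res (hPer L F W) hzs)
  set R : Ell2 (Lattice d) →L[ℂ] Ell2 (Lattice d) :=
    (resPer L F W z : OpFamily (Lattice d) (PerConfig d L)) ω with hR
  set hf := perHamiltonian_supp (d := d) L W
  -- The signs are those of p - q, so the additive function `signedSum e` attains the ℓ¹ norm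
  -- exactly at this displacement.
  set e : Fin d → ℝ := fun j => if 0 ≤ (p - q) j then 1 else -1 with he
  have he1 : ∀ j, |e j| = 1 := by
    intro j
    simp only [he]
    split_ifs <;> simp
  have hc : signedSum e (p - q) = nrm (p - q) := by
    change ∑ j, e j * ((p - q) j : ℝ) = ∑ j, |((p - q) j : ℝ)|
    refine Finset.sum_congr rfl fun j _ => ?_
    simp only [he]
    split_ifs with h
    · rw [one_mul, abs_of_nonneg (by exact_mod_cast h)]
    · rw [abs_of_neg (by exact_mod_cast not_le.1 h)]
      ring
  set T : Lattice d → Ell2 (Lattice d) →L[ℂ] Ell2 (Lattice d) := fun s =>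
    weightedShift (fun p => perHamiltonian L W (perTranslate (-p) ω) s * phase (magForm F (p + s) p))
      ((exists_bound' perTranslate (magForm F) hf s).imp fun _ h => ⟨h.1, h.2 ω⟩) s with hT
  have hS : ∀ s ∈ hf.finite.toFinset, s = 0 ∨ ∑ j, s j ^ 2 = 1 := by
    intro s hs
    obtain ⟨ω', hω'⟩ := (Set.Finite.mem_toFinset _).1 hs
    by_contra! h
    exact hω' (by simp [perHamiltonian, hamiltonian, h.1, h.2])
  -- The bound for s = 0 contains W but is multiplied by 0 in `sum_hopping_le`.
  have hTB : ∀ s ∈ hf.finite.toFinset, ‖T s‖ ≤ if s = 0 then ‖T 0‖ else 1 := by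
    intro s hs
    split_ifs with h
    · rw [h]
    · refine norm_weightedShift_le _ _ _ zero_le_one fun p' => ?_
      rw [norm_mul, norm_phase, mul_one, perHamiltonian, hamiltonian, if_neg h, add_zero]
      split_ifs <;> simp
  have hl' : R * (z • 1 - ∑ s ∈ hf.finite.toFinset, T s) = 1 := hl
  have hr' : (z • 1 - ∑ s ∈ hf.finite.toFinset, T s) * R = 1 := hr
  have hn : ‖resPer L F W z‖ ≤ ρ⁻¹ := norm_res_le _ hρ0 hz
  have key := norm_entry_mul_exp_le (signedSum e) hf.finite.toFinset T _
    (fun s φ p => weightedShift_apply _ _ s φ p) hTB hρ (R := R) (z := z) hl' hr'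
    ((lp.norm_apply_le_norm (by simp) (resPer L F W z :
      OpFamily (Lattice d) (PerConfig d L)) ω).trans hn)
    (ξ := ξ') (fun b hb => (sum_hopping_le hS he1 (fun s hs => if_neg hs) b).trans (by
      gcongr
      exact Real.sinh_le_sinh.2 hb.le)) (b := ξ) (by rwa [abs_of_nonneg hξ]) p q
  rw [hc] at key
  rw [neg_mul, Real.exp_neg, ← div_eq_mul_inv, le_div_iff₀ (Real.exp_pos _)]
  exact key

/-! ### Weighted `ℓ¹` bounds for convolution products -/

section Weighted

set_option linter.unusedSectionVars false

variable {G Ω : Type} [AddCommGroup G]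

/-- A submultiplicative weight. -/
structure IsWeight (w : G → ℝ) : Prop where
  zero : w 0 = 1
  one_le : ∀ n, 1 ≤ w n
  add_le : ∀ m n, w (m + n) ≤ w m * w n

theorem isWeight_one : IsWeight (fun _ : G => (1 : ℝ)) := ⟨rfl, fun _ => le_rfl, fun _ _ => by simp⟩

/-- `∑_n sup_ω |f(ω, n)| w(n) ≤ A`. -/
def L1Bound (w : G → ℝ) (f : Ω → G → ℂ) (A : ℝ) : Prop :=
  ∃ a : G → ℝ, (∀ n, 0 ≤ a n) ∧ (∀ ω n, ‖f ω n‖ * w n ≤ a n) ∧ Summable a ∧ ∑' n, a n ≤ A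

theorem L1Bound.nonneg {w : G → ℝ} {f : Ω → G → ℂ} {A : ℝ} (h : L1Bound w f A) : 0 ≤ A := by
  obtain ⟨a, h0, -, -, hA⟩ := h
  exact (tsum_nonneg h0).trans hA

theorem L1Bound.mono {w : G → ℝ} {f : Ω → G → ℂ} {A B : ℝ} (h : L1Bound w f A) (hAB : A ≤ B) :
    L1Bound w f B := by
  obtain ⟨a, h0, h1, h2, hA⟩ := h
  exact ⟨a, h0, h1, h2, hA.trans hAB⟩

theorem L1Bound.toOne {w : G → ℝ} (hw : IsWeight w) {f : Ω → G → ℂ} {A : ℝ} (h : L1Bound w f A) :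
    L1Bound (fun _ => 1) f A := by
  obtain ⟨a, h0, h1, h2, hA⟩ := h
  exact ⟨a, h0, fun ω n => (mul_le_mul_of_nonneg_left (hw.one_le n) (norm_nonneg _)).trans (h1 ω n),
    h2, hA⟩

theorem L1Bound.add {w : G → ℝ} (hw : IsWeight w) {f g : Ω → G → ℂ} {A B : ℝ}
    (hf : L1Bound w f A) (hg : L1Bound w g B) : L1Bound w (fun ω n => f ω n + g ω n) (A + B) := by
  obtain ⟨a, a0, a1, a2, hA⟩ := hf
  obtain ⟨b, b0, b1, b2, hB⟩ := hg
  refine ⟨fun n => a n + b n, fun n => add_nonneg (a0 n) (b0 n), fun ω n => ?_, a2.add b2, ?_⟩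
  · refine le_trans ?_ (add_le_add (a1 ω n) (b1 ω n))
    rw [← add_mul]
    exact mul_le_mul_of_nonneg_right (norm_add_le _ _) (zero_le_one.trans (hw.one_le n))
  · rw [a2.tsum_add b2]
    exact add_le_add hA hB

/-- The change of variables `(n, m) ↦ (m, n - m)`. -/
def subEquiv (G : Type) [AddCommGroup G] : G × G ≃ G × G where
  toFun x := (x.2, x.1 - x.2)
  invFun y := (y.1 + y.2, y.1)
  left_inv x := by simp
  right_inv y := by simp

theorem summable_mul_sub {a b : G → ℝ} (a0 : ∀ n, 0 ≤ a n) (b0 : ∀ n, 0 ≤ b n) (ha : Summable a)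
    (hb : Summable b) : Summable fun x : G × G => a x.2 * b (x.1 - x.2) :=
  (subEquiv G).summable_iff.2 (ha.mul_of_nonneg hb a0 b0)

theorem tsum_tsum_mul_sub {a b : G → ℝ} (a0 : ∀ n, 0 ≤ a n) (b0 : ∀ n, 0 ≤ b n) (ha : Summable a)
    (hb : Summable b) : ∑' n, ∑' m, a m * b (n - m) = (∑' n, a n) * ∑' n, b n := by
  rw [ha.tsum_mul_tsum hb (ha.mul_of_nonneg hb a0 b0), ← (subEquiv G).tsum_eq]
  exact ((summable_mul_sub a0 b0 ha hb).tsum_prod).symm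

variable (t : G → Ω → Ω) (θ : G → G → ℝ)

theorem norm_conv_term_le {f g : Ω → G → ℂ} {a b : G → ℝ} (a1 : ∀ ω n, ‖f ω n‖ ≤ a n)
    (b1 : ∀ ω n, ‖g ω n‖ ≤ b n) (ω : Ω) (n m : G) :
    ‖f ω m * g (t (-m) ω) (n - m) * phase (θ n m)‖ ≤ a m * b (n - m) := by
  rw [norm_mul, norm_phase, mul_one, norm_mul]
  exact mul_le_mul (a1 _ _) (b1 _ _) (norm_nonneg _) ((norm_nonneg _).trans (a1 ω m))

theorem L1Bound.conv {w : G → ℝ} (hw : IsWeight w) {f g : Ω → G → ℂ} {A B : ℝ}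
    (hf : L1Bound w f A) (hg : L1Bound w g B) : L1Bound w (conv t θ f g) (A * B) := by
  have hA0 := hf.nonneg
  obtain ⟨a, a0, a1, a2, hA⟩ := hf
  obtain ⟨b, b0, b1, b2, hB⟩ := hg
  have hs := summable_mul_sub a0 b0 a2 b2
  have hw0 : ∀ n, 0 < w n := fun n => zero_lt_one.trans_le (hw.one_le n)
  refine ⟨fun n => ∑' m, a m * b (n - m), fun n => tsum_nonneg fun m => mul_nonneg (a0 _) (b0 _),
    fun ω n => ?_, hs.prod, ?_⟩
  · have hsn : Summable fun m => a m * b (n - m) := hs.prod_factor n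
    have hle : ∀ m, ‖f ω m * g (t (-m) ω) (n - m) * phase (θ n m)‖ ≤ a m * b (n - m) / w n := by
      intro m
      rw [le_div_iff₀ (hw0 n), norm_mul, norm_phase, mul_one, norm_mul]
      calc ‖f ω m‖ * ‖g (t (-m) ω) (n - m)‖ * w n
          ≤ ‖f ω m‖ * ‖g (t (-m) ω) (n - m)‖ * (w m * w (n - m)) := by
            gcongr
            simpa using hw.add_le m (n - m)
        _ = (‖f ω m‖ * w m) * (‖g (t (-m) ω) (n - m)‖ * w (n - m)) := by ring
        _ ≤ a m * b (n - m) := by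
            refine mul_le_mul (a1 _ _) (b1 _ _) ?_ (a0 _)
            exact mul_nonneg (norm_nonneg _) (hw0 _).le
    have h1 := tsum_of_norm_bounded (hsn.div_const (w n)).hasSum hle
    rw [tsum_div_const] at h1
    rwa [← le_div_iff₀ (hw0 n)]
  · rw [tsum_tsum_mul_sub a0 b0 a2 b2]
    exact mul_le_mul hA hB (tsum_nonneg b0) hA0

theorem L1Bound.unit {w : G → ℝ} (hw : IsWeight w) : L1Bound w (unit : Ω → G → ℂ) 1 := by
  classical
  refine ⟨fun n => if n = 0 then 1 else 0, fun n => by dsimp only; split_ifs <;> simp, fun ω n => ?_,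
    (hasSum_ite_eq 0 1).summable, by rw [tsum_ite_eq]⟩
  by_cases h : n = 0
  · simp [NCTorus.unit, h, hw.zero]
  · simp [NCTorus.unit, h]

theorem convProd_zero (f : Fin 0 → Ω → G → ℂ) : convProd t θ f = NCTorus.unit := by
  simp [convProd]

theorem convProd_succ {N : ℕ} (f : Fin (N + 1) → Ω → G → ℂ) :
    convProd t θ f = NCTorus.conv t θ (f 0) (convProd t θ fun j => f j.succ) := by
  simp [convProd, List.ofFn_succ]

theorem L1Bound.convProd {w : G → ℝ} (hw : IsWeight w) {N : ℕ} {f : Fin N → Ω → G → ℂ}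
    {A : Fin N → ℝ} (hf : ∀ j, L1Bound w (f j) (A j)) :
    L1Bound w (convProd t θ f) (∏ j, A j) := by
  induction N with
  | zero =>
    rw [convProd_zero]
    simpa using L1Bound.unit hw
  | succ N ih =>
    rw [convProd_succ, Fin.prod_univ_succ]
    exact (hf 0).conv t θ hw (ih fun j => hf j.succ)

theorem summable_conv_term {f g : Ω → G → ℂ} {A B : ℝ} (hf : L1Bound (fun _ => 1) f A)
    (hg : L1Bound (fun _ => 1) g B) (ω : Ω) (n : G) :
    Summable fun m => f ω m * g (t (-m) ω) (n - m) * phase (θ n m) := by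
  obtain ⟨a, a0, a1, a2, -⟩ := hf
  obtain ⟨b, b0, b1, b2, -⟩ := hg
  simp only [mul_one] at a1 b1
  exact Summable.of_norm_bounded ((summable_mul_sub a0 b0 a2 b2).prod_factor n)
    (norm_conv_term_le t θ a1 b1 ω n)

theorem conv_sub_conv {f f' g g' : Ω → G → ℂ} {A A' B B' : ℝ} (hf : L1Bound (fun _ => 1) f A)
    (hf' : L1Bound (fun _ => 1) f' A') (hg : L1Bound (fun _ => 1) g B)
    (hg' : L1Bound (fun _ => 1) g' B') :
    (fun ω n => conv t θ f g ω n - conv t θ f' g' ω n) = fun ω n =>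
      conv t θ (fun ω n => f ω n - f' ω n) g ω n + conv t θ f' (fun ω n => g ω n - g' ω n) ω n := by
  funext ω n
  have s1 := summable_conv_term t θ hf hg ω n
  have s2 := summable_conv_term t θ hf' hg' ω n
  have s3 := summable_conv_term t θ hf' hg ω n
  have h1 : conv t θ (fun ω n => f ω n - f' ω n) g ω n = conv t θ f g ω n - conv t θ f' g ω n := by
    rw [conv, conv, conv, ← s1.tsum_sub s3]
    congr 1 with m
    ring
  have h2 : conv t θ f' (fun ω n => g ω n - g' ω n) ω n =
      conv t θ f' g ω n - conv t θ f' g' ω n := by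
    rw [conv, conv, conv, ← s3.tsum_sub s2]
    congr 1 with m
    ring
  rw [h1, h2]
  ring

/-- Telescoping: close factors have close convolution products. -/
theorem L1Bound.convProd_sub {N : ℕ} {f g : Fin N → Ω → G → ℂ} {A : Fin N → ℝ} {ε : ℝ}
    (hf : ∀ j, L1Bound (fun _ => 1) (f j) (A j)) (hg : ∀ j, L1Bound (fun _ => 1) (g j) (A j))
    (hfg : ∀ j, L1Bound (fun _ => 1) (fun ω n => f j ω n - g j ω n) (ε * A j)) :
    L1Bound (fun _ => 1) (fun ω n => NCTorus.convProd t θ f ω n - NCTorus.convProd t θ g ω n)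
      (N * ε * ∏ j, A j) := by
  induction N with
  | zero =>
    simp only [convProd_zero, sub_self]
    exact ⟨fun _ => 0, fun _ => le_rfl, fun _ _ => by simp, summable_zero, by simp⟩
  | succ N ih =>
    have hF := L1Bound.convProd t θ isWeight_one fun j : Fin N => hf j.succ
    have hG := L1Bound.convProd t θ isWeight_one fun j : Fin N => hg j.succ
    have hD := ih (fun j => hf j.succ) (fun j => hg j.succ) fun j => hfg j.succ
    simp only [convProd_succ]
    rw [conv_sub_conv t θ (hf 0) (hg 0) hF hG]
    refine (((hfg 0).conv t θ isWeight_one hF).add isWeight_one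
      ((hg 0).conv t θ isWeight_one hD)).mono (le_of_eq ?_)
    rw [Fin.prod_univ_succ]
    push_cast
    ring

variable [TopologicalSpace Ω]

theorem continuous_conv (ht : ∀ m, Continuous (t m)) {f g : Ω → G → ℂ} {A B : ℝ}
    (hf : L1Bound (fun _ => 1) f A) (hg : L1Bound (fun _ => 1) g B)
    (cf : ∀ n, Continuous fun ω => f ω n) (cg : ∀ n, Continuous fun ω => g ω n) (n : G) :
    Continuous fun ω => conv t θ f g ω n := by
  obtain ⟨a, a0, a1, a2, -⟩ := hf
  obtain ⟨b, b0, b1, b2, -⟩ := hg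
  simp only [mul_one] at a1 b1
  refine continuous_tsum (fun m => ?_) ((summable_mul_sub a0 b0 a2 b2).prod_factor n)
    fun m ω => norm_conv_term_le t θ a1 b1 ω n m
  exact ((cf m).mul ((cg (n - m)).comp (ht (-m)))).mul continuous_const

theorem continuous_convProd (ht : ∀ m, Continuous (t m)) {N : ℕ} {f : Fin N → Ω → G → ℂ}
    {A : Fin N → ℝ} (hf : ∀ j, L1Bound (fun _ => 1) (f j) (A j))
    (cf : ∀ j n, Continuous fun ω => f j ω n) (n : G) :
    Continuous fun ω => convProd t θ f ω n := by
  induction N generalizing n with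
  | zero =>
    simp only [convProd_zero]
    exact continuous_const
  | succ N ih =>
    rw [convProd_succ]
    exact continuous_conv t θ ht (hf 0) (L1Bound.convProd t θ isWeight_one fun j => hf j.succ)
      (cf 0) (fun n => ih (fun j => hf j.succ) (fun j => cf j.succ) n) n

end Weighted

/-! ### Periodization -/

section Periodize

variable {d L : ℕ}

/-- The periodization `(ω, p) ↦ ∑_{n ≡ p} f(ω, n)` of a function on the periodic algebra. -/
def periodize (f : PerConfig d L → Lattice d → ℂ) : TorusConfig d L → Torus d L → ℂ :=
  fun ω p => ∑' n, if wrap L n = p then f (unroll ω) n else 0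

theorem norm_ite_le {P : Prop} [Decidable P] {z : ℂ} {a : ℝ} (h : ‖z‖ ≤ a) :
    ‖if P then z else 0‖ ≤ a := by
  split_ifs
  · exact h
  · simpa using (norm_nonneg z).trans h

theorem continuous_periodize {f : PerConfig d L → Lattice d → ℂ} {A : ℝ}
    (hf : L1Bound (fun _ => 1) f A) (cf : ∀ n, Continuous fun ω => f ω n) (p : Torus d L) :
    Continuous fun ω => periodize f ω p := by
  obtain ⟨a, a0, a1, a2, -⟩ := hf
  simp only [mul_one] at a1
  refine continuous_tsum (fun n => ?_) a2 fun n ω => norm_ite_le (a1 _ n)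
  split_ifs
  · exact (cf n).comp (continuous_unroll d L)
  · exact continuous_const

theorem tsum_fiber_mul {φ : Lattice d → ℂ} (hφ : Summable fun n => ‖φ n‖) (K : Torus d L → ℂ) :
    ∑' q, (∑' n, if wrap L n = q then φ n else 0) * K q = ∑' n, φ n * K (wrap L n) := by
  rw [tsum_fintype]
  have hs : ∀ q : Torus d L, Summable fun n => (if wrap L n = q then φ n else 0) * K q := fun q =>
    (Summable.of_norm_bounded hφ fun n => norm_ite_le le_rfl).mul_right _
  simp only [← tsum_mul_right]
  rw [← Summable.tsum_finsetSum fun q _ => hs q]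
  congr 1 with n
  rw [Finset.sum_eq_single (wrap L n)]
  · simp
  · intro q _ hq
    rw [if_neg hq.symm, zero_mul]
  · simp

theorem periodize_unit : periodize (NCTorus.unit : PerConfig d L → Lattice d → ℂ) = NCTorus.unit := by
  funext ω p
  rw [periodize, tsum_eq_single 0]
  · simp [NCTorus.unit, eq_comm]
  · intro n hn
    simp [NCTorus.unit, hn]

/-- After the substitution n = l + m, the sum over n ≡ p becomes a sum over l ≡ p - m, and
quantization lets the phase be read off from residues. Absolute summability justifies the
interchange of sums. -/
theorem periodize_conv {F : Matrix (Fin d) (Fin d) ℝ} (hF : IsQuantized L F)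
    {f g : PerConfig d L → Lattice d → ℂ} {A B : ℝ} (hf : L1Bound (fun _ => 1) f A)
    (hg : L1Bound (fun _ => 1) g B) :
    periodize (conv perTranslate (magForm F) f g) =
      conv rotate (torusForm F) (periodize f) (periodize g) := by
  funext ω p
  obtain ⟨a, a0, a1, a2, -⟩ := hf
  obtain ⟨b, b0, b1, b2, -⟩ := hg
  simp only [mul_one] at a1 b1
  set K : Torus d L → ℂ := fun q =>
    periodize g (rotate (-q) ω) (p - q) * phase (torusForm F p q) with hK
  have hφ : Summable fun n => ‖f (unroll ω) n‖ :=
    Summable.of_nonneg_of_le (fun _ => norm_nonneg _) (fun n => a1 _ n) a2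
  have hR : conv rotate (torusForm F) (periodize f) (periodize g) ω p =
      ∑' n, f (unroll ω) n * K (wrap L n) := by
    rw [← tsum_fiber_mul hφ K]
    refine tsum_congr fun q => ?_
    simp only [hK, periodize]
    ring
  set T : Lattice d → Lattice d → ℂ := fun n m => if wrap L n = p then
    f (unroll ω) m * g (perTranslate (-m) (unroll ω)) (n - m) * phase (magForm F n m) else 0 with hT
  have hTs : Summable (Function.uncurry T) :=
    Summable.of_norm_bounded (summable_mul_sub a0 b0 a2 b2) fun x =>
      norm_ite_le (norm_conv_term_le _ _ a1 b1 _ x.1 x.2)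
  have hL : periodize (conv perTranslate (magForm F) f g) ω p = ∑' n, ∑' m, T n m := by
    refine tsum_congr fun n => ?_
    simp only [hT]
    split_ifs
    · rfl
    · simp
  rw [hL, hR, ← hTs.tsum_comm]
  refine tsum_congr fun m => ?_
  rw [← (Equiv.addRight m).tsum_eq]
  have hterm : ∀ l, T (l + m) m = f (unroll ω) m * ((if wrap L l = p - wrap L m then
      g (unroll (rotate (-wrap L m) ω)) l else 0) * phase (torusForm F p (wrap L m))) := by
    intro l
    simp only [hT, wrap_add, eq_sub_iff_add_eq]
    split_ifs with h
    · rw [← h, ← wrap_add, phase_torusForm hF, perTranslate_unroll, wrap_neg, add_sub_cancel_right]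
      ring
    · simp
  simp only [Equiv.coe_addRight, hterm]
  rw [tsum_mul_left, tsum_mul_right]
  rfl

theorem periodize_convProd {F : Matrix (Fin d) (Fin d) ℝ} (hF : IsQuantized L F) {N : ℕ}
    {f : Fin N → PerConfig d L → Lattice d → ℂ} {A : Fin N → ℝ}
    (hf : ∀ j, L1Bound (fun _ => 1) (f j) (A j)) :
    periodize (convProd perTranslate (magForm F) f) =
      convProd rotate (torusForm F) fun j => periodize (f j) := by
  induction N with
  | zero => rw [convProd_zero, convProd_zero, periodize_unit]
  | succ N ih =>
    rw [convProd_succ, convProd_succ, periodize_conv hF (hf 0)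
      (L1Bound.convProd _ _ isWeight_one fun j => hf j.succ), ih fun j => hf j.succ]

theorem nrm_zero : nrm (0 : Lattice d) = 0 := by simp [nrm]

theorem isWeight_exp {η : ℝ} (hη : 0 ≤ η) : IsWeight fun n : Lattice d => Real.exp (η * nrm n) where
  zero := by simp [nrm_zero]
  one_le n := Real.one_le_exp (mul_nonneg hη (nrm_nonneg n))
  add_le m n := by
    rw [← Real.exp_add, ← mul_add]
    exact Real.exp_le_exp.2 (mul_le_mul_of_nonneg_left (nrm_add_le m n) hη)

theorem le_nrm_of_wrap_eq_zero {n : Lattice d} (hn : n ≠ 0) (h : wrap L n = 0) : (L : ℝ) ≤ nrm n := by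
  obtain ⟨j, hj⟩ : ∃ j, n j ≠ 0 := by
    by_contra! h0
    exact hn (funext h0)
  have h1 := Int.le_of_dvd (abs_pos.2 hj) ((dvd_abs _ _).2 (wrap_eq_zero_dvd h j))
  refine le_trans ?_ (abs_le_nrm n j)
  rw [← Int.cast_abs]
  have : (L : ℤ) ≤ |n j| := by push_cast at h1; linarith
  exact_mod_cast this

/-- The difference consists of the values at nonzero n ≡ 0. Each such n has ℓ¹ norm at least L, so
the weight e^{η|n|} already present in the bound yields the factor e^{-ηL}. -/
theorem norm_periodize_sub_le {η : ℝ} (hη : 0 ≤ η) {f : PerConfig d L → Lattice d → ℂ} {A : ℝ}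
    (hf : L1Bound (fun n => Real.exp (η * nrm n)) f A) (ω : TorusConfig d L) :
    ‖f (unroll ω) 0 - periodize f ω 0‖ ≤ A * Real.exp (-η * L) := by
  classical
  have hw := isWeight_exp (d := d) hη
  obtain ⟨a, a0, a1, a2, hA⟩ := hf
  have ha : ∀ ω n, ‖f ω n‖ ≤ a n := fun ω n =>
    (le_mul_of_one_le_right (norm_nonneg _) (hw.one_le n)).trans (a1 ω n)
  have hs : Summable fun n => if wrap L n = 0 then f (unroll ω) n else 0 :=
    Summable.of_norm_bounded a2 fun n => norm_ite_le (ha _ n)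
  have h1 : periodize f ω 0 = f (unroll ω) 0 +
      ∑' n, if n = 0 then 0 else if wrap L n = 0 then f (unroll ω) n else 0 := by
    rw [periodize, hs.tsum_eq_add_tsum_ite 0]
    simp
  rw [h1, sub_add_cancel_left, norm_neg]
  refine (tsum_of_norm_bounded (a2.mul_right (Real.exp (-η * L))).hasSum fun n => ?_).trans ?_
  · have hpos : 0 ≤ a n * Real.exp (-η * L) := mul_nonneg (a0 n) (Real.exp_pos _).le
    by_cases h0 : n = 0
    · simpa [h0] using hpos
    by_cases h2 : wrap L n = 0
    · rw [if_neg h0, if_pos h2]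
      have h3 : 1 ≤ Real.exp (η * nrm n) * Real.exp (-η * L) := by
        rw [← Real.exp_add]
        refine Real.one_le_exp ?_
        have := mul_le_mul_of_nonneg_left (le_nrm_of_wrap_eq_zero h0 h2) hη
        linarith
      calc ‖f (unroll ω) n‖ ≤ ‖f (unroll ω) n‖ * (Real.exp (η * nrm n) * Real.exp (-η * L)) :=
            le_mul_of_one_le_right (norm_nonneg _) h3
        _ = ‖f (unroll ω) n‖ * Real.exp (η * nrm n) * Real.exp (-η * L) := by ring
        _ ≤ _ := mul_le_mul_of_nonneg_right (a1 _ n) (Real.exp_pos _).le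
    · simpa [h0, h2] using hpos
  · rw [tsum_mul_right]
    exact mul_le_mul_of_nonneg_right hA (Real.exp_pos _).le

end Periodize

/-! ### Continuity of matrix entries -/

section ContinuousEntries

variable {G Ω : Type} [AddCommGroup G] [TopologicalSpace Ω] [CompactSpace Ω]
  {t : G → Ω → Ω} (θ : G → G → ℝ)

theorem continuous_ent_rep (ht : ∀ m, Continuous (t m)) {f : Ω → G → ℂ}
    (hf : IsCompactlySupported f) (p q : G) :
    Continuous fun ω => ent (rep t θ hf) ω p q := by
  simp only [ent_rep]
  exact ((hf.continuous _).comp (ht _)).mul continuous_const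

theorem continuous_ent_mul_rep (ht : ∀ m, Continuous (t m)) {f : Ω → G → ℂ} (hf : IsCompactlySupported f)
    {b : OpFamily G Ω} (hb : ∀ p q, Continuous fun ω => ent b ω p q) (p n : G) :
    Continuous fun ω => ent (b * rep t θ hf) ω p n := by
  classical
  have h : ∀ ω, ent (b * rep t θ hf) ω p n = ∑ m ∈ hf.finite.toFinset.image (fun s => n - s),
      ent b ω p m * ent (rep t θ hf) ω m n := by
    intro ω
    refine (hasSum_ent_mul b (rep t θ hf) ω p n).unique (hasSum_sum_of_ne_finset_zero fun m hm => ?_)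
    rw [ent_rep]
    have : f (t (-m) ω) (n - m) = 0 := by
      by_contra h0
      exact hm (Finset.mem_image.2 ⟨n - m, by simpa using ⟨_, h0⟩, by simp⟩)
    simp [this]
  simp only [h]
  exact continuous_finsetSum _ fun m _ => (hb p m).mul (continuous_ent_rep θ ht hf m n)

theorem continuous_ent_mul_star_rep (ht : ∀ m, Continuous (t m)) {f : Ω → G → ℂ} (hf : IsCompactlySupported f)
    {b : OpFamily G Ω} (hb : ∀ p q, Continuous fun ω => ent b ω p q) (p n : G) :
    Continuous fun ω => ent (b * star (rep t θ hf)) ω p n := by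
  classical
  have h : ∀ ω, ent (b * star (rep t θ hf)) ω p n =
      ∑ m ∈ hf.finite.toFinset.image (fun s => n + s),
        ent b ω p m * star (ent (rep t θ hf) ω n m) := by
    intro ω
    have h1 := hasSum_ent_mul b (star (rep t θ hf)) ω p n
    simp only [ent_star] at h1
    refine h1.unique (hasSum_sum_of_ne_finset_zero fun m hm => ?_)
    rw [ent_rep]
    have : f (t (-n) ω) (m - n) = 0 := by
      by_contra h0
      exact hm (Finset.mem_image.2 ⟨m - n, by simpa using ⟨_, h0⟩, by simp⟩)
    simp [this]
  simp only [h]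
  exact continuous_finsetSum _ fun m _ => (hb p m).mul (continuous_ent_rep θ ht hf n m).star

/-- The matrix entries of an element of the covariance algebra are continuous in `ω`. -/
theorem continuous_ent (ht : ∀ m, Continuous (t m)) (a : covarianceAlgebra t θ) (p q : G) :
    Continuous fun ω => ent (a : OpFamily G Ω) ω p q := by
  set S : Set (OpFamily G Ω) :=
    {T | ∃ (f : Ω → G → ℂ) (hf : IsCompactlySupported f), T = rep t θ hf} with hS
  -- Entries of a product of two general elements are infinite sums, so continuity is not visibly
  -- preserved by products. The induction claim is therefore about right multiplication of any b
  -- with continuous entries; for a generator or its adjoint this involves only finite sums.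
  have key : ∀ x ∈ Algebra.adjoin ℂ (S ∪ star S), ∀ b : OpFamily G Ω,
      (∀ p q, Continuous fun ω => ent b ω p q) → ∀ p q, Continuous fun ω => ent (b * x) ω p q := by
    intro x hx
    induction hx using Algebra.adjoin_induction with
    | mem x hx =>
      intro b hb p q
      rcases hx with ⟨f, hf, rfl⟩ | ⟨f, hf, h⟩
      · exact continuous_ent_mul_rep θ ht hf hb p q
      · rw [← star_star x, h]
        exact continuous_ent_mul_star_rep θ ht hf hb p q
    | algebraMap r =>
      intro b hb p q
      rw [Algebra.algebraMap_eq_smul_one, mul_smul_comm, mul_one]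
      simp only [ent_smul]
      exact continuous_const.mul (hb p q)
    | add x y _ _ hx hy =>
      intro b hb p q
      simp only [mul_add, ent_add]
      exact (hx b hb p q).add (hy b hb p q)
    | mul x y _ _ hx hy =>
      intro b hb p q
      rw [← mul_assoc]
      exact hy _ (hx b hb) p q
  have h1 : ∀ p q, Continuous fun ω => ent (1 : OpFamily G Ω) ω p q := by
    intro p q
    simp only [ent_one]
    exact continuous_const
  refine continuous_of_uniform_approx_of_continuous fun u hu => ?_
  obtain ⟨ε, hε, hu⟩ := Metric.mem_uniformity_dist.1 hu
  have ha : (a : OpFamily G Ω) ∈ closure (StarAlgebra.adjoin ℂ S : Set (OpFamily G Ω)) := a.2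
  obtain ⟨x, hx, hxa⟩ := Metric.mem_closure_iff.1 ha ε hε
  refine ⟨fun ω => ent x ω p q, by simpa using key x hx 1 h1 p q, fun ω => hu ?_⟩
  rw [dist_eq_norm] at hxa ⊢
  rw [← ent_sub]
  exact (norm_ent_le _ ω p q).trans_lt hxa

end ContinuousEntries

/-! ### Summability of exponential weights -/

section ExpSum

theorem summable_exp_neg_abs_int {ξ : ℝ} (hξ : 0 < ξ) :
    Summable fun n : ℤ => Real.exp (-ξ * |(n : ℝ)|) := by
  have h : Summable fun n : ℕ => Real.exp (-ξ * n) := by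
    have := summable_geometric_of_lt_one (Real.exp_pos (-ξ)).le
      (Real.exp_lt_one_iff.2 (neg_lt_zero.2 hξ))
    refine this.congr fun n => ?_
    rw [← Real.exp_nat_mul]
    congr 1
    ring
  refine Summable.of_nat_of_neg ?_ ?_ <;> simpa using h

theorem summable_exp_neg_nrm {ξ : ℝ} (hξ : 0 < ξ) (d : ℕ) :
    Summable fun n : Lattice d => Real.exp (-ξ * nrm n) := by
  induction d with
  | zero => exact Summable.of_finite
  | succ d ih =>
    rw [← (Fin.consEquiv fun _ : Fin (d + 1) => ℤ).summable_iff]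
    refine ((summable_exp_neg_abs_int hξ).mul_of_nonneg ih (fun _ => (Real.exp_pos _).le)
      fun _ => (Real.exp_pos _).le).congr fun x => ?_
    rw [← Real.exp_add, ← mul_add]
    simp [Fin.consEquiv, nrm, Fin.sum_univ_succ]

/-- `∑_n e^{-ξ |n|₁}`. -/
def expSum (d : ℕ) (ξ : ℝ) : ℝ := ∑' n : Lattice d, Real.exp (-ξ * nrm n)

theorem expSum_nonneg (d : ℕ) (ξ : ℝ) : 0 ≤ expSum d ξ := tsum_nonneg fun _ => (Real.exp_pos _).le

theorem L1Bound.of_exp {Ω : Type} {d : ℕ} {f : Ω → Lattice d → ℂ} {w : Lattice d → ℝ} {C ξ : ℝ}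
    (hξ : 0 < ξ) (hC : 0 ≤ C) (h : ∀ ω n, ‖f ω n‖ * w n ≤ C * Real.exp (-ξ * nrm n)) :
    L1Bound w f (C * expSum d ξ) :=
  ⟨_, fun _ => mul_nonneg hC (Real.exp_pos _).le, h, (summable_exp_neg_nrm hξ d).mul_left C,
    by rw [tsum_mul_left, expSum]⟩

theorem IsCompactlySupported.exists_l1Bound {G Ω : Type} [AddCommGroup G] [TopologicalSpace Ω]
    [CompactSpace Ω] {f : Ω → G → ℂ} (hf : IsCompactlySupported f) :
    ∃ B, L1Bound (fun _ => 1) f B := by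
  classical
  choose C hC h using fun s => exists_bound hf s
  refine ⟨_, fun s => if s ∈ hf.finite.toFinset then C s else 0, fun s => ?_, fun ω s => ?_,
    summable_of_ne_finset_zero (s := hf.finite.toFinset) fun s hs => if_neg hs, le_rfl⟩
  · dsimp only
    split_ifs
    exacts [hC s, le_rfl]
  · rw [mul_one]
    dsimp only
    split_ifs with hs
    · exact h s ω
    · have : f ω s = 0 := by
        by_contra h0
        exact hs (by simpa using ⟨_, h0⟩)
      simp [this]

end ExpSum

/-! ### Periodization of the Hamiltonian -/

section PeriodizeHamiltonian

variable {d L : ℕ}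

theorem periodize_perHamiltonian (hL : 1 ≤ L) (W : ℝ) :
    periodize (perHamiltonian (d := d) L W) = mapP (perHamiltonian L W) := by
  funext ω p
  rw [periodize, tsum_eq_single (coord p)]
  · simp [mapP]
  · intro n hn
    split_ifs with h
    · by_contra h0
      refine hn ?_
      rw [← h, coord_wrap]
      intro j
      exact (abs_le_one_of_hamiltonian_ne_zero h0 j).trans (by exact_mod_cast hL)
    · rfl

end PeriodizeHamiltonian

/-! ### Resolvents and periodization -/

section ResolventPeriodize

variable {d L : ℕ}

instance instFiniteDimensionalEll2 {G : Type} [Finite G] : FiniteDimensional ℂ (Ell2 G) :=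
  FiniteDimensional.of_injective (V₂ := G → ℂ)
    { toFun := fun φ => (φ : G → ℂ), map_add' := fun _ _ => rfl, map_smul' := fun _ _ => rfl }
    fun φ ψ (h : (φ : G → ℂ) = ψ) => lp.ext h

/-- With finitely many sites every ℓ²(G) is finite-dimensional, so a one-sided inverse is two-sided.
It is then enough to periodize one of the two resolvent equations. -/
theorem opFamily_mul_eq_one_symm {G Ω : Type} [Nonempty G] [Finite G] {a b : OpFamily G Ω}
    (h : a * b = 1) : b * a = 1 := by
  ext1
  funext ω
  have h1 : a ω * b ω = 1 := congrArg (fun x : OpFamily G Ω => x ω) h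
  have h2 : ((a ω : Ell2 G →ₗ[ℂ] Ell2 G)) * (b ω : Ell2 G →ₗ[ℂ] Ell2 G) = 1 := by
    ext1 x
    exact congrArg (fun T : Ell2 G →L[ℂ] Ell2 G => T x) h1
  have h3 := mul_eq_one_comm.1 h2
  change b ω * a ω = 1
  ext1 x
  exact congrArg (fun T : Ell2 G →ₗ[ℂ] Ell2 G => T x) h3

theorem isCompactlySupported_of_finite {G Ω : Type} [AddCommGroup G] [TopologicalSpace Ω]
    [Finite G] {f : Ω → G → ℂ} (hf : ∀ n, Continuous fun ω => f ω n) : IsCompactlySupported f :=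
  ⟨hf, Set.toFinite _⟩

/-- The cocycle identity behind the twisted product. The torus form is not additive, because
coordinates jump when wrapped, but its phase may be computed on lattice lifts, where the form is
bilinear and antisymmetric. -/
theorem phase_torusForm_cocycle {F : Matrix (Fin d) (Fin d) ℝ} (hF : IsQuantized L F)
    (p m n : Torus d L) :
    phase (torusForm F m p) * phase (torusForm F n m) =
      phase (torusForm F (n - p) (m - p)) * phase (torusForm F n p) := by
  obtain ⟨p, rfl⟩ : ∃ k, wrap L k = p := ⟨coord p, wrap_coord p⟩
  obtain ⟨m, rfl⟩ : ∃ k, wrap L k = m := ⟨coord m, wrap_coord m⟩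
  obtain ⟨n, rfl⟩ : ∃ k, wrap L k = n := ⟨coord n, wrap_coord n⟩
  rw [← wrap_sub, ← wrap_sub, phase_torusForm hF, phase_torusForm hF, phase_torusForm hF,
    phase_torusForm hF, ← phase_add, ← phase_add]
  congr 1
  have h1 := magForm_add_left (F := F) (n - p) p (m - p)
  have h2 := magForm_add_right (F := F) n (m - p) p
  have h3 := magForm_add_right (F := F) p (m - p) p
  rw [sub_add_cancel] at h1 h2 h3
  rw [magForm_self hF.1] at h3
  have h4 := magForm_swap hF.1 p m
  linarith

theorem rotate_rotate (p q : Torus d L) (ω : TorusConfig d L) :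
    rotate p (rotate q ω) = rotate (p + q) ω := by
  funext x
  simp [rotate, add_assoc]

theorem ent_rep_mul_rep {F : Matrix (Fin d) (Fin d) ℝ} (hF : IsQuantized L F)
    {f g : TorusConfig d L → Torus d L → ℂ} (hf : IsCompactlySupported f)
    (hg : IsCompactlySupported g) (ω : TorusConfig d L) (p n : Torus d L) :
    ent (rep rotate (torusForm F) hf * rep rotate (torusForm F) hg) ω p n =
      conv rotate (torusForm F) f g (rotate (-p) ω) (n - p) * phase (torusForm F n p) := by
  rw [← (hasSum_ent_mul_rep rotate (torusForm F) _ hg ω p n).tsum_eq, conv, ← tsum_mul_right,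
    ← (Equiv.subRight p).tsum_eq (fun m => f (rotate (-p) ω) m *
      g (rotate (-m) (rotate (-p) ω)) (n - p - m) * phase (torusForm F (n - p) m) *
        phase (torusForm F n p))]
  refine tsum_congr fun m => ?_
  have h := phase_torusForm_cocycle hF p m n
  rw [ent_rep, Equiv.subRight_apply, rotate_rotate, show -(m - p) + -p = -m by abel,
    show n - p - (m - p) = n - m by abel]
  linear_combination f (rotate (-p) ω) (m - p) * g (rotate (-m) ω) (n - m) * h

theorem torusForm_zero_right (F : Matrix (Fin d) (Fin d) ℝ) (p : Torus d L) :
    torusForm F p 0 = 0 := by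
  have : coord (0 : Torus d L) = 0 := coord_eq_zero.2 rfl
  simp [torusForm, magForm, this]

theorem magForm_zero_right (F : Matrix (Fin d) (Fin d) ℝ) (p : Lattice d) :
    magForm F p 0 = 0 := by
  simp [magForm]

/-- The function of the resolvent of the periodic Hamiltonian. -/
def resFun (L : ℕ) (F : Matrix (Fin d) (Fin d) ℝ) (W : ℝ) (z : ℂ) :
    PerConfig d L → Lattice d → ℂ :=
  toFun perTranslate (magForm F) (resPer L F W z)

theorem continuous_toFun_per (F : Matrix (Fin d) (Fin d) ℝ) (a : PerAlgebra L F) (n : Lattice d) :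
    Continuous fun ω => toFun perTranslate (magForm F) a ω n := by
  simp only [toFun_eq_ent]
  exact continuous_ent (magForm F) continuous_perTranslate a 0 n

instance instNontrivialPerAlgebra (F : Matrix (Fin d) (Fin d) ℝ) : Nontrivial (PerAlgebra L F) := by
  refine ⟨⟨1, 0, fun h => ?_⟩⟩
  have h1 := congrArg (fun a : PerAlgebra L F => ent (a : OpFamily (Lattice d) (PerConfig d L))
    (unroll fun _ => ⟨0, by norm_num⟩) 0 0) h
  have h2 : ent (1 : OpFamily (Lattice d) (PerConfig d L)) (unroll fun _ => ⟨0, by norm_num⟩) 0 0 =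
      0 := h1
  rw [ent_one, if_pos rfl] at h2
  exact one_ne_zero h2

theorem exists_l1Bound_resFun {F : Matrix (Fin d) (Fin d) ℝ} (hF : IsQuantized L F) (W : ℝ) {z : ℂ}
    (hz : z ∉ spectrum ℂ (hPer L F W)) : ∃ A, L1Bound (fun _ => 1) (resFun L F W z) A := by
  have hc : IsClosed (spectrum ℂ (hPer L F W)) := spectrum.isClosed _
  have hne : (spectrum ℂ (hPer L F W)).Nonempty := spectrum.nonempty _
  have hρ : 0 < Metric.infDist z (spectrum ℂ (hPer L F W)) := (hc.notMem_iff_infDist_pos hne).1 hz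
  set ρ := Metric.infDist z (spectrum ℂ (hPer L F W)) with hρd
  -- Any positive rate will do here. This choice gives 2d sinh ξ' = ρ d/(2d + 1) < ρ, and the added
  -- 1 keeps the denominator nonzero when d = 0.
  set ξ' := Real.arsinh (ρ / (2 * (2 * d + 1))) with hξ'
  have hξ0 : 0 < ξ' := Real.arsinh_pos_iff.2 (by positivity)
  have hs : 2 * d * Real.sinh ξ' < ρ := by
    rw [hξ', Real.sinh_arsinh, mul_div_assoc', div_lt_iff₀ (by positivity)]
    nlinarith [(Nat.cast_nonneg d : (0 : ℝ) ≤ d)]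
  refine ⟨_, L1Bound.of_exp (C := 1 / (ρ - 2 * d * Real.sinh ξ')) (half_pos hξ0)
    (by have := sub_pos.2 hs; positivity) fun ω n => ?_⟩
  rw [mul_one, resFun, toFun_eq_ent]
  refine (norm_ent_res_le hF.1 W (half_pos hξ0).le (half_lt_self hξ0) hs le_rfl ω 0 n).trans_eq ?_
  rw [zero_sub, nrm_neg]

/-- The row at site 0 of (z - h)⁻¹(z - h) = 1, in the convolution form to which `periodize_conv`
applies. -/
theorem conv_resFun {F : Matrix (Fin d) (Fin d) ℝ} (hF : IsQuantized L F) (W : ℝ) {z : ℂ}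
    (hz : z ∉ spectrum ℂ (hPer L F W)) :
    conv perTranslate (magForm F) (resFun L F W z) (perHamiltonian L W) =
      fun ω n => z * resFun L F W z ω n - NCTorus.unit ω n := by
  have hnormal : IsStarNormal (hPer L F W) := (isSelfAdjoint_hPer L hF.1 W).isStarNormal
  have h1 : (resPer L F W z : OpFamily (Lattice d) (PerConfig d L)) *
      (z • 1 - rep perTranslate (magForm F) (perHamiltonian_supp L W)) = 1 :=
    congrArg (Subtype.val : PerAlgebra L F → _) (res_mul (hPer L F W) hz)
  funext ω n
  have h2 := congrArg (fun a : OpFamily (Lattice d) (PerConfig d L) => ent a ω 0 n) h1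
  simp only [mul_sub, mul_smul_comm, mul_one, ent_sub, ent_smul, ent_one] at h2
  rw [← (hasSum_ent_mul_rep perTranslate (magForm F) _ (perHamiltonian_supp L W) ω 0 n).tsum_eq]
    at h2
  have h3 := h2.trans (show _ = NCTorus.unit ω n by simp [NCTorus.unit, eq_comm])
  rw [resFun, conv]
  simp only [toFun_eq_ent]
  linear_combination -(1 : ℂ) * h3

theorem periodize_sub_unit {u : PerConfig d L → Lattice d → ℂ} {A : ℝ}
    (hu : L1Bound (fun _ => 1) u A) (z : ℂ) :
    periodize (fun ω n => z * u ω n - NCTorus.unit ω n) =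
      fun ω p => z * periodize u ω p - NCTorus.unit ω p := by
  have h1 := L1Bound.unit (Ω := PerConfig d L) (isWeight_one (G := Lattice d))
  obtain ⟨a, a0, a1, a2, -⟩ := hu
  obtain ⟨b, b0, b1, b2, -⟩ := h1
  simp only [mul_one] at a1 b1
  funext ω p
  rw [← periodize_unit]
  have s1 : Summable fun n => if wrap L n = p then u (unroll ω) n else 0 :=
    Summable.of_norm_bounded a2 fun n => norm_ite_le (a1 _ n)
  have s2 : Summable fun n : Lattice d => if wrap L n = p then
      (NCTorus.unit (unroll ω : PerConfig d L) n : ℂ) else 0 :=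
    Summable.of_norm_bounded b2 fun n => norm_ite_le (b1 _ n)
  rw [periodize, periodize, periodize, ← tsum_mul_left, ← (s1.mul_left z).tsum_sub s2]
  refine tsum_congr fun n => ?_
  split_ifs <;> simp

theorem isCompactlySupported_periodize_resFun {F : Matrix (Fin d) (Fin d) ℝ}
    (hF : IsQuantized L F) (W : ℝ) {z : ℂ} (hz : z ∉ spectrum ℂ (hPer L F W)) :
    IsCompactlySupported (periodize (resFun L F W z)) := by
  obtain ⟨A, hA⟩ := exists_l1Bound_resFun hF W hz
  exact isCompactlySupported_of_finite fun p =>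
    continuous_periodize hA (fun n => continuous_toFun_per F _ n) p

/-- The periodized resolvent is a left inverse of `z - h̃`. -/
theorem ofFun_periodize_resFun_mul (hL : 1 ≤ L) {F : Matrix (Fin d) (Fin d) ℝ}
    (hF : IsQuantized L F) (W : ℝ) {z : ℂ} (hz : z ∉ spectrum ℂ (hPer L F W)) :
    ofFun rotate (torusForm F) (isCompactlySupported_periodize_resFun hF W hz) *
      (z • 1 - hTorus L F W) = 1 := by
  classical
  obtain ⟨A, hA⟩ := exists_l1Bound_resFun hF W hz
  obtain ⟨B, hB⟩ := (perHamiltonian_supp (d := d) L W).exists_l1Bound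
  have hc := periodize_conv hF hA hB
  rw [conv_resFun hF W hz, periodize_sub_unit hA, periodize_perHamiltonian hL] at hc
  refine Subtype.ext (opFamily_ext fun ω p n => ?_)
  change ent (rep rotate (torusForm F) (isCompactlySupported_periodize_resFun hF W hz) *
    (z • 1 - rep rotate (torusForm F) (mapP_supp (perHamiltonian_supp L W)))) ω p n = ent 1 ω p n
  rw [mul_sub, mul_smul_comm, mul_one, ent_sub, ent_smul, ent_rep_mul_rep hF, ← hc, ent_rep, ent_one]
  have h0 : torusForm F p p = 0 := by
    rw [torusForm, magForm_self hF.1]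
  by_cases h : p = n
  · subst h
    simp [NCTorus.unit, h0, phase_zero]
  · have h' : n - p ≠ 0 := fun e => h (sub_eq_zero.1 e).symm
    simp [NCTorus.unit, h, h', mul_assoc]

theorem torus_mul_eq_one_symm {F : Matrix (Fin d) (Fin d) ℝ} {a b : TorusAlgebra L F}
    (h : a * b = 1) : b * a = 1 :=
  Subtype.ext (opFamily_mul_eq_one_symm (congrArg Subtype.val h))

/-- Off the periodic spectrum the periodized resolvent is a left inverse of z - h̃, hence an
inverse. Functions analytic near σ(h) may thus be applied to h̃. -/
theorem spectrum_hTorus_subset (hL : 1 ≤ L) {F : Matrix (Fin d) (Fin d) ℝ}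
    (hF : IsQuantized L F) (W : ℝ) : spectrum ℂ (hTorus L F W) ⊆ spectrum ℂ (hPer L F W) := by
  intro z hz
  by_contra h
  refine hz ?_
  have h1 := ofFun_periodize_resFun_mul hL hF W h
  rw [← Algebra.algebraMap_eq_smul_one] at h1
  exact ⟨⟨_, _, torus_mul_eq_one_symm h1, h1⟩, rfl⟩

theorem periodize_resFun (hL : 1 ≤ L) {F : Matrix (Fin d) (Fin d) ℝ} (hF : IsQuantized L F)
    (W : ℝ) {z : ℂ} (hz : z ∉ spectrum ℂ (hPer L F W)) :
    periodize (resFun L F W z) = toFun rotate (torusForm F) (resTorus L F W z) := by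
  have hnormal : IsStarNormal (hTorus L F W) := (isSelfAdjoint_hTorus L hF.1 W).isStarNormal
  have h1 := ofFun_periodize_resFun_mul hL hF W hz
  have h2 := mul_res (hTorus L F W) fun h => hz (spectrum_hTorus_subset hL hF W h)
  have h3 : resTorus L F W z = _ := (left_inv_eq_right_inv h1 h2).symm
  rw [h3]
  funext ω p
  rw [toFun_eq_ent]
  change _ = ent (rep rotate (torusForm F) (isCompactlySupported_periodize_resFun hF W hz)) ω 0 p
  rw [ent_rep, torusForm_zero_right, phase_zero, sub_zero, mul_one]
  congr 1
  funext q
  simp [rotate]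

end ResolventPeriodize

/-! ### Functional calculus -/

section Calculus

theorem norm_cfc_sub_sum_res_le {A : Type*} [CStarAlgebra A] (a : A) [IsStarNormal a] {Φ : ℂ → ℂ}
    (hΦ : ContinuousOn Φ (spectrum ℂ a)) {ι : Type*} (s : Finset ι) (z c : ι → ℂ)
    (hz : ∀ i ∈ s, z i ∉ spectrum ℂ a) {ε : ℝ} (hε : 0 ≤ ε)
    (h : ∀ t ∈ spectrum ℂ a, ‖Φ t - ∑ i ∈ s, c i / (z i - t)‖ ≤ ε) :
    ‖cfc Φ a - ∑ i ∈ s, c i • res a (z i)‖ ≤ ε := by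
  have hc : ∀ i ∈ s, ContinuousOn (fun t => c i * (z i - t)⁻¹) (spectrum ℂ a) := fun i hi =>
    continuousOn_const.mul (continuousOn_inv_sub (hz i hi))
  have h1 : ∑ i ∈ s, c i • res a (z i) = cfc (fun t => ∑ i ∈ s, c i * (z i - t)⁻¹) a := by
    rw [← Finset.sum_fn, cfc_sum _ a s hc]
    exact Finset.sum_congr rfl fun i hi =>
      (cfc_const_mul (c i) _ a (continuousOn_inv_sub (hz i hi))).symm
  rw [h1, ← cfc_sub _ _ a hΦ (continuousOn_finsetSum _ hc)]
  exact norm_cfc_le hε fun t ht => by simpa only [div_eq_mul_inv] using h t ht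

section Linear

variable {G Ω : Type} [AddCommGroup G] [TopologicalSpace Ω] [CompactSpace Ω]
  (t : G → Ω → Ω) (θ : G → G → ℝ)

theorem toFun_sum_smul {ι : Type*} (s : Finset ι) (c : ι → ℂ) (a : ι → covarianceAlgebra t θ)
    (ω : Ω) (n : G) :
    toFun t θ (∑ i ∈ s, c i • a i) ω n = ∑ i ∈ s, c i * toFun t θ (a i) ω n := by
  let T : covarianceAlgebra t θ →ₗ[ℂ] ℂ :=
    { toFun := fun a => toFun t θ a ω n, map_add' := fun _ _ => rfl, map_smul' := fun _ _ => rfl }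
  change T (∑ i ∈ s, c i • a i) = ∑ i ∈ s, c i • T (a i)
  rw [map_sum]
  simp only [map_smul]

theorem norm_toFun_sub_le (a b : covarianceAlgebra t θ) (ω : Ω) (n : G) :
    ‖toFun t θ a ω n - toFun t θ b ω n‖ ≤ ‖a - b‖ :=
  norm_ent_le ((a - b : covarianceAlgebra t θ) : OpFamily G Ω) ω 0 n

end Linear

variable {d L : ℕ}

theorem periodize_sum_mul {ι : Type*} (s : Finset ι) (c : ι → ℂ)
    {f : ι → PerConfig d L → Lattice d → ℂ} (hf : ∀ i ∈ s, ∃ A, L1Bound (fun _ => 1) (f i) A)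
    (ω : TorusConfig d L) (p : Torus d L) :
    periodize (fun ω n => ∑ i ∈ s, c i * f i ω n) ω p = ∑ i ∈ s, c i * periodize (f i) ω p := by
  simp only [periodize, ← tsum_mul_left]
  rw [← Summable.tsum_finsetSum]
  · refine tsum_congr fun n => ?_
    split_ifs <;> simp
  · intro i hi
    obtain ⟨A, a, a0, a1, a2, -⟩ := hf i hi
    simp only [mul_one] at a1
    exact (Summable.of_norm_bounded a2 fun n => norm_ite_le (a1 _ n)).mul_left _

theorem spectrum_hPer_eq {F : Matrix (Fin d) (Fin d) ℝ} (hF : IsQuantized L F) (W : ℝ) :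
    ∃ K : Set ℝ, IsCompact K ∧ K.Nonempty ∧ spectrum ℂ (hPer L F W) = Complex.ofReal '' K := by
  have hsa := isSelfAdjoint_hPer L hF.1 W
  have h : spectrum ℂ (hPer L F W) =
      Complex.ofReal '' (Complex.ofReal ⁻¹' spectrum ℂ (hPer L F W)) := by
    refine (Set.image_preimage_eq_of_subset fun z hz => ?_).symm
    exact ⟨z.re, (hsa.mem_spectrum_eq_re hz).symm⟩
  refine ⟨_, Complex.isometry_ofReal.isClosedEmbedding.isCompact_preimage (spectrum.isCompact _), ?_, h⟩
  have := spectrum.nonempty (hPer L F W)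
  rw [h] at this
  exact Set.image_nonempty.1 this

theorem continuousOn_spectrum {σ : Set ℂ} {κ : ℝ} (hκ : 0 < κ) {Φ : ℂ → ℂ}
    (hΦ : AnalyticOnNhd ℂ Φ {z | Metric.infDist z σ ≤ κ}) : ContinuousOn Φ σ :=
  hΦ.continuousOn.mono fun z hz => by
    exact (Metric.infDist_zero_of_mem hz).trans_le hκ.le

/-- The nodes and coefficients come from a scalar approximation on σ(h), which contains σ(h̃). The
same combination of resolvents therefore approximates both Φ(h) and Φ(h̃), and periodization maps
one to the other. Decay holds term by term, as the nodes stay at distance at least κ - ε ≥ ρ, and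
the total coefficient weight is controlled by Φ̄. -/
theorem exists_resolvent_approx (hL : 1 ≤ L) {F : Matrix (Fin d) (Fin d) ℝ} (hF : IsQuantized L F)
    (W : ℝ) {κ ρ ξ ξ' ε : ℝ} (hξ : 0 < ξ) (hξ' : ξ < ξ') (hρ : 2 * d * Real.sinh ξ' < ρ)
    (hε : 0 < ε) (hρε : ρ ≤ κ - ε) {Φ : ℂ → ℂ}
    (hΦ : AnalyticOnNhd ℂ Φ {z | Metric.infDist z (spectrum ℂ (hPer L F W)) ≤ κ}) :
    ∃ (a : PerAlgebra L F) (b : TorusAlgebra L F), ‖cfc Φ (hPer L F W) - a‖ ≤ ε ∧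
      ‖cfc Φ (hTorus L F W) - b‖ ≤ ε ∧
      (∀ ω n, ‖toFun perTranslate (magForm F) a ω n‖ ≤
        (6 * contourMean (spectrum ℂ (hPer L F W)) κ Φ + ε) *
          (1 / (ρ - 2 * d * Real.sinh ξ') * Real.exp (-ξ * nrm n))) ∧
      periodize (toFun perTranslate (magForm F) a) = toFun rotate (torusForm F) b := by
  have hnP : IsStarNormal (hPer L F W) := (isSelfAdjoint_hPer L hF.1 W).isStarNormal
  have hnT : IsStarNormal (hTorus L F W) := (isSelfAdjoint_hTorus L hF.1 W).isStarNormal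
  have hsinh : 0 ≤ Real.sinh ξ' := Real.sinh_nonneg_iff.2 (hξ.trans hξ').le
  have hρ0 : 0 < ρ := lt_of_le_of_lt (by positivity) hρ
  have hκ : 0 < κ := by linarith
  have hsub := spectrum_hTorus_subset hL hF W
  have hcont := continuousOn_spectrum hκ hΦ
  obtain ⟨K, hK, hKne, hKs⟩ := spectrum_hPer_eq hF W
  have hΦ' := hΦ.differentiableOn
  rw [hKs] at hΦ'
  obtain ⟨s, z, c, hz, hc, happ⟩ := exists_cauchy_approx hK hKne hκ hΦ' hε
  rw [← hKs] at hz hc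
  have happ' : ∀ t ∈ spectrum ℂ (hPer L F W), ‖Φ t - ∑ i ∈ s, c i / (z i - t)‖ ≤ ε := by
    rw [hKs]
    rintro _ ⟨t, ht, rfl⟩
    exact happ t ht
  have hzρ : ∀ i ∈ s, ρ ≤ Metric.infDist (z i) (spectrum ℂ (hPer L F W)) :=
    fun i hi => hρε.trans (hz i hi)
  have hzn : ∀ i ∈ s, z i ∉ spectrum ℂ (hPer L F W) :=
    fun i hi => notMem_spectrum_of_infDist hρ0 (hzρ i hi)
  refine ⟨∑ i ∈ s, c i • resPer L F W (z i), ∑ i ∈ s, c i • resTorus L F W (z i),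
    norm_cfc_sub_sum_res_le _ hcont s z c hzn hε.le happ',
    norm_cfc_sub_sum_res_le _ (hcont.mono hsub) s z c (fun i hi h => hzn i hi (hsub h)) hε.le
      fun t ht => happ' t (hsub ht), fun ω n => ?_, ?_⟩
  · have hpos : 0 ≤ 1 / (ρ - 2 * d * Real.sinh ξ') * Real.exp (-ξ * nrm n) := by
      have := sub_pos.2 hρ
      positivity
    rw [toFun_sum_smul]
    refine (norm_sum_le _ _).trans ?_
    refine le_trans ?_ (mul_le_mul_of_nonneg_right hc hpos)
    rw [Finset.sum_mul]
    refine Finset.sum_le_sum fun i hi => ?_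
    rw [norm_mul, toFun_eq_ent]
    refine mul_le_mul_of_nonneg_left ?_ (norm_nonneg _)
    simpa only [zero_sub, nrm_neg] using norm_ent_res_le hF.1 W hξ.le hξ' hρ (hzρ i hi) ω 0 n
  · have h1 : toFun perTranslate (magForm F) (∑ i ∈ s, c i • resPer L F W (z i)) =
        fun ω n => ∑ i ∈ s, c i * resFun L F W (z i) ω n := by
      funext ω n
      rw [toFun_sum_smul]
      rfl
    rw [h1]
    funext ω p
    rw [periodize_sum_mul s c fun i hi => exists_l1Bound_resFun hF W (hzn i hi), toFun_sum_smul]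
    exact Finset.sum_congr rfl fun i hi => by rw [periodize_resFun hL hF W (hzn i hi)]

/-- Exponential decay of functions of the periodic Hamiltonian. -/
theorem norm_funCalc_le (hL : 1 ≤ L) {F : Matrix (Fin d) (Fin d) ℝ} (hF : IsQuantized L F)
    (W : ℝ) {κ ρ ξ ξ' : ℝ} (hξ : 0 < ξ) (hξ' : ξ < ξ') (hρ : 2 * d * Real.sinh ξ' < ρ)
    (hρκ : ρ < κ) {Φ : ℂ → ℂ}
    (hΦ : AnalyticOnNhd ℂ Φ {z | Metric.infDist z (spectrum ℂ (hPer L F W)) ≤ κ})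
    (ω : PerConfig d L) (n : Lattice d) :
    ‖funCalc perTranslate (magForm F) Φ (hPer L F W) ω n‖ ≤
      6 * contourMean (spectrum ℂ (hPer L F W)) κ Φ *
        (1 / (ρ - 2 * d * Real.sinh ξ') * Real.exp (-ξ * nrm n)) := by
  set D := 1 / (ρ - 2 * d * Real.sinh ξ') * Real.exp (-ξ * nrm n)
  set M := contourMean (spectrum ℂ (hPer L F W)) κ Φ
  have key : ∀ ε, 0 < ε → ε < κ - ρ →
      ‖funCalc perTranslate (magForm F) Φ (hPer L F W) ω n‖ ≤ (6 * M + ε) * D + ε := by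
    intro ε hε hε'
    obtain ⟨a, b, ha, -, hD, -⟩ :=
      exists_resolvent_approx hL hF W hξ hξ' hρ hε (by linarith) hΦ
    have h1 := (norm_toFun_sub_le _ _ (cfc Φ (hPer L F W)) a ω n).trans ha
    calc ‖funCalc perTranslate (magForm F) Φ (hPer L F W) ω n‖
        = ‖toFun perTranslate (magForm F) a ω n + (funCalc perTranslate (magForm F) Φ
            (hPer L F W) ω n - toFun perTranslate (magForm F) a ω n)‖ := by rw [add_sub_cancel]
      _ ≤ _ := (norm_add_le _ _).trans (add_le_add (hD ω n) h1)
  have hlim : Filter.Tendsto (fun ε : ℝ => (6 * M + ε) * D + ε) (nhdsWithin 0 (Set.Ioi 0))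
      (nhds ((6 * M + 0) * D + 0)) :=
    (Continuous.tendsto (by fun_prop) 0).mono_left nhdsWithin_le_nhds
  rw [add_zero, add_zero] at hlim
  refine ge_of_tendsto hlim ?_
  filter_upwards [Ioo_mem_nhdsGT (sub_pos.2 hρκ)] with ε hε
  exact key ε hε.1 hε.2

/-- Periodization intertwines the functional calculi of the two Hamiltonians. -/
theorem periodize_funCalc (hL : 1 ≤ L) {F : Matrix (Fin d) (Fin d) ℝ} (hF : IsQuantized L F)
    (W : ℝ) {κ ρ ξ ξ' : ℝ} (hξ : 0 < ξ) (hξ' : ξ < ξ') (hρ : 2 * d * Real.sinh ξ' < ρ)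
    (hρκ : ρ < κ) {Φ : ℂ → ℂ}
    (hΦ : AnalyticOnNhd ℂ Φ {z | Metric.infDist z (spectrum ℂ (hPer L F W)) ≤ κ}) :
    periodize (funCalc perTranslate (magForm F) Φ (hPer L F W)) =
      funCalc rotate (torusForm F) Φ (hTorus L F W) := by
  set M := contourMean (spectrum ℂ (hPer L F W)) κ Φ
  have hε : ∀ k : ℕ, 0 < (κ - ρ) / (k + 1) := fun k => div_pos (sub_pos.2 hρκ) (by positivity)
  have hε1 : ∀ k : ℕ, (κ - ρ) / (k + 1) ≤ κ - ρ := fun k =>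
    div_le_self (sub_pos.2 hρκ).le (by linarith [(Nat.cast_nonneg k : (0 : ℝ) ≤ k)])
  have hε0 : Filter.Tendsto (fun k : ℕ => (κ - ρ) / ((k : ℝ) + 1)) Filter.atTop (nhds 0) := by
    simpa [div_eq_mul_inv] using
      (tendsto_one_div_add_atTop_nhds_zero_nat (𝕜 := ℝ)).const_mul (κ - ρ)
  choose a b ha hb hD hab using fun k =>
    exists_resolvent_approx hL hF W hξ hξ' hρ (hε k) (by linarith [hε1 k]) hΦ
  have hta : ∀ ω n, Filter.Tendsto (fun k => toFun perTranslate (magForm F) (a k) ω n) Filter.atTop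
      (nhds (funCalc perTranslate (magForm F) Φ (hPer L F W) ω n)) := by
    intro ω n
    rw [tendsto_iff_norm_sub_tendsto_zero]
    refine squeeze_zero (fun _ => norm_nonneg _) (fun k => ?_) hε0
    rw [norm_sub_rev]
    exact (norm_toFun_sub_le _ _ _ _ ω n).trans (ha k)
  have htb : ∀ ω n, Filter.Tendsto (fun k => toFun rotate (torusForm F) (b k) ω n) Filter.atTop
      (nhds (funCalc rotate (torusForm F) Φ (hTorus L F W) ω n)) := by
    intro ω n
    rw [tendsto_iff_norm_sub_tendsto_zero]
    refine squeeze_zero (fun _ => norm_nonneg _) (fun k => ?_) hε0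
    rw [norm_sub_rev]
    exact (norm_toFun_sub_le _ _ _ _ ω n).trans (hb k)
  funext ω p
  refine tendsto_nhds_unique ?_ (htb ω p)
  simp only [← hab]
  -- The norm approximation controls each value but not the infinite sum over a fibre; the decay
  -- bound, uniform in k, serves as dominating function.
  refine tendsto_tsum_of_dominated_convergence (bound := fun n => (6 * M + (κ - ρ)) *
    (1 / (ρ - 2 * d * Real.sinh ξ') * Real.exp (-ξ * nrm n)))
    (((summable_exp_neg_nrm hξ d).mul_left _).mul_left _) (fun n => ?_)
    (Filter.Eventually.of_forall fun k n => norm_ite_le ((hD k _ n).trans ?_))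
  · split_ifs
    · exact hta _ n
    · exact tendsto_const_nhds
  · have := sub_pos.2 hρ
    gcongr
    exact hε1 k

end Calculus

/-! ### Membership in the algebras -/

section Membership

variable {G Ω : Type} [AddCommGroup G] [TopologicalSpace Ω] [CompactSpace Ω]
  (t : G → Ω → Ω) (θ : G → G → ℝ)

theorem norm_rep_le {f : Ω → G → ℂ} (hf : IsCompactlySupported f) {s : G} {C : ℝ} (hC : 0 ≤ C)
    (hs : ∀ ω n, n ≠ s → f ω n = 0) (h : ∀ ω, ‖f ω s‖ ≤ C) : ‖rep t θ hf‖ ≤ C := by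
  refine lp.norm_le_of_forall_le hC fun ω => ?_
  refine ContinuousLinearMap.opNorm_le_bound _ hC fun φ => ?_
  have hb : ∀ p, ‖f (t (-p) ω) s * phase (θ (p + s) p)‖ ≤ C := fun p => by
    simpa [norm_phase] using h _
  have h1 : rep t θ hf ω φ = (⟨_, memℓp_shift _ hb s φ⟩ : Ell2 G) := by
    ext p
    change repAt t θ hf ω φ p = f (t (-p) ω) s * phase (θ (p + s) p) * φ (p + s)
    rw [repAt_apply, tsum_eq_single (p + s), add_sub_cancel_left]
    intro q hq
    rw [hs _ (q - p) fun e => hq (by rw [← e]; abel)]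
    simp
  rw [h1]
  exact norm_shift_le _ hC hb s φ

/-- A continuous function with `∑_n sup_ω |f(ω, n)| < ∞` belongs to the algebra. -/
theorem exists_toFun_eq (t0 : ∀ ω, t 0 ω = ω) (θ0 : ∀ p, θ p 0 = 0) {f : Ω → G → ℂ} {A : ℝ}
    (hf : L1Bound (fun _ => 1) f A) (cf : ∀ n, Continuous fun ω => f ω n) :
    ∃ a : covarianceAlgebra t θ, toFun t θ a = f := by
  classical
  obtain ⟨a, a0, a1, a2, -⟩ := hf
  simp only [mul_one] at a1
  have hs : ∀ s, IsCompactlySupported fun ω n => if n = s then f ω n else 0 := fun s =>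
    { continuous := fun n => by
        split_ifs
        · exact cf n
        · exact continuous_const
      finite := (Set.finite_singleton s).subset fun n ⟨ω, hn⟩ => by
        by_contra h
        exact hn (if_neg h) }
  have hsum : Summable fun s => ofFun t θ (hs s) := by
    refine Summable.of_norm_bounded a2 fun s => ?_
    exact norm_rep_le t θ (hs s) (a0 s) (fun ω n hn => if_neg hn) fun ω => by simpa using a1 ω s
  refine ⟨∑' s, ofFun t θ (hs s), ?_⟩
  funext ω p
  let T : covarianceAlgebra t θ →L[ℂ] ℂ :=
    (entL ω 0 p).comp (covarianceAlgebra t θ).toSubalgebra.toSubmodule.subtypeL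
  have h1 := hsum.hasSum.mapL T
  have h2 : ∀ s, T (ofFun t θ (hs s)) = if s = p then f ω p else 0 := by
    intro s
    change ent (rep t θ (hs s)) ω 0 p = _
    rw [ent_rep, neg_zero, t0, sub_zero, θ0, phase_zero, mul_one]
    simp only [eq_comm]
  simp only [h2] at h1
  exact h1.unique (hasSum_ite_eq p (f ω p))

variable {d L : ℕ} {F : Matrix (Fin d) (Fin d) ℝ}

theorem memPer_of_l1Bound {f : PerConfig d L → Lattice d → ℂ} {A : ℝ}
    (hf : L1Bound (fun _ => 1) f A) (cf : ∀ n, Continuous fun ω => f ω n) : MemPer F f :=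
  exists_toFun_eq _ _ (fun ω => Subtype.ext (funext fun n => by simp [perTranslate, translate]))
    (magForm_zero_right F) hf cf

theorem memTorus_of_continuous {f : TorusConfig d L → Torus d L → ℂ}
    (cf : ∀ p, Continuous fun ω => f ω p) : MemTorus F f := by
  obtain ⟨B, hB⟩ := (isCompactlySupported_of_finite cf).exists_l1Bound
  exact exists_toFun_eq _ _ (fun ω => funext fun n => by simp [rotate])
    (torusForm_zero_right F) hB cf

end Membership

/-! ### Comparison of the correlation functions -/

section Correlations

variable {d L : ℕ}

instance instIsProbabilityMeasureTorus (d L : ℕ) : IsProbabilityMeasure (torusMeasure d L) := by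
  have h : IsProbabilityMeasure ((volume : Measure ℝ).comap (Subtype.val : Amp → ℝ)) := by
    refine ⟨?_⟩
    rw [Measure.comap_apply _ Subtype.val_injective
      (fun s hs => measurableSet_Icc.subtype_image hs) _ MeasurableSet.univ, Set.image_univ,
      Subtype.range_coe, Real.volume_Icc]
    norm_num
  rw [torusMeasure]
  infer_instance

theorem trace_perMeasure {f : PerConfig d L → Lattice d → ℂ} (cf : Continuous fun ω => f ω 0) :
    trace (perMeasure d L) f = ∫ ω, f (unroll ω) 0 ∂torusMeasure d L :=
  integral_map (continuous_unroll d L).measurable.aemeasurable cf.aestronglyMeasurable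

theorem L1Bound.norm_zero_le {G Ω : Type} [AddCommGroup G] {f : Ω → G → ℂ} {A : ℝ}
    (h : L1Bound (fun _ => 1) f A) (ω : Ω) : ‖f ω 0‖ ≤ A := by
  obtain ⟨a, a0, a1, a2, hA⟩ := h
  have := a1 ω 0
  rw [mul_one] at this
  exact (this.trans (a2.le_tsum 0 fun n _ => a0 n)).trans hA

/-- Two errors are added at the site 0. Replacing the factors f_j by g_j one at a time gives Nε;
comparing the product of the g_j with its own periodization, which is the torus product of the
`periodize (g j)`, gives e^{-ηL}. -/
theorem norm_perCorr_sub_torusCorr_le {F : Matrix (Fin d) (Fin d) ℝ} (hF : IsQuantized L F) {N : ℕ}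
    {f g : Fin N → PerConfig d L → Lattice d → ℂ} {A : Fin N → ℝ} {η ε : ℝ} (hη : 0 ≤ η)
    (hf : ∀ j, L1Bound (fun n => Real.exp (η * nrm n)) (f j) (A j))
    (hg : ∀ j, L1Bound (fun n => Real.exp (η * nrm n)) (g j) (A j))
    (hfg : ∀ j, L1Bound (fun _ => 1) (fun ω n => f j ω n - g j ω n) (ε * A j))
    (cf : ∀ j n, Continuous fun ω => f j ω n) (cg : ∀ j n, Continuous fun ω => g j ω n) :
    ‖perCorr F f - torusCorr F fun j => periodize (g j)‖ ≤
      (N * ε + Real.exp (-η * L)) * ∏ j, A j := by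
  have hw := isWeight_exp (d := d) hη
  have hf1 := fun j => (hf j).toOne hw
  have hg1 := fun j => (hg j).toOne hw
  have cF := continuous_convProd perTranslate (magForm F) continuous_perTranslate hf1 cf 0
  have cG := fun n => continuous_convProd perTranslate (magForm F) continuous_perTranslate hg1 cg n
  have hG := L1Bound.convProd perTranslate (magForm F) hw hg
  have cP := continuous_periodize (hG.toOne hw) cG 0
  have cU : Continuous fun ω => convProd perTranslate (magForm F) f (unroll ω) 0 :=
    cF.comp (continuous_unroll d L)
  rw [perCorr, torusCorr, trace_perMeasure cF, ← periodize_convProd hF hg1, trace]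
  have hint : ∀ {u : TorusConfig d L → ℂ}, Continuous u → Integrable u (torusMeasure d L) :=
    fun hu => hu.integrable_of_hasCompactSupport (HasCompactSupport.of_compactSpace _)
  rw [← integral_sub (hint cU) (hint cP)]
  refine (norm_integral_le_of_norm_le_const (C := (N * ε + Real.exp (-η * L)) * ∏ j, A j)
    (Filter.Eventually.of_forall fun ω => ?_)).trans_eq (by simp)
  have h1 := (L1Bound.convProd_sub perTranslate (magForm F) hf1 hg1 hfg).norm_zero_le (unroll ω)
  have h2 := norm_periodize_sub_le hη hG ω
  refine (norm_sub_le_norm_sub_add_norm_sub _ (convProd perTranslate (magForm F) g (unroll ω) 0)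
    _).trans ((add_le_add h1 h2).trans_eq (by ring))

/-- The symbol `∏_j (i x_j)^{α_j}` of the derivation `∂_α`. -/
def derivSymbol (α : Fin d → ℕ) (x : Fin d → ℝ) : ℂ := ∏ j, (Complex.I * (x j : ℂ)) ^ α j

theorem norm_derivSymbol (α : Fin d → ℕ) (x : Fin d → ℝ) :
    ‖derivSymbol α x‖ = ∏ j, |x j| ^ α j := by
  simp [derivSymbol, norm_prod]

theorem norm_derivSymbol_mono (α : Fin d → ℕ) {x y : Fin d → ℝ} (h : ∀ j, |x j| ≤ |y j|) :
    ‖derivSymbol α x‖ ≤ ‖derivSymbol α y‖ := by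
  rw [norm_derivSymbol, norm_derivSymbol]
  exact Finset.prod_le_prod (fun _ _ => by positivity) fun j _ =>
    pow_le_pow_left₀ (abs_nonneg _) (h j) _

theorem exists_norm_derivSymbol_le (α : Fin d → ℕ) {δ : ℝ} (hδ : 0 < δ) :
    ∃ Q : ℝ, 0 ≤ Q ∧ ∀ n : Lattice d,
      ‖derivSymbol α fun j => (n j : ℝ)‖ ≤ Q * Real.exp (δ * nrm n) := by
  refine ⟨(∑ j, α j).factorial / δ ^ ∑ j, α j, by positivity, fun n => ?_⟩
  rw [norm_derivSymbol]
  calc ∏ j, |(n j : ℝ)| ^ α j ≤ ∏ j, nrm n ^ α j :=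
        Finset.prod_le_prod (fun _ _ => by positivity) fun j _ =>
          pow_le_pow_left₀ (abs_nonneg _) (abs_le_nrm n j) _
    _ = nrm n ^ ∑ j, α j := Finset.prod_pow_eq_pow_sum _ _ _
    _ ≤ _ := by
        have h := Real.pow_div_factorial_le_exp (δ * nrm n) (mul_nonneg hδ.le (nrm_nonneg n))
          (∑ j, α j)
        rw [div_le_iff₀ (by positivity), mul_pow] at h
        rw [div_mul_eq_mul_div, le_div_iff₀ (by positivity)]
        linarith

theorem contourMean_nonneg (σ : Set ℂ) (κ : ℝ) (Φ : ℂ → ℂ) : 0 ≤ contourMean σ κ Φ :=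
  mul_nonneg (by positivity) (integral_nonneg fun _ => norm_nonneg _)

/-- Correlation functions of `∂_α Φ(h)` in the periodic algebra, compared with those of the
periodizations of `b Φ(h)`, where `b` agrees with the symbol of `∂_α` on a large cube. -/
theorem exists_corr_bound (hd : 0 < d) {N : ℕ} (α : Fin N → Fin d → ℕ) {κ ξ : ℝ} (hξ : 0 < ξ)
    (hξκ : ξ < Real.arsinh (κ / (2 * d))) :
    ∃ B : ℝ, ∀ L : ℕ, 1 ≤ L → ∀ F : Matrix (Fin d) (Fin d) ℝ, IsQuantized L F →
      ∀ (W : ℝ) (Φ : Fin N → ℂ → ℂ),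
        (∀ j, AnalyticOnNhd ℂ (Φ j) {z | Metric.infDist z (spectrum ℂ (hPer L F W)) ≤ κ}) →
        (∀ j, MemPer F (perDerivCalc (α j) (Φ j) (hPer L F W))) ∧
        ∀ b : Fin N → Lattice d → ℂ,
        (∀ j n, ‖b j n‖ ≤ ‖derivSymbol (α j) fun k => (n k : ℝ)‖) →
        (∀ j n, (∀ k, |(n k : ℝ)| < L / √2) → b j n = derivSymbol (α j) fun k => (n k : ℝ)) →
        (∀ j p, Continuous fun ω => periodize (fun ω n =>
          b j n * funCalc perTranslate (magForm F) (Φ j) (hPer L F W) ω n) ω p) ∧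
        ‖perCorr F (fun j => perDerivCalc (α j) (Φ j) (hPer L F W)) - torusCorr F fun j =>
          periodize fun ω n => b j n * funCalc perTranslate (magForm F) (Φ j) (hPer L F W) ω n‖
          ≤ B * (∏ j, contourMean (spectrum ℂ (hPer L F W)) κ (Φ j)) *
            Real.exp (-(ξ / 2) * L) := by
  have hd' : (0 : ℝ) < d := by exact_mod_cast hd
  -- Three rates ξ < ξ₁ < ξ₂. The Combes–Thomas bound is run with ξ₂, for which 2d sinh ξ₂ < ρ < κ
  -- leaves room for nodes inside the curve. It yields decay at rate ξ₁, and the gap ξ₁ - ξ absorbs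
  -- the polynomial symbols.
  obtain ⟨ξ₂, h2, h2'⟩ := exists_between hξκ
  obtain ⟨ξ₁, h1, h1'⟩ := exists_between h2
  have hs : 2 * d * Real.sinh ξ₂ < κ := by
    have h := Real.sinh_lt_sinh.2 h2'
    rw [Real.sinh_arsinh, lt_div_iff₀ (by positivity)] at h
    linarith
  obtain ⟨ρ, hρ, hρκ⟩ := exists_between hs
  have hC : 0 < 1 / (ρ - 2 * d * Real.sinh ξ₂) := one_div_pos.2 (sub_pos.2 hρ)
  set C := 1 / (ρ - 2 * d * Real.sinh ξ₂) with hCd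
  choose Q hQ0 hQ using fun j => exists_norm_derivSymbol_le (α j) (sub_pos.2 h1)
  have hr : √2 * √2 = 2 := Real.mul_self_sqrt zero_le_two
  have hr0 : 0 < √2 := by positivity
  -- Where some |n_k| ≥ L/√2, the share (√2/2)ξ of the decay already gives e^{-ξL/2}; τ > 0 is what
  -- remains for summing over n.
  set τ : ℝ := (1 - √2 / 2) * ξ with hτ
  have hτ0 : 0 < τ := mul_pos (by nlinarith) hξ
  set S : ℝ := expSum d (ξ / 2) + expSum d τ with hS
  have hS1 : expSum d (ξ / 2) ≤ S := le_add_of_nonneg_right (expSum_nonneg _ _)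
  have hS2 : expSum d τ ≤ S := le_add_of_nonneg_left (expSum_nonneg _ _)
  -- The term 2N is the telescoping error with ε = 2e^{-ξL/2}, and 1 is the periodization error with
  -- η = ξ/2. The enlarged sum S serves both the weighted bounds and the bound on the difference.
  refine ⟨(2 * N + 1) * ∏ j, 6 * C * Q j * S, fun L hL F hF W Φ hΦ => ?_⟩
  set M : Fin N → ℝ := fun j => contourMean (spectrum ℂ (hPer L F W)) κ (Φ j) with hM
  have hM0 : ∀ j, 0 ≤ M j := fun j => contourMean_nonneg _ _ _
  set φ : Fin N → PerConfig d L → Lattice d → ℂ := fun j =>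
    funCalc perTranslate (magForm F) (Φ j) (hPer L F W) with hφ
  have cφ : ∀ j n, Continuous fun ω => φ j ω n := fun j n => continuous_toFun_per F _ n
  set D : Fin N → ℝ := fun j => M j * (6 * C * Q j) with hD
  have hD0 : ∀ j, 0 ≤ D j := fun j => by
    have := hM0 j
    have := hQ0 j
    positivity
  have hdec : ∀ (b : Fin N → Lattice d → ℂ),
      (∀ j n, ‖b j n‖ ≤ ‖derivSymbol (α j) fun k => (n k : ℝ)‖) → ∀ j ω n,
      ‖b j n * φ j ω n‖ ≤ D j * Real.exp (-ξ * nrm n) := by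
    intro b hb j ω n
    rw [norm_mul]
    calc ‖b j n‖ * ‖φ j ω n‖
        ≤ (Q j * Real.exp ((ξ₁ - ξ) * nrm n)) * (6 * M j * (C * Real.exp (-ξ₁ * nrm n))) :=
          mul_le_mul ((hb j n).trans (hQ j n))
            (norm_funCalc_le hL hF W (hξ.trans h1) h1' hρ hρκ (hΦ j) ω n) (norm_nonneg _)
            (mul_nonneg (hQ0 j) (Real.exp_pos _).le)
      _ = D j * (Real.exp ((ξ₁ - ξ) * nrm n) * Real.exp (-ξ₁ * nrm n)) := by
          simp only [hD]
          ring
      _ = D j * Real.exp (-ξ * nrm n) := by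
          rw [← Real.exp_add]
          congr 2
          ring
  have hbd : ∀ (b : Fin N → Lattice d → ℂ),
      (∀ j n, ‖b j n‖ ≤ ‖derivSymbol (α j) fun k => (n k : ℝ)‖) → ∀ j,
      L1Bound (fun n => Real.exp (ξ / 2 * nrm n)) (fun ω n => b j n * φ j ω n) (D j * S) := by
    intro b hb j
    refine (L1Bound.of_exp (half_pos hξ) (hD0 j) fun ω n => ?_).mono
      (mul_le_mul_of_nonneg_left hS1 (hD0 j))
    refine (mul_le_mul_of_nonneg_right (hdec b hb j ω n) (Real.exp_pos _).le).trans_eq ?_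
    rw [mul_assoc, ← Real.exp_add]
    congr 2
    ring
  have hw := isWeight_exp (d := d) (half_pos hξ).le
  set c : Fin N → Lattice d → ℂ := fun j n => derivSymbol (α j) fun k => (n k : ℝ) with hc
  have hcb := hbd c fun _ _ => le_rfl
  have hcc : ∀ j n, Continuous fun ω => c j n * φ j ω n := fun j n =>
    continuous_const.mul (cφ j n)
  refine ⟨fun j => memPer_of_l1Bound ((hcb j).toOne hw) (hcc j), fun b hb hbc => ?_⟩
  have hbb := hbd b hb
  have hbcont : ∀ j n, Continuous fun ω => b j n * φ j ω n := fun j n =>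
    continuous_const.mul (cφ j n)
  refine ⟨fun j p => continuous_periodize ((hbb j).toOne hw) (hbcont j) p, ?_⟩
  have hdiff : ∀ j, L1Bound (fun _ => 1) (fun ω n => c j n * φ j ω n - b j n * φ j ω n)
      (2 * Real.exp (-(ξ / 2) * L) * (D j * S)) := by
    intro j
    refine (L1Bound.of_exp (C := 2 * Real.exp (-(ξ / 2) * L) * D j) hτ0
      (mul_nonneg (by positivity) (hD0 j)) fun ω n => ?_).mono ?_
    · rw [mul_one]
      by_cases hn : ∀ k, |(n k : ℝ)| < L / √2
      · rw [hbc j n hn, sub_self, norm_zero]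
        exact mul_nonneg (mul_nonneg (by positivity) (hD0 j)) (Real.exp_pos _).le
      · push Not at hn
        obtain ⟨k, hk⟩ := hn
        have hk' : L / √2 ≤ nrm n := hk.trans (abs_le_nrm n k)
        rw [div_le_iff₀ hr0] at hk'
        have hexp : Real.exp (-ξ * nrm n) ≤ Real.exp (-(ξ / 2) * L) * Real.exp (-τ * nrm n) := by
          rw [← Real.exp_add, Real.exp_le_exp, hτ]
          nlinarith [mul_le_mul_of_nonneg_left hk' hξ.le]
        calc ‖c j n * φ j ω n - b j n * φ j ω n‖
            ≤ D j * Real.exp (-ξ * nrm n) + D j * Real.exp (-ξ * nrm n) :=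
              (norm_sub_le _ _).trans
                (add_le_add (hdec c (fun _ _ => le_rfl) j ω n) (hdec b hb j ω n))
          _ = 2 * D j * Real.exp (-ξ * nrm n) := by ring
          _ ≤ 2 * D j * (Real.exp (-(ξ / 2) * L) * Real.exp (-τ * nrm n)) :=
              mul_le_mul_of_nonneg_left hexp (by linarith [hD0 j])
          _ = _ := by ring
    · have : (0 : ℝ) ≤ 2 * Real.exp (-(ξ / 2) * L) * D j := mul_nonneg (by positivity) (hD0 j)
      nlinarith [mul_le_mul_of_nonneg_left hS2 this]
  refine (norm_perCorr_sub_torusCorr_le hF (half_pos hξ).le hcb hbb hdiff hcc hbcont).trans_eq ?_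
  have hprod : ∏ j, D j * S = (∏ j, M j) * ∏ j, 6 * C * Q j * S := by
    rw [← Finset.prod_mul_distrib]
    refine Finset.prod_congr rfl fun j _ => ?_
    simp only [hD]
    ring
  rw [hprod]
  ring

end Correlations

/-! ### The torus functions as periodizations -/

section Reduction

variable {d L : ℕ} {F : Matrix (Fin d) (Fin d) ℝ}

theorem periodize_symbol_mul (g : Torus d L → ℂ) (φ : PerConfig d L → Lattice d → ℂ) :
    (periodize fun ω n => g (wrap L n) * φ ω n) = fun ω p => g p * periodize φ ω p := by
  funext ω p
  rw [periodize, periodize, ← tsum_mul_left]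
  refine tsum_congr fun n => ?_
  split_ifs with h
  · rw [h]
  · rw [mul_zero]

/-- Every fibre of `wrap` meets the cell {-L, …, L}^d exactly once, so after truncation to the cell
a single term survives. Thus the map P is itself a periodization. -/
theorem periodize_cell_mul (c : Lattice d → ℂ) (φ : PerConfig d L → Lattice d → ℂ) :
    (periodize fun ω n => (if n = coord (wrap L n) then c n else 0) * φ ω n) =
      mapP fun ω n => c n * φ ω n := by
  funext ω p
  rw [periodize, tsum_eq_single (coord p)]
  · simp [mapP]
  · intro n hn
    split_ifs with h h'
    · exact absurd (h'.trans (by rw [h])) hn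
    · rw [zero_mul]
    · rfl

theorem coord_wrap_of_abs_lt {n : Lattice d} (h : ∀ k, |(n k : ℝ)| < L / √2) :
    coord (wrap L n) = n := by
  refine coord_wrap fun k => ?_
  have h1 : (L : ℝ) / √2 ≤ L := div_le_self (Nat.cast_nonneg L) (Real.one_le_sqrt.2 one_le_two)
  have h2 := (h k).le.trans h1
  rw [← Int.cast_abs] at h2
  exact_mod_cast h2

theorem mapP_perDerivCalc (α : Fin d → ℕ) (Φ : ℂ → ℂ) (a : PerAlgebra L F) :
    mapP (perDerivCalc α Φ a) = periodize fun ω n =>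
      (if n = coord (wrap L n) then derivSymbol α fun k => (n k : ℝ) else 0) *
        funCalc perTranslate (magForm F) Φ a ω n :=
  (periodize_cell_mul _ _).symm

end Reduction

end NCTorus

end

/-! ### The main theorem -/

theorem mainTheorem8 (d : ℕ) (hd : 0 < d) (N : ℕ) (α : Fin N → Fin d → ℕ) (κ ξ : ℝ)
    (hξ : 0 < ξ) (hξκ : ξ < Real.arsinh (κ / (2 * d))) :
    (∃ B₃ : ℝ, ∀ L : ℕ, 1 ≤ L → ∀ F : Matrix (Fin d) (Fin d) ℝ, NCTorus.IsQuantized L F →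
      ∀ (W : ℝ) (Φ : Fin N → ℂ → ℂ),
        (∀ j, AnalyticOnNhd ℂ (Φ j)
          {z | Metric.infDist z (spectrum ℂ (NCTorus.hPer L F W)) ≤ κ}) →
        ∀ f : Fin N → NCTorus.PerConfig d L → NCTorus.Lattice d → ℂ,
        (∀ j, f j = NCTorus.perDerivCalc (α j) (Φ j) (NCTorus.hPer L F W)) →
        (∀ j, NCTorus.MemPer F (f j)) ∧
        (∀ j, NCTorus.MemTorus F (NCTorus.mapP (f j))) ∧
        ‖NCTorus.perCorr F f - NCTorus.torusCorr F (fun j => NCTorus.mapP (f j))‖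
          ≤ B₃ * (∏ j, NCTorus.contourMean (spectrum ℂ (NCTorus.hPer L F W)) κ (Φ j))
            * Real.exp (-(ξ / 2) * L)) ∧
    (∃ B₄ : ℝ, ∀ L : ℕ, 1 ≤ L → ∀ F : Matrix (Fin d) (Fin d) ℝ, NCTorus.IsQuantized L F →
      ∀ 𝔵 : ZMod (2 * L + 1) → ℝ, NCTorus.IsApproxCoord L 𝔵 →
      ∀ (W : ℝ) (Φ : Fin N → ℂ → ℂ),
        (∀ j, AnalyticOnNhd ℂ (Φ j)
          {z | Metric.infDist z (spectrum ℂ (NCTorus.hJ L F W)) ≤ κ}) →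
        ∀ (f : Fin N → NCTorus.PerConfig d L → NCTorus.Lattice d → ℂ)
          (f' : Fin N → NCTorus.TorusConfig d L → NCTorus.Torus d L → ℂ),
        (∀ j, f j = NCTorus.perDerivCalc (α j) (Φ j) (NCTorus.hJ L F W)) →
        (∀ j, f' j = NCTorus.torusDerivCalc 𝔵 (α j) (Φ j) (NCTorus.hTorus L F W)) →
        (∀ j, NCTorus.MemPer F (f j)) ∧
        (∀ j, NCTorus.MemTorus F (f' j)) ∧
        ‖NCTorus.perCorr F f - NCTorus.torusCorr F f'‖
          ≤ B₄ * (∏ j, NCTorus.contourMean (spectrum ℂ (NCTorus.hJ L F W)) κ (Φ j))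
            * Real.exp (-(ξ / 2) * L) ∧
        (0 < ∏ j, NCTorus.contourMean (spectrum ℂ (NCTorus.hJ L F W)) κ (Φ j) →
          ‖NCTorus.perCorr F f - NCTorus.torusCorr F f'‖
            < B₄ * (∏ j, NCTorus.contourMean (spectrum ℂ (NCTorus.hJ L F W)) κ (Φ j))
              * Real.exp (-(ξ / 2) * L))) := by
  have hd' : (0 : ℝ) < d := by exact_mod_cast hd
  obtain ⟨ξ₂, h1, h2⟩ := exists_between hξκ
  have hs : 2 * d * Real.sinh ξ₂ < κ := by
    have h := Real.sinh_lt_sinh.2 h2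
    rw [Real.sinh_arsinh, lt_div_iff₀ (by positivity)] at h
    linarith
  obtain ⟨ρ, hρ, hρκ⟩ := exists_between hs
  obtain ⟨B, hB⟩ := NCTorus.exists_corr_bound hd α hξ hξκ
  -- The added 1 in the second constant turns the weak inequality into a strict one as soon as the
  -- product of the means is positive.
  refine ⟨⟨B, fun L hL F hF W Φ hΦ f hf => ?_⟩, ⟨B + 1, fun L hL F hF 𝔵 h𝔵 W Φ hΦ f f' hf hf' => ?_⟩⟩
  · obtain rfl : f = _ := funext hf
    obtain ⟨hm, hb⟩ := hB L hL F hF W Φ hΦ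
    -- For P the symbol is cut off outside the cell, which contains the cube |n_k| < L/√2.
    obtain ⟨hc, hle⟩ := hb (fun j n => if n = NCTorus.coord (NCTorus.wrap L n) then
      NCTorus.derivSymbol (α j) fun k => (n k : ℝ) else 0) (fun j n => NCTorus.norm_ite_le le_rfl)
      fun j n hn => if_pos (NCTorus.coord_wrap_of_abs_lt hn).symm
    simp only [← NCTorus.mapP_perDerivCalc] at hc hle
    exact ⟨hm, fun j => NCTorus.memTorus_of_continuous (hc j), hle⟩
  · rw [NCTorus.hJ_eq_hPer hL] at hΦ ⊢
    simp only [NCTorus.hJ_eq_hPer hL] at hf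
    obtain rfl : f = _ := funext hf
    obtain ⟨hm, hb⟩ := hB L hL F hF W Φ hΦ
    -- For ∂̃ the symbol is evaluated at 𝔵 of the wrapped point. It is dominated by the original
    -- symbol because 𝔵 does not exceed the coordinate in size and wrapping does not increase
    -- coordinates. Being constant on the fibres of `wrap`, it commutes with periodization.
    obtain ⟨hc, hle⟩ := hb (fun j n => NCTorus.derivSymbol (α j) fun k => 𝔵 (NCTorus.wrap L n k))
      (fun j n => NCTorus.norm_derivSymbol_mono _ fun k => by
        have h := NCTorus.abs_coord_wrap_le (L := L) n k
        refine (h𝔵.2 _).trans ?_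
        rw [← Int.cast_abs, ← Int.cast_abs]
        exact_mod_cast h)
      fun j n hn => by
        have h := NCTorus.coord_wrap_of_abs_lt hn
        refine congrArg _ (funext fun k => ?_)
        have hk : (NCTorus.wrap L n k).valMinAbs = n k := congrFun h k
        rw [h𝔵.1 _ (by rw [hk]; exact hn k), hk]
    have hper : ∀ j, (NCTorus.periodize fun ω n =>
        (NCTorus.derivSymbol (α j) fun k => 𝔵 (NCTorus.wrap L n k)) *
          NCTorus.funCalc NCTorus.perTranslate (NCTorus.magForm F) (Φ j)
            (NCTorus.hPer L F W) ω n) = f' j := by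
      intro j
      rw [hf' j, NCTorus.periodize_symbol_mul (fun p => NCTorus.derivSymbol (α j) fun k => 𝔵 (p k)),
        NCTorus.periodize_funCalc hL hF W hξ h1 hρ hρκ (hΦ j)]
      rfl
    simp only [hper] at hc hle
    have hE := Real.exp_pos (-(ξ / 2) * L)
    set P := ∏ j, NCTorus.contourMean (spectrum ℂ (NCTorus.hPer L F W)) κ (Φ j) with hP
    have hP0 : 0 ≤ P := Finset.prod_nonneg fun j _ => NCTorus.contourMean_nonneg _ _ _
    refine ⟨hm, fun j => NCTorus.memTorus_of_continuous (hc j), hle.trans ?_, fun h => ?_⟩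
    · gcongr
      linarith
    · refine hle.trans_lt ?_
      gcongr
      linarith
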